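/- For every constant $C_0$ there are positive constants $C_1,\dots,C_6$, depending only on $C_0$, such that the following holds. Let $n\ge 1$ and let $X_1,\dots,X_n$ be random variables on a probability space with values in $\{0,1,2,\dots\}$ that are $1$-dependent, i.e. $\sigma(X_1,\dots,X_s)$ and $\sigma(X_t,\dots,X_n)$ are independent whenever $1\le s$, $t-s>1$, $t\le n$. Put $X_k\equiv 0$ for $k\le 0$, and let $$S_n=X_1+\dots+X_n,\quad F_n(x)=P(S_n\le x),\quad \lambda=\mathbb E S_n,\quad \Gamma_2=\tfrac12(\operatorname{Var}S_n-\mathbb E S_n),\quad \nu_j(k)=\mathbb E X_k(X_k-1)\cdots(X_k-j+1).$$ Put $\hat{\mathbb E}^+(Y_1,Y_2)=\mathbb E Y_1Y_2+\mathbb E Y_1\mathbb E Y_2$, $\hat{\mathbb E}^+(Y_1,Y_2,Y_3)=\mathbb E Y_1Y_2Y_3+\mathbb E Y_1\,\mathbb E Y_2Y_3+\hat{\mathbb E}^+(Y_1,Y_2)\,\mathbb E Y_3$, $\hat{\mathbb E}^+_2(X_{k-1},X_k)=\hat{\mathbb E}^+(X_{k-1}(X_{k-1}-1),X_k)+\hat{\mathbb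 E}^+(X_{k-1},X_k(X_k-1))$, and $$R_0=\sum_{k=1}^n\{\nu_2(k)+\nu_1^2(k)+\mathbb E X_{k-1}X_k\},$$ $$R_1=\sum_{k=1}^n\{\nu_1^3(k)+\nu_1(k)\nu_2(k)+\nu_3(k)+[\nu_1(k-2)+\nu_1(k-1)+\nu_1(k)]\mathbb E X_{k-1}X_k+\hat{\mathbb E}^+_2(X_{k-1},X_k)+\hat{\mathbb E}^+(X_{k-2},X_{k-1},X_k)\}.$$ Assume that $$\nu_1(k)\le \tfrac1{100},\quad \nu_2(k)\le\nu_1(k),\quad |X_k|\le C_0\ \text{almost surely}\quad(k=1,\dots,n),$$ $$\lambda\ge1,\quad \sum_{k=1}^n\nu_2(k)\le\frac{\lambda}{20},\quad \sum_{k=2}^n|\operatorname{Cov}(X_{k-1},X_k)|\le\frac{\lambda}{20}.$$ With $z=e^{it}-1$, let $\Pi$ be the Poisson distribution with mean $\lambda$, and let $\Pi_1$ and $G$ be the signed measures on $\{0,1,2,\dots\}$ with Fourier–Stieltjes transforms $\Gamma_2z^2e^{\lambda z}$ and $e^{\lambda z+\Gamma_2z^2}$. Let $\tilde\delta\in[0,1)$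 be the fractional part of $-2\Gamma_2$, and let $TP$ be the distribution of $\lfloor-2\Gamma_2\rfloor+Y$, where $Y$ is Poisson with mean $\lambda+2\Gamma_2+\tilde\delta$. If $\Gamma_2>0$, let $NB$ be the negative binomial distribution $NB\{j\}=\frac{\Gamma(r+j)}{j!\,\Gamma(r)}\bar q^{\,r}(1-\bar q)^j$, $j\ge 0$, where $\frac{r(1-\bar q)}{\bar q}=\lambda$ and $r\big(\frac{1-\bar q}{\bar q}\big)^2=2\Gamma_2$. If $\Gamma_2<0$, let $BI$ be the binomial distribution with parameters $N=\lfloor\lambda^2/(2|\Gamma_2|)\rfloor$ and $\bar p=\lambda/N$. For a (signed) measure $M$ on the integers write $M(x)=M((-\infty,x])$. Then, for every $x\in\{0,1,2,\dots\}$, $$\Big(1+\frac{(x-\lambda)^2}{\lambda}\Big)|F_n(x)-\Pi(x)|\le C_1\frac{R_0}{\lambda},$$ $$\Big(1+\frac{(x-\lambda)^2}{\lambda}\Big)|F_n(x)-\Pi(x)-\Pi_1(x)|\le C_2\Big(\frac{R_0^2}{\lambda^2}+\frac{R_1}{\lambda\sqrt\lambda}\Big),$$ $$\Big(1+\frac{(x-\lambda)^2}{\lambda}\Big)|F_n(x)-G(x)|\le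 C_3\frac{R_1}{\lambda\sqrt\lambda},$$ $$\Big(1+\frac{(x-\lambda)^2}{\lambda}\Big)|F_n(x)-TP(x)|\le C_4\Big(\frac{R_1+|\Gamma_2|}{\lambda\sqrt\lambda}+\frac{\tilde\delta}{\lambda}\Big).$$ If in addition $\Gamma_2>0$, then $$\Big(1+\frac{(x-\lambda)^2}{\lambda}\Big)|F_n(x)-NB(x)|\le C_5\Big(\frac{R_1}{\lambda\sqrt\lambda}+\frac{\Gamma_2^2}{\lambda^2\sqrt\lambda}\Big).$$ If instead $\Gamma_2<0$, then $$\Big(1+\frac{(x-\lambda)^2}{\lambda}\Big)|F_n(x)-BI(x)|\le C_6\Big(\frac{R_1}{\lambda\sqrt\lambda}+\frac{\Gamma_2^2}{\lambda^2\sqrt\lambda}\Big).$$ -/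

import Mathlib

open MeasureTheory ProbabilityTheory

namespace MDep

noncomputable section

/-! ### Random variables and their moments

A sequence `X : ℤ → Ω → ℕ` is used for the indices `1, …, n`; the convention `X k ≡ 0` for `k ≤ 0`
is stated in the theorem. -/

section RandomVariables

variable {Ω : Type*} [MeasurableSpace Ω]

/-- The variables `X 1, …, X n` are `m`-dependent: the σ-algebras generated by `X 1, …, X s` and by
`X t, …, X n` are independent whenever `1 ≤ s`, `t - s > m`, `t ≤ n`. -/
def IsMDependent (m : ℕ) (P : Measure Ω) (X : ℤ → Ω → ℕ) (n : ℕ) : Prop :=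
  ∀ s t : ℤ, 1 ≤ s → m < t - s → t ≤ n →
    Indep (⨆ i ∈ Set.Icc 1 s, MeasurableSpace.comap (X i) inferInstance)
      (⨆ i ∈ Set.Icc t (n : ℤ), MeasurableSpace.comap (X i) inferInstance) P

/-- The sum `S_n = X 1 + ⋯ + X n`. -/
def sumS (X : ℤ → Ω → ℕ) (n : ℕ) (ω : Ω) : ℕ := ∑ k ∈ Finset.Icc (1 : ℤ) n, X k ω

/-- The distribution function of `S_n`. -/
def cdfS (P : Measure Ω) (X : ℤ → Ω → ℕ) (n x : ℕ) : ℝ := P.real {ω | sumS X n ω ≤ x}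

/-- `lam = E S_n`. -/
def lam (P : Measure Ω) (X : ℤ → Ω → ℕ) (n : ℕ) : ℝ := ∫ ω, (sumS X n ω : ℝ) ∂P

/-- `Γ₂ = (Var S_n - E S_n) / 2`. -/
def Gam2 (P : Measure Ω) (X : ℤ → Ω → ℕ) (n : ℕ) : ℝ :=
  (variance (fun ω => (sumS X n ω : ℝ)) P - lam P X n) / 2

/-- The `j`-th factorial moment `ν_j(k) = E X_k (X_k - 1) ⋯ (X_k - j + 1)`. -/
def nu (P : Measure Ω) (X : ℤ → Ω → ℕ) (j : ℕ) (k : ℤ) : ℝ :=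
  ∫ ω, ((X k ω).descFactorial j : ℝ) ∂P

/-- `Ê⁺(Y₁, Y₂) = E Y₁Y₂ + E Y₁ E Y₂`. -/
def Eplus2 (P : Measure Ω) (Y₁ Y₂ : Ω → ℝ) : ℝ :=
  (∫ ω, Y₁ ω * Y₂ ω ∂P) + (∫ ω, Y₁ ω ∂P) * ∫ ω, Y₂ ω ∂P

/-- `Ê⁺(Y₁, Y₂, Y₃) = E Y₁Y₂Y₃ + Ê⁺(Y₁) E Y₂Y₃ + Ê⁺(Y₁, Y₂) E Y₃`, with `Ê⁺(Y₁) = E Y₁`. -/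
def Eplus3 (P : Measure Ω) (Y₁ Y₂ Y₃ : Ω → ℝ) : ℝ :=
  (∫ ω, Y₁ ω * Y₂ ω * Y₃ ω ∂P) + (∫ ω, Y₁ ω ∂P) * (∫ ω, Y₂ ω * Y₃ ω ∂P)
    + Eplus2 P Y₁ Y₂ * ∫ ω, Y₃ ω ∂P

/-- `Ê⁺₂(X_{k-1}, X_k) = Ê⁺(X_{k-1}(X_{k-1} - 1), X_k) + Ê⁺(X_{k-1}, X_k(X_k - 1))`. -/
def Eplus22 (P : Measure Ω) (X : ℤ → Ω → ℕ) (k : ℤ) : ℝ :=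
  Eplus2 P (fun ω => (X (k - 1) ω : ℝ) * ((X (k - 1) ω : ℝ) - 1)) (fun ω => (X k ω : ℝ))
    + Eplus2 P (fun ω => (X (k - 1) ω : ℝ)) (fun ω => (X k ω : ℝ) * ((X k ω : ℝ) - 1))

/-- `E X_{k-1} X_k`. -/
def mixed (P : Measure Ω) (X : ℤ → Ω → ℕ) (k : ℤ) : ℝ :=
  ∫ ω, (X (k - 1) ω : ℝ) * (X k ω : ℝ) ∂P

/-- The remainder `R₀`. -/
def R0 (P : Measure Ω) (X : ℤ → Ω → ℕ) (n : ℕ) : ℝ :=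
  ∑ k ∈ Finset.Icc (1 : ℤ) n, (nu P X 2 k + nu P X 1 k ^ 2 + mixed P X k)

/-- The remainder `R₁`. -/
def R1 (P : Measure Ω) (X : ℤ → Ω → ℕ) (n : ℕ) : ℝ :=
  ∑ k ∈ Finset.Icc (1 : ℤ) n,
    (nu P X 1 k ^ 3 + nu P X 1 k * nu P X 2 k + nu P X 3 k
      + (nu P X 1 (k - 2) + nu P X 1 (k - 1) + nu P X 1 k) * mixed P X k
      + Eplus22 P X k
      + Eplus3 P (fun ω => (X (k - 2) ω : ℝ)) (fun ω => (X (k - 1) ω : ℝ))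
          (fun ω => (X k ω : ℝ)))

end RandomVariables

/-! ### The approximations

A (signed) measure `M` on `ℕ` is given by its point masses `M{k}`. -/

/-- `M(x) = ∑_{k=0}^x M{k}`. -/
def distFun (M : ℕ → ℝ) (x : ℕ) : ℝ := ∑ k ∈ Finset.range (x + 1), M k

/-- Point masses of the Poisson law with parameter `l`. -/
def poissonMass (l : ℝ) (k : ℕ) : ℝ := Real.exp (-l) * l ^ k / k.factorial

/-- Convolution of a measure on `ℕ` with `δ₁ - δ₀`: multiplication of the transform by
`z = e^{it} - 1`. -/
def firstDiff (M : ℕ → ℝ) : ℕ → ℝ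
  | 0 => -M 0
  | k + 1 => M k - M (k + 1)

/-- `Π₁`: the second order difference of the Poisson law, multiplied by `g = Γ₂`. -/
def poissonMass1 (l g : ℝ) (k : ℕ) : ℝ := g * firstDiff (firstDiff (poissonMass l)) k

/-- The (signed) compound Poisson measure `G`. Since
`l z + g z² = (g - l) + (l - 2 g) w + g w²` for `w = e^{it} = z + 1`, its point masses are the
coefficients of `w ^ k` in `exp (l z + g z²)`; see `hasSum_compoundMass`. -/
def compoundMass (l g : ℝ) (k : ℕ) : ℝ :=
  Real.exp (g - l) * ∑ j ∈ Finset.range (k / 2 + 1),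
    (l - 2 * g) ^ (k - 2 * j) / (k - 2 * j).factorial * (g ^ j / j.factorial)

/-- Distribution function of the translated Poisson law, i.e. of `⌊-2g⌋ + Y` with
`Y ∼ Poisson (l + 2g + δ)`, `δ` the fractional part of `-2g`. The support starts at `⌊-2g⌋`,
which may be negative. -/
def TPdist (l g : ℝ) (x : ℕ) : ℝ :=
  ∑ k ∈ Finset.Icc ⌊-2 * g⌋ (x : ℤ),
    poissonMass (l + 2 * g + Int.fract (-2 * g)) (k - ⌊-2 * g⌋).toNat

/-- Point masses of the negative binomial law with parameters `r`, `q`. -/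
def nbMass (r q : ℝ) (j : ℕ) : ℝ :=
  Real.Gamma (r + j) / (j.factorial * Real.Gamma r) * q ^ r * (1 - q) ^ j

/-- The parameter `q` of the negative binomial approximation, see `nb_parameters`. -/
def nbQ (l g : ℝ) : ℝ := l / (l + 2 * g)

/-- The parameter `r` of the negative binomial approximation, see `nb_parameters`. -/
def nbR (l g : ℝ) : ℝ := l ^ 2 / (2 * g)

/-- Point masses of the binomial law with parameters `N`, `p`. -/
def binMass (N : ℕ) (p : ℝ) (k : ℕ) : ℝ := N.choose k * p ^ k * (1 - p) ^ (N - k)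

/-- `N = ⌊l² / (2|g|)⌋`; the other parameter of the binomial approximation is `l / N`. -/
def binN (l g : ℝ) : ℕ := ⌊l ^ 2 / (2 * |g|)⌋₊

/-! ### The definitions have the intended transforms and parameters -/

theorem nb_parameters {l g : ℝ} (hl : 0 < l) (hg : 0 < g) (r q : ℝ) :
    (r * (1 - q) / q = l ∧ r * ((1 - q) / q) ^ 2 = 2 * g) ↔ (r = nbR l g ∧ q = nbQ l g) := by
  unfold nbR nbQ
  constructor
  · rintro ⟨h1, h2⟩
    have hq : q ≠ 0 := by
      rintro rfl
      simp at h1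
      exact hl.ne h1
    have h3 : l * ((1 - q) / q) = 2 * g := by
      rw [← h2, ← h1]
      ring
    have h4 : q * (l + 2 * g) = l := by
      field_simp at h3
      linarith
    have hs : l + 2 * g ≠ 0 := by positivity
    have hq' : q = l / (l + 2 * g) := by
      field_simp
      exact h4
    refine ⟨?_, hq'⟩
    have h5 : (1 - q) / q = 2 * g / l := by
      field_simp
      linarith
    rw [mul_div_assoc, h5] at h1
    field_simp at h1 ⊢
    linarith
  · rintro ⟨rfl, rfl⟩
    have hs : l + 2 * g ≠ 0 := by positivity
    constructor <;> field_simp <;> ring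

theorem hasSum_poissonMass (l : ℝ) (w : ℂ) :
    HasSum (fun k => (poissonMass l k : ℂ) * w ^ k) (Complex.exp (l * (w - 1))) := by
  have h := (NormedSpace.expSeries_div_hasSum_exp ((l : ℂ) * w)).mul_left (Complex.exp (-l))
  rw [← Complex.exp_eq_exp_ℂ, ← Complex.exp_add] at h
  have hf : (fun k => (poissonMass l k : ℂ) * w ^ k) =
      fun k => Complex.exp (-l) * (((l : ℂ) * w) ^ k / k.factorial) := by
    funext k
    simp only [poissonMass]
    push_cast
    rw [mul_pow]
    ring
  have hv : (l : ℂ) * (w - 1) = -l + l * w := by ring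
  rw [hf, hv]
  exact h

theorem hasSum_firstDiff {M : ℕ → ℝ} {w a : ℂ} (h : HasSum (fun k => (M k : ℂ) * w ^ k) a) :
    HasSum (fun k => (firstDiff M k : ℂ) * w ^ k) (a * (w - 1)) := by
  have h1 : HasSum (fun k => (M (k + 1) : ℂ) * w ^ (k + 1)) (a - M 0) := by
    have := (hasSum_nat_add_iff' 1).mpr h
    simpa using this
  have h2 := (h.mul_right w).sub h1
  rw [← hasSum_nat_add_iff' 1]
  convert h2 using 1
  · funext k
    simp only [firstDiff]
    push_cast
    ring
  · simp [firstDiff]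
    ring

theorem hasSum_poissonMass1 (l g : ℝ) (w : ℂ) :
    HasSum (fun k => (poissonMass1 l g k : ℂ) * w ^ k)
      (Complex.exp (l * (w - 1)) * (g * (w - 1) ^ 2)) := by
  have h := (hasSum_firstDiff (hasSum_firstDiff (hasSum_poissonMass l w))).mul_left (g : ℂ)
  have hf : (fun k => (poissonMass1 l g k : ℂ) * w ^ k) =
      fun k => (g : ℂ) * ((firstDiff (firstDiff (poissonMass l)) k : ℂ) * w ^ k) := by
    funext k
    simp only [poissonMass1]
    push_cast
    ring
  have hv : Complex.exp (l * (w - 1)) * (g * (w - 1) ^ 2) =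
      g * (Complex.exp (l * (w - 1)) * (w - 1) * (w - 1)) := by ring
  rw [hf, hv]
  exact h

theorem hasSum_fiber {f : ℕ × ℕ → ℂ} {c : ℂ} (hf : HasSum f c) :
    HasSum (fun k => ∑ j ∈ Finset.range (k / 2 + 1), f (k - 2 * j, j)) c := by
  rw [← (Equiv.sigmaFiberEquiv fun p : ℕ × ℕ => p.1 + 2 * p.2).hasSum_iff] at hf
  refine hf.sigma fun k => ?_
  let t : Finset (ℕ × ℕ) := (Finset.range (k / 2 + 1)).image fun j => (k - 2 * j, j)
  have ht : {p : ℕ × ℕ | p.1 + 2 * p.2 = k} = (t : Set (ℕ × ℕ)) := by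
    ext ⟨i, j⟩
    simp only [t, Set.mem_ofPred_eq, Finset.coe_image, Set.mem_image, Finset.coe_range,
      Set.mem_Iio, Prod.mk.injEq]
    constructor
    · intro h
      exact ⟨j, by omega, by omega, rfl⟩
    · rintro ⟨j', h, h', rfl⟩
      omega
  have h5 : ∑ j ∈ Finset.range (k / 2 + 1), f (k - 2 * j, j) = ∑ p ∈ t, f p := by
    rw [Finset.sum_image]
    intro i _ j _ hij
    exact (Prod.mk.inj hij).2
  rw [h5]
  change HasSum (fun c : ({p : ℕ × ℕ | p.1 + 2 * p.2 = k} : Set (ℕ × ℕ)) => f c) _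
  rw [ht]
  exact t.hasSum f

theorem hasSum_compoundMass (l g : ℝ) (w : ℂ) :
    HasSum (fun k => (compoundMass l g k : ℂ) * w ^ k)
      (Complex.exp (l * (w - 1) + g * (w - 1) ^ 2)) := by
  have key : ∀ a b : ℂ, HasSum (fun p : ℕ × ℕ => a ^ p.1 / p.1.factorial *
      (b ^ p.2 / p.2.factorial)) (Complex.exp a * Complex.exp b) := by
    intro a b
    have h1 : ∀ u : ℂ, HasSum (fun n : ℕ => u ^ n / n.factorial) (Complex.exp u) := by
      intro u
      rw [Complex.exp_eq_exp_ℂ]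
      exact NormedSpace.expSeries_div_hasSum_exp u
    have h2 : ∀ u : ℂ, Summable fun n : ℕ => ‖u ^ n / (n.factorial : ℂ)‖ := fun u =>
      NormedSpace.norm_expSeries_div_summable u
    have hs : Summable fun p : ℕ × ℕ => a ^ p.1 / (p.1.factorial : ℂ) *
        (b ^ p.2 / (p.2.factorial : ℂ)) :=
      summable_mul_of_summable_norm (f := fun n : ℕ => a ^ n / (n.factorial : ℂ))
        (g := fun n : ℕ => b ^ n / (n.factorial : ℂ)) (h2 a) (h2 b)
    rw [← (h1 a).tsum_eq, ← (h1 b).tsum_eq, tsum_mul_tsum_of_summable_norm (h2 a) (h2 b)]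
    exact hs.hasSum
  have h3 := (hasSum_fiber (key ((l - 2 * g) * w) (g * w ^ 2))).mul_left (Complex.exp (g - l))
  have hv : Complex.exp (l * (w - 1) + g * (w - 1) ^ 2) = Complex.exp (g - l) *
      (Complex.exp ((l - 2 * g) * w) * Complex.exp (g * w ^ 2)) := by
    rw [← Complex.exp_add, ← Complex.exp_add]
    congr 1
    ring
  rw [hv]
  have hf : ∀ k, (compoundMass l g k : ℂ) * w ^ k = Complex.exp (g - l) *
      ∑ j ∈ Finset.range (k / 2 + 1), ((l - 2 * g) * w) ^ (k - 2 * j) / (k - 2 * j).factorial *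
        ((g * w ^ 2) ^ j / j.factorial) := by
    intro k
    simp only [compoundMass]
    push_cast
    rw [mul_assoc, Finset.sum_mul]
    congr 1
    refine Finset.sum_congr rfl fun j hj => ?_
    have hk : k = (k - 2 * j) + 2 * j := by
      have := Finset.mem_range.mp hj
      omega
    have hw : w ^ k = w ^ (k - 2 * j) * (w ^ 2) ^ j := by
      rw [← pow_mul, ← pow_add, ← hk]
    rw [hw, mul_pow, mul_pow]
    ring
  rw [funext hf]
  exact h3

end

end MDep

open MDep

/-! The proof compares generating functions on circles slightly inside and outside the unit circle.
Put `a k = E w ^ S_k` and `z = w - 1`. Writing `w ^ X_k = 1 + (w ^ X_k - 1)` and peeling variables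
off the past, one-dependence factorizes all terms with a gap and gives `a k = a (k-1) + ∑ j, a
(k-j-2) * c k j`, where `c k j` is the expectation of the product of `w ^ X_i - 1` over `k-j ≤ i ≤
k` (`integral_pow_partialSum`). The coefficients decay geometrically, since every second factor is
independent and has small mean. Hence the ratios `a k / a (k-1)` stay close to 1 and no `a k`
vanishes (`ratio_bounds_aux`).

Feeding the bounds on earlier ratios back into the recursion expands each ratio to third order in
`z`. Up to a local error, it is the exponential of `ν₁ z + s z²` (`norm_ratio_sub_exp_le`). The
coefficients `ν₁` sum to `λ` and the coefficients `s` sum exactly to `Γ₂` (`Gam2_eq`), so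
multiplying the ratios compares `E w ^ S_n` with the transform of `G`. The error is `R₁ ‖z‖³` times
an exponential which, on the circles used, decays like a Gaussian in the angle `t`
(`norm_genFun_sub_exp_le`, `exponent_le`).

The weight `1 + (x - λ)²/λ` comes from the radius. On `‖w‖ = e ^ h` with `|h| = η/√λ`, integration
against `w ^ (-x) / (1 - w)` extracts the distribution function at `x`. Choosing the sign of `h`
according to the side of `λ` on which `x` lies yields a factor `exp (-η |x - λ| / √λ)`, which
absorbs the weight. A bound `A ‖z‖ ^ (p+1)` for transforms thus becomes `A / √λ ^ (p+1)` for
distribution functions (`nonuniform_bound`). The variables must be bounded here, so that `‖w‖ ^ X_k`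
stays near 1.

The remaining laws are compared with `G` through their exponents. Those of the negative binomial,
binomial and translated Poisson laws are logarithms agreeing with `λ z + g z²` to second order, for
a `g` equal to `Γ₂` up to rounding. The triangle inequality finishes the proof. Almost sure
boundedness is reduced to sure boundedness by truncation. -/

theorem cast_descFactorial_three (m : ℕ) :
    (m.descFactorial 3 : ℝ) = m * (m - 1) * (m - 2) := by
  induction m with
  | zero => simp
  | succ m ih =>
    have h : (m + 1).descFactorial 3 = (m + 1) * m.descFactorial 2 :=
      Nat.succ_descFactorial_succ m 2
    rw [h]
    push_cast [Nat.cast_descFactorial_two]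
    ring

/-! ### Discrete Taylor bounds for `w ^ m` around `w = 1`. -/

section PowerExpansion

variable {w : ℂ} {K : ℝ} {B : ℕ}

/-- This and the next two bounds form a ladder. Passing from `m` to `m + 1` adds the preceding
remainder times `w - 1`, and summing the preceding bound over `m` produces the next falling
factorial. The growth of `‖w‖ ^ m` enters only at this lowest level, so the constant `K` is never
compounded. -/
theorem norm_pow_sub_one_le (hK : ∀ j ≤ B, ‖w‖ ^ j ≤ K) {m : ℕ} (hm : m ≤ B) :
    ‖w ^ m - 1‖ ≤ K * ‖w - 1‖ * m := by
  induction m with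
  | zero => simp
  | succ m ih =>
    have h1 : w ^ (m + 1) - 1 = (w ^ m - 1) + w ^ m * (w - 1) := by ring
    have h2 : ‖w ^ m * (w - 1)‖ ≤ K * ‖w - 1‖ := by
      rw [norm_mul, norm_pow]
      exact mul_le_mul_of_nonneg_right (hK m (by omega)) (norm_nonneg _)
    rw [h1]
    push_cast
    linarith [norm_add_le (w ^ m - 1) (w ^ m * (w - 1)), ih (by omega)]

theorem norm_pow_sub_one_sub_le (hK : ∀ j ≤ B, ‖w‖ ^ j ≤ K) {m : ℕ} (hm : m ≤ B) :
    ‖w ^ m - 1 - m * (w - 1)‖ ≤ K * ‖w - 1‖ ^ 2 / 2 * m.descFactorial 2 := by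
  induction m with
  | zero => simp
  | succ m ih =>
    have h1 : w ^ (m + 1) - 1 - ((m + 1 : ℕ) : ℂ) * (w - 1) =
        (w ^ m - 1 - m * (w - 1)) + (w ^ m - 1) * (w - 1) := by push_cast; ring
    have h2 : ‖(w ^ m - 1) * (w - 1)‖ ≤ K * ‖w - 1‖ * m * ‖w - 1‖ := by
      rw [norm_mul]
      exact mul_le_mul_of_nonneg_right (norm_pow_sub_one_le hK (by omega)) (norm_nonneg _)
    have h3 := ih (by omega)
    rw [h1]
    refine (norm_add_le _ _).trans ((add_le_add h3 h2).trans (le_of_eq ?_))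
    push_cast [Nat.cast_descFactorial_two]
    ring

theorem norm_pow_sub_one_sub_sub_le (hK : ∀ j ≤ B, ‖w‖ ^ j ≤ K) {m : ℕ} (hm : m ≤ B) :
    ‖w ^ m - 1 - m * (w - 1) - (m.descFactorial 2 : ℂ) / 2 * (w - 1) ^ 2‖
      ≤ K * ‖w - 1‖ ^ 3 / 6 * m.descFactorial 3 := by
  induction m with
  | zero => simp
  | succ m ih =>
    have h1 : w ^ (m + 1) - 1 - ((m + 1 : ℕ) : ℂ) * (w - 1)
        - ((m + 1).descFactorial 2 : ℂ) / 2 * (w - 1) ^ 2 =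
        (w ^ m - 1 - m * (w - 1) - (m.descFactorial 2 : ℂ) / 2 * (w - 1) ^ 2)
          + (w ^ m - 1 - m * (w - 1)) * (w - 1) := by
      push_cast [Nat.cast_descFactorial_two]; ring
    have h2 : ‖(w ^ m - 1 - m * (w - 1)) * (w - 1)‖
        ≤ K * ‖w - 1‖ ^ 2 / 2 * m.descFactorial 2 * ‖w - 1‖ := by
      rw [norm_mul]
      exact mul_le_mul_of_nonneg_right (norm_pow_sub_one_sub_le hK (by omega)) (norm_nonneg _)
    have h3 := ih (by omega)
    rw [h1]
    refine (norm_add_le _ _).trans ((add_le_add h3 h2).trans (le_of_eq ?_))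
    rw [cast_descFactorial_three, cast_descFactorial_three]
    push_cast [Nat.cast_descFactorial_two]
    ring

end PowerExpansion

/-! ### Inversion on circles of radius `e ^ h` and the nonuniform estimate. -/

section Inversion

open Complex Real

/-- The parametrization `t ↦ e^{h + it}` of the circle of radius `e^h`. -/
noncomputable def expCircle (h t : ℝ) : ℂ := cexp (h + t * I)

theorem norm_expCircle (h t : ℝ) : ‖expCircle h t‖ = rexp h := by
  simp [expCircle, Complex.norm_exp]

theorem expCircle_ne_zero (h t : ℝ) : expCircle h t ≠ 0 := Complex.exp_ne_zero _

theorem continuous_expCircle (h : ℝ) : Continuous (expCircle h) := by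
  unfold expCircle; fun_prop

theorem expCircle_zpow (h t : ℝ) (d : ℤ) : expCircle h t ^ d = cexp (d * (h + t * I)) := by
  rw [expCircle, Complex.exp_int_mul]

theorem norm_expCircle_zpow (h t : ℝ) (d : ℤ) : ‖expCircle h t ^ d‖ = rexp (h * d) := by
  rw [expCircle_zpow, Complex.norm_exp]
  simp [mul_comm]

theorem expCircle_ne_one {h : ℝ} (hh : h ≠ 0) (t : ℝ) : expCircle h t ≠ 1 := by
  intro h1
  have := norm_expCircle h t
  rw [h1, norm_one, eq_comm, Real.exp_eq_one_iff] at this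
  exact hh this

theorem continuous_expCircle_zpow (h : ℝ) (d : ℤ) : Continuous fun t => expCircle h t ^ d :=
  (continuous_expCircle h).zpow₀ d fun t => Or.inl (expCircle_ne_zero h t)

theorem integral_expCircle_zpow (h : ℝ) (d : ℤ) :
    ∫ t in -π..π, expCircle h t ^ d = if d = 0 then 2 * (π : ℂ) else 0 := by
  split_ifs with hd
  · subst hd
    simp
    ring
  · have hc : (d : ℂ) * I ≠ 0 := mul_ne_zero (by exact_mod_cast hd) I_ne_zero
    have h1 : (fun t : ℝ => expCircle h t ^ d) =
        fun t : ℝ => cexp (d * h) * cexp (d * I * t) := by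
      funext t
      rw [expCircle_zpow, ← Complex.exp_add]
      congr 1; ring
    rw [h1, intervalIntegral.integral_const_mul, integral_exp_mul_complex hc]
    have h2 : cexp (d * I * (π : ℝ)) = cexp (d * I * (-π : ℝ)) := by
      rw [Complex.exp_eq_exp_iff_exists_int]
      exact ⟨d, by push_cast; ring⟩
    rw [h2]; simp

theorem hasSum_intervalIntegral_of_bound {F : ℕ → ℝ → ℂ} {S : ℝ → ℂ} {u : ℕ → ℝ} {a b : ℝ}
    (hF : ∀ j, Continuous (F j)) (hu : Summable u) (hb : ∀ j t, ‖F j t‖ ≤ u j)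
    (hS : ∀ t, HasSum (fun j => F j t) (S t)) :
    HasSum (fun j => ∫ t in a..b, F j t) (∫ t in a..b, S t) :=
  intervalIntegral.hasSum_integral_of_dominated_convergence (fun j _ => u j)
    (fun j => (hF j).aestronglyMeasurable)
    (fun j => Filter.Eventually.of_forall fun t _ => hb j t)
    (Filter.Eventually.of_forall fun _ _ => hu) intervalIntegrable_const
    (Filter.Eventually.of_forall fun t _ => hS t)

/-- The integral of `w ^ d / (1 - w)` over a circle around the origin. -/
theorem integral_zpow_div_one_sub {h : ℝ} (hh : h ≠ 0) (d : ℤ) :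
    ∫ t in -π..π, expCircle h t ^ d / (1 - expCircle h t) =
      2 * π * ((if d ≤ 0 then 1 else 0) - (if 0 < h then 1 else 0)) := by
  -- Inside the unit circle `1 / (1 - w)` is the series of the `w ^ j`; outside it is minus the
  -- series of the `w ^ (-1 - j)`. Orthogonality keeps at most the one term with total exponent
  -- zero.
  rcases hh.lt_or_gt with hneg | hpos
  · have hr : rexp h < 1 := Real.exp_lt_one_iff.2 hneg
    have key := hasSum_intervalIntegral_of_bound (a := -π) (b := π)
      (F := fun j t => expCircle h t ^ (d + j))
      (S := fun t => expCircle h t ^ d / (1 - expCircle h t))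
      (u := fun j => rexp (h * d) * rexp h ^ j)
      (fun j => continuous_expCircle_zpow h _)
      ((summable_geometric_of_lt_one (Real.exp_pos _).le hr).mul_left _)
      (fun j t => le_of_eq (by
        rw [norm_expCircle_zpow, ← Real.exp_nat_mul, ← Real.exp_add]
        congr 1; push_cast; ring))
      (fun t => by
        have := (hasSum_geometric_of_norm_lt_one (K := ℂ) (ξ := expCircle h t)
          (by rw [norm_expCircle]; exact hr)).mul_left (expCircle h t ^ d)
        rw [← div_eq_mul_inv] at this
        refine this.congr_fun ?_
        intro j
        simp [zpow_add₀ (expCircle_ne_zero h t)])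
    simp only [integral_expCircle_zpow] at key
    refine key.unique ?_
    by_cases hd : d ≤ 0
    · convert! hasSum_single (f := fun j : ℕ => if d + j = 0 then 2 * (π : ℂ) else 0)
        (-d).toNat ?_ using 1
      · simp [hd, hneg.not_gt]
      · intro j hj
        rw [if_neg]; omega
    · convert! hasSum_zero (α := ℂ) (β := ℕ) using 1
      · funext j
        rw [if_neg]; omega
      · simp [hd, hneg.not_gt]
  · have hr : rexp (-h) < 1 := Real.exp_lt_one_iff.2 (by linarith)
    have key := hasSum_intervalIntegral_of_bound (a := -π) (b := π)
      (F := fun j t => -(expCircle h t ^ (d - 1 - j)))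
      (S := fun t => expCircle h t ^ d / (1 - expCircle h t))
      (u := fun j => rexp (h * (d - 1)) * rexp (-h) ^ j)
      (fun j => (continuous_expCircle_zpow h _).neg)
      ((summable_geometric_of_lt_one (Real.exp_pos _).le hr).mul_left _)
      (fun j t => le_of_eq (by
        rw [norm_neg, norm_expCircle_zpow, ← Real.exp_nat_mul, ← Real.exp_add]
        congr 1; push_cast; ring))
      (fun t => by
        have hn := expCircle_ne_zero h t
        have h1 : expCircle h t - 1 ≠ 0 := sub_ne_zero.2 (expCircle_ne_one hh t)
        have h1' : 1 - expCircle h t ≠ 0 := sub_ne_zero.2 (expCircle_ne_one hh t).symm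
        have := (hasSum_geometric_of_norm_lt_one (K := ℂ) (ξ := (expCircle h t)⁻¹)
          (by rw [norm_inv, norm_expCircle, ← Real.exp_neg]; exact hr)).mul_left
            (-(expCircle h t ^ (d - 1)))
        convert! this using 1
        · funext j
          rw [zpow_sub₀ hn _ (j : ℤ)]
          simp [div_eq_mul_inv]
        · rw [zpow_sub_one₀ hn]
          have h2 : 1 - (expCircle h t)⁻¹ = (expCircle h t - 1) / expCircle h t := by
            field_simp
          rw [h2]
          field_simp
          ring)
    simp only [intervalIntegral.integral_neg, integral_expCircle_zpow] at key
    refine key.unique ?_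
    by_cases hd : d ≤ 0
    · convert! hasSum_zero (α := ℂ) (β := ℕ) using 1
      · funext j
        rw [if_neg, neg_zero]; omega
      · simp [hd, hpos]
    · convert! hasSum_single (f := fun j : ℕ => -(if d - 1 - j = 0 then 2 * (π : ℂ) else 0))
        (d - 1).toNat ?_ using 1
      · have : d - 1 - ((d - 1).toNat : ℤ) = 0 := by omega
        simp only [this, hd, hpos]; simp
      · intro j hj
        rw [if_neg, neg_zero]; omega

/-- Division by `1 - w` sums coefficients. For `h < 0` it picks up the indices up to `x`; for `h >
0` it picks up minus the tail, which is the partial sum minus the total mass one. That correction is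
the same for all sequences of mass one and cancels in differences. -/
theorem integral_series_div_one_sub {h : ℝ} (hh : h ≠ 0) {a : ℕ → ℝ} {f : ℂ → ℂ}
    (ha : Summable fun k => |a k| * rexp h ^ k) (h1 : HasSum a 1)
    (hf : ∀ t, HasSum (fun k => (a k : ℂ) * expCircle h t ^ k) (f (expCircle h t))) (x : ℤ) :
    IntervalIntegrable
      (fun t => f (expCircle h t) * expCircle h t ^ (-x) / (1 - expCircle h t)) volume (-π) π ∧
    ∫ t in -π..π, f (expCircle h t) * expCircle h t ^ (-x) / (1 - expCircle h t) =
      2 * π * ((∑ k ∈ Finset.range (x + 1).toNat, a k : ℝ) - (if 0 < h then 1 else 0)) := by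
  have hne : ∀ t, 1 - expCircle h t ≠ 0 := fun t => sub_ne_zero.2 (expCircle_ne_one hh t).symm
  have hcont : Continuous fun t => f (expCircle h t) := by
    have : (fun t => f (expCircle h t)) = fun t => ∑' k, (a k : ℂ) * expCircle h t ^ k :=
      funext fun t => (hf t).tsum_eq.symm
    rw [this]
    refine continuous_tsum (fun k => continuous_const.mul ((continuous_expCircle h).pow k)) ha ?_
    intro k t
    simp [norm_expCircle]
  refine ⟨Continuous.intervalIntegrable ((hcont.mul (continuous_expCircle_zpow h _)).div
    (continuous_const.sub (continuous_expCircle h)) hne) _ _, ?_⟩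
  have hlow : ∀ t, |1 - rexp h| ≤ ‖1 - expCircle h t‖ := by
    intro t
    have := abs_norm_sub_norm_le 1 (expCircle h t)
    rwa [norm_one, norm_expCircle] at this
  have hpos : 0 < |1 - rexp h| := by
    rw [abs_pos, sub_ne_zero]
    intro h2
    exact hh (Real.exp_eq_one_iff h |>.1 h2.symm)
  have key := hasSum_intervalIntegral_of_bound (a := -π) (b := π)
      (F := fun k t => (a k : ℂ) * (expCircle h t ^ ((k : ℤ) - x) / (1 - expCircle h t)))
      (S := fun t => f (expCircle h t) * expCircle h t ^ (-x) / (1 - expCircle h t))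
      (u := fun k => |a k| * rexp h ^ k * (rexp (h * (-x)) / |1 - rexp h|))
      (fun j => continuous_const.mul ((continuous_expCircle_zpow h _).div
        (continuous_const.sub (continuous_expCircle h)) hne))
      (ha.mul_right _)
      (fun k t => by
        rw [norm_mul, norm_div, norm_expCircle_zpow, Complex.norm_real, Real.norm_eq_abs, mul_assoc]
        refine mul_le_mul_of_nonneg_left ?_ (abs_nonneg _)
        rw [mul_div_assoc', ← Real.exp_nat_mul, ← Real.exp_add]
        have h2 : h * (((k : ℤ) - x : ℤ) : ℝ) = k * h + h * (-x) := by push_cast; ring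
        rw [h2]
        exact div_le_div_of_nonneg_left (Real.exp_pos _).le hpos (hlow t))
      (fun t => by
        have := (hf t).mul_right (expCircle h t ^ (-x) / (1 - expCircle h t))
        convert! this using 1
        · funext k
          rw [sub_eq_add_neg, zpow_add₀ (expCircle_ne_zero h t), zpow_natCast]
          ring
        · ring)
  simp only [intervalIntegral.integral_const_mul, integral_zpow_div_one_sub hh] at key
  refine key.unique ?_
  have hA : HasSum (fun k : ℕ => if (k : ℤ) - x ≤ 0 then (a k : ℂ) else 0)
      (∑ k ∈ Finset.range (x + 1).toNat, (a k : ℂ)) := by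
    have h3 : HasSum (fun k : ℕ => if (k : ℤ) - x ≤ 0 then (a k : ℂ) else 0)
        (∑ k ∈ Finset.range (x + 1).toNat, if (k : ℤ) - x ≤ 0 then (a k : ℂ) else 0) :=
      hasSum_sum_of_ne_finset_zero (fun k hk => by
        rw [if_neg]
        rw [Finset.mem_range] at hk
        omega)
    convert! h3 using 1
    refine Finset.sum_congr rfl fun k hk => ?_
    rw [if_pos]
    rw [Finset.mem_range] at hk
    omega
  have hB : HasSum (fun k => (a k : ℂ)) 1 := by
    simpa using Complex.hasSum_ofReal.2 h1
  have := (hA.sub (hB.mul_right (if 0 < h then (1 : ℂ) else 0))).mul_left (2 * (π : ℂ))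
  convert! this using 1
  · funext k
    split_ifs <;> ring
  · push_cast
    simp

/-- `a` has total mass one and generating function `f` on the circle of radius `r`. -/
def HasGenFun (a : ℕ → ℝ) (f : ℂ → ℂ) (r : ℝ) : Prop :=
  HasSum a 1 ∧ ∀ w : ℂ, ‖w‖ = r → HasSum (fun k => (a k : ℂ) * w ^ k) (f w)

theorem HasGenFun.integral {a : ℕ → ℝ} {f : ℂ → ℂ} {h : ℝ} (hh : h ≠ 0)
    (H : HasGenFun a f (rexp h)) (x : ℤ) :
    IntervalIntegrable
      (fun t => f (expCircle h t) * expCircle h t ^ (-x) / (1 - expCircle h t)) volume (-π) π ∧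
    ∫ t in -π..π, f (expCircle h t) * expCircle h t ^ (-x) / (1 - expCircle h t) =
      2 * π * ((∑ k ∈ Finset.range (x + 1).toNat, a k : ℝ) - (if 0 < h then 1 else 0)) := by
  refine integral_series_div_one_sub hh ?_ H.1 (fun t => H.2 _ (norm_expCircle h t)) x
  have := (H.2 _ (norm_expCircle h 0)).summable.norm
  simpa [norm_expCircle] using this

theorem norm_expCircle_sub_one_sq (h t : ℝ) :
    ‖expCircle h t - 1‖ ^ 2 = (rexp h - 1) ^ 2 + 2 * rexp h * (1 - Real.cos t) := by
  have h1 : expCircle h t - 1 = ((rexp h * Real.cos t - 1 : ℝ) : ℂ) + (rexp h * Real.sin t : ℝ) * I := by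
    rw [expCircle, Complex.exp_add, Complex.exp_mul_I]
    push_cast
    ring
  rw [h1, ← Complex.normSq_eq_norm_sq, Complex.normSq_add_mul_I]
  linear_combination (rexp h) ^ 2 * Real.sin_sq_add_cos_sq t

theorem re_expCircle_sub_one (h t : ℝ) :
    (expCircle h t - 1).re = rexp h - 1 - rexp h * (1 - Real.cos t) := by
  rw [expCircle, Complex.exp_add, Complex.exp_mul_I]
  simp [← Complex.ofReal_exp, ← Complex.ofReal_cos, ← Complex.ofReal_sin]
  ring

/-- Since `|h| ≤ 1 / √l`, each factor `‖w - 1‖` is worth `1 / √l`, up to a polynomial in `√l * t`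
that the Gaussian factor absorbs. -/
theorem norm_expCircle_sub_one_le {h t l : ℝ} (hl : 0 < l) (hh : |h| ≤ 1) (hhl : h ^ 2 * l ≤ 1) :
    ‖expCircle h t - 1‖ ≤ 2 * √(1 + l * t ^ 2) / √l := by
  have h1 : |rexp h - 1| ≤ 2 * |h| := Real.abs_exp_sub_one_le hh
  have h2 : (rexp h - 1) ^ 2 ≤ 4 * h ^ 2 := by
    rw [← sq_abs, ← sq_abs h]
    nlinarith [abs_nonneg (rexp h - 1)]
  have h3 : rexp h ≤ 3 := by
    have := (abs_le.1 h1).2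
    linarith
  have h4 : 1 - Real.cos t ≤ t ^ 2 / 2 := by linarith [Real.one_sub_sq_div_two_le_cos (x := t)]
  have h5 : ‖expCircle h t - 1‖ ^ 2 ≤ 4 * h ^ 2 + 3 * t ^ 2 := by
    rw [norm_expCircle_sub_one_sq]
    have h6 : 0 ≤ 1 - Real.cos t := by linarith [Real.cos_le_one t]
    nlinarith [Real.exp_pos h]
  rw [le_div_iff₀ (Real.sqrt_pos.2 hl)]
  refine le_of_sq_le_sq ?_ (by positivity)
  rw [mul_pow, mul_pow, Real.sq_sqrt hl.le, Real.sq_sqrt (by positivity)]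
  nlinarith [mul_le_mul_of_nonneg_right h5 hl.le, mul_nonneg hl.le (sq_nonneg t)]

theorem one_add_sq_mul_exp_neg_le {η u : ℝ} (hη : 0 < η) (hη1 : η ≤ 1) (hu : 0 ≤ u) :
    (1 + u ^ 2) * rexp (-(η * u)) ≤ 2 / η ^ 2 := by
  have h1 := Real.quadratic_le_exp_of_nonneg (mul_nonneg hη.le hu)
  rw [Real.exp_neg, ← div_eq_mul_inv, div_le_div_iff₀ (Real.exp_pos _) (by positivity)]
  nlinarith [mul_nonneg hη.le hu]

/-- Half of the Gaussian decay rate `c` is spent on polynomial factors; the other half is left for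
the integral over `t`. -/
theorem one_add_sq_le_exp {c y : ℝ} (hc : 0 < c) (hy : 0 ≤ y) :
    (1 + y) ^ 2 ≤ (1 + 4 / c) ^ 2 * rexp (c / 2 * y) := by
  have h1 : 1 + y ≤ (1 + 4 / c) * rexp (c / 4 * y) := by
    have h2 := Real.add_one_le_exp (c / 4 * y)
    have h3 : y = 4 / c * (c / 4 * y) := by field_simp
    have h4 : 0 ≤ c / 4 * y := by positivity
    have h5 : 0 < 4 / c := by positivity
    nlinarith
  have h2 : rexp (c / 2 * y) = rexp (c / 4 * y) ^ 2 := by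
    rw [← Real.exp_nat_mul]; congr 1; push_cast; ring
  rw [h2, ← mul_pow]
  gcongr

/-- Non-uniform comparison of two distribution functions through their generating functions on
circles of radius `e ^ h`, `|h| = η / √l`. -/
theorem nonuniform_bound {η c K : ℝ} (hη : 0 < η) (hη1 : η ≤ 1) (hc : 0 < c) :
    ∃ C : ℝ, 0 < C ∧ ∀ (l : ℝ), 1 ≤ l → ∀ (a b : ℕ → ℝ) (f g : ℂ → ℂ) (x y : ℤ) (A : ℝ) (p : ℕ),
      0 ≤ A → p ≤ 3 →
      (∀ h, |h| = η / √l → HasGenFun a f (rexp h) ∧ HasGenFun b g (rexp h) ∧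
        ∀ t, |t| ≤ π → ‖f (expCircle h t) - expCircle h t ^ (x - y) * g (expCircle h t)‖
          ≤ A * ‖expCircle h t - 1‖ ^ (p + 1) * rexp (l * h + K - c * (l * t ^ 2))) →
      (1 + ((x : ℝ) - l) ^ 2 / l) * |(∑ k ∈ Finset.range (x + 1).toNat, a k)
          - ∑ k ∈ Finset.range (y + 1).toNat, b k| ≤ C * (A / √l ^ (p + 1)) := by
  set C₁ : ℝ := 8 * (1 + 4 / c) ^ 2 * rexp K * √(2 * π / c) with hC₁
  have hC₁pos : 0 < C₁ := by
    have : 0 < 2 * π / c := by positivity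
    have := Real.sqrt_pos.2 this
    positivity
  refine ⟨2 / η ^ 2 * C₁, by positivity, ?_⟩
  intro l hl a b f g x y A p hA hp H
  have hl0 : 0 < l := by linarith
  have hs : 0 < √l := Real.sqrt_pos.2 hl0
  have hs1 : 1 ≤ √l := Real.one_le_sqrt.2 hl
  -- The sign of `h` is that of `x - l`, so that `exp (h * (l - x))` decays on both sides of `l`.
  obtain ⟨h, hh, hhx⟩ : ∃ h : ℝ, |h| = η / √l ∧ h * (l - x) = -(η * (|(x : ℝ) - l| / √l)) := by
    rcases le_total l x with hx | hx
    · refine ⟨η / √l, abs_of_pos (by positivity), ?_⟩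
      rw [abs_of_nonneg (by linarith)]; ring
    · refine ⟨-(η / √l), by rw [abs_neg, abs_of_pos (by positivity)], ?_⟩
      rw [abs_of_nonpos (by linarith)]; ring
  have hh0 : h ≠ 0 := by
    rw [← abs_pos, hh]; positivity
  have hh1 : |h| ≤ 1 := by
    rw [hh, div_le_one hs]; linarith
  have hhl : h ^ 2 * l ≤ 1 := by
    rw [← sq_abs, hh, div_pow, Real.sq_sqrt hl0.le, div_mul_cancel₀ _ hl0.ne']
    nlinarith
  obtain ⟨Hf, Hg, Hfg⟩ := H h hh
  obtain ⟨i1, e1⟩ := Hf.integral hh0 x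
  obtain ⟨i2, e2⟩ := Hg.integral hh0 y
  set D : ℝ := (∑ k ∈ Finset.range (x + 1).toNat, a k) - ∑ k ∈ Finset.range (y + 1).toNat, b k
    with hD
  -- The terms depending on the sign of `h` cancel, both sequences having total mass one.
  have key : ((2 * π * D : ℝ) : ℂ) = ∫ t in -π..π,
      (f (expCircle h t) * expCircle h t ^ (-x) / (1 - expCircle h t)
        - g (expCircle h t) * expCircle h t ^ (-y) / (1 - expCircle h t)) := by
    rw [intervalIntegral.integral_sub i1 i2, e1, e2, hD]
    push_cast
    ring
  set M : ℝ := A * (8 * (1 + 4 / c) ^ 2 * rexp K) * rexp (h * (l - x)) / √l ^ p with hM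
  have hbound : ∀ t ∈ Set.Ioc (-π) π,
      ‖f (expCircle h t) * expCircle h t ^ (-x) / (1 - expCircle h t)
        - g (expCircle h t) * expCircle h t ^ (-y) / (1 - expCircle h t)‖
        ≤ M * rexp (-(c * l / 2) * t ^ 2) := by
    intro t ht
    have hz : expCircle h t - 1 ≠ 0 := sub_ne_zero.2 (expCircle_ne_one hh0 t)
    have hzpos : 0 < ‖expCircle h t - 1‖ := norm_pos_iff.2 hz
    -- Translating `b` by `x - y` turns its distribution function at `y` into one at `x`, so both
    -- integrands share the factor `w ^ (-x)`.
    have e3 : f (expCircle h t) * expCircle h t ^ (-x) / (1 - expCircle h t)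
        - g (expCircle h t) * expCircle h t ^ (-y) / (1 - expCircle h t)
        = (f (expCircle h t) - expCircle h t ^ (x - y) * g (expCircle h t))
          * expCircle h t ^ (-x) / (1 - expCircle h t) := by
      have : expCircle h t ^ (-y) = expCircle h t ^ (x - y) * expCircle h t ^ (-x) := by
        rw [← zpow_add₀ (expCircle_ne_zero h t)]; congr 1; ring
      rw [this]; ring
    have hzle := norm_expCircle_sub_one_le (t := t) hl0 hh1 hhl
    -- One of the `p + 1` factors `‖w - 1‖` cancels the denominator, and only `p` remain. As the
    -- square root is at least 1 and `p ≤ 3`, its exponent may be raised to 4.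
    have hzp : ‖expCircle h t - 1‖ ^ p ≤ 8 * (1 + l * t ^ 2) ^ 2 / √l ^ p := by
      have hv1 : 1 ≤ √(1 + l * t ^ 2) := Real.one_le_sqrt.2 (by nlinarith [sq_nonneg t])
      calc ‖expCircle h t - 1‖ ^ p ≤ (2 * √(1 + l * t ^ 2) / √l) ^ p := by gcongr
        _ = 2 ^ p * √(1 + l * t ^ 2) ^ p / √l ^ p := by rw [div_pow, mul_pow]
        _ ≤ 2 ^ 3 * √(1 + l * t ^ 2) ^ 4 / √l ^ p := by
            gcongr
            · norm_num
            · omega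
        _ = _ := by
            have : √(1 + l * t ^ 2) ^ 4 = (1 + l * t ^ 2) ^ 2 := by
              rw [show 4 = 2 * 2 from rfl, pow_mul, Real.sq_sqrt (by positivity)]
            rw [this]; norm_num
    rw [e3, norm_div, norm_mul, norm_expCircle_zpow, norm_sub_rev 1, div_le_iff₀ hzpos]
    calc _ ≤ A * ‖expCircle h t - 1‖ ^ (p + 1) * rexp (l * h + K - c * (l * t ^ 2))
          * rexp (h * (-x : ℤ)) :=
          mul_le_mul_of_nonneg_right (Hfg t (abs_le.2 ⟨ht.1.le, ht.2⟩)) (Real.exp_pos _).le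
      _ = A * ‖expCircle h t - 1‖ ^ p * (rexp K * rexp (h * (l - x)) * rexp (-(c * (l * t ^ 2))))
          * ‖expCircle h t - 1‖ := by
          have : rexp (l * h + K - c * (l * t ^ 2)) * rexp (h * (-x : ℤ))
              = rexp K * rexp (h * (l - x)) * rexp (-(c * (l * t ^ 2))) := by
            rw [← Real.exp_add, ← Real.exp_add, ← Real.exp_add]
            congr 1; push_cast; ring
          rw [mul_assoc, this]; ring
      _ ≤ A * (8 * ((1 + 4 / c) ^ 2 * rexp (c / 2 * (l * t ^ 2))) / √l ^ p)
          * (rexp K * rexp (h * (l - x)) * rexp (-(c * (l * t ^ 2)))) * ‖expCircle h t - 1‖ := by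
          have h6 := one_add_sq_le_exp hc (show 0 ≤ l * t ^ 2 by positivity)
          gcongr
          refine hzp.trans ?_
          gcongr
      _ = M * rexp (-(c * l / 2) * t ^ 2) * ‖expCircle h t - 1‖ := by
          have : rexp (-(c * l / 2) * t ^ 2)
              = rexp (c / 2 * (l * t ^ 2)) * rexp (-(c * (l * t ^ 2))) := by
            rw [← Real.exp_add]; congr 1; ring
          rw [this, hM]; ring
  have hMnn : 0 ≤ M := by positivity
  have hb : 0 < c * l / 2 := by positivity
  -- Extending the integral to the whole line gives a Gaussian of width `1 / √l`, which restores the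
  -- power of `√l` lost to the denominator.
  have hgauss : ∫ t in -π..π, M * rexp (-(c * l / 2) * t ^ 2) ≤ M * (√(2 * π / c) / √l) := by
    rw [intervalIntegral.integral_const_mul]
    refine mul_le_mul_of_nonneg_left ?_ hMnn
    have h7 : √(2 * π / c) / √l = √(π / (c * l / 2)) := by
      rw [← Real.sqrt_div (by positivity)]; congr 1; field_simp
    rw [h7, ← integral_gaussian, intervalIntegral.integral_of_le (by linarith [Real.pi_pos])]
    exact setIntegral_le_integral (integrable_exp_neg_mul_sq hb)
      (Filter.Eventually.of_forall fun t => (Real.exp_pos _).le)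
  have hfin : 2 * π * |D| ≤ M * (√(2 * π / c) / √l) := by
    have h8 : ‖((2 * π * D : ℝ) : ℂ)‖ = 2 * π * |D| := by
      rw [Complex.norm_real, Real.norm_eq_abs, abs_mul, abs_of_pos Real.two_pi_pos]
    rw [← h8, key]
    refine (intervalIntegral.norm_integral_le_of_norm_le (by linarith [Real.pi_pos])
      (Filter.Eventually.of_forall hbound) ?_).trans hgauss
    exact Continuous.intervalIntegrable (by fun_prop) _ _
  have hD1 : |D| ≤ M * (√(2 * π / c) / √l) := by
    have : 1 ≤ 2 * π := by linarith [Real.pi_gt_three]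
    nlinarith [abs_nonneg D]
  have hu : 1 + ((x : ℝ) - l) ^ 2 / l = 1 + (|(x : ℝ) - l| / √l) ^ 2 := by
    rw [div_pow, sq_abs, Real.sq_sqrt hl0.le]
  have h9 := one_add_sq_mul_exp_neg_le hη hη1
    (show 0 ≤ |(x : ℝ) - l| / √l by positivity)
  rw [hu]
  calc _ ≤ (1 + (|(x : ℝ) - l| / √l) ^ 2) * (M * (√(2 * π / c) / √l)) := by gcongr
    _ = ((1 + (|(x : ℝ) - l| / √l) ^ 2) * rexp (-(η * (|(x : ℝ) - l| / √l))))
        * (C₁ * (A / √l ^ (p + 1))) := by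
        rw [hM, hhx, hC₁]; field_simp; ring
    _ ≤ 2 / η ^ 2 * (C₁ * (A / √l ^ (p + 1))) := by gcongr
    _ = _ := by ring

end Inversion

/-! ### Ratios of consecutive terms of a recursion with decaying coefficients. -/

section Recursion

open Finset

/-- The sum `S` satisfies `S ≤ u 0 + u 1 + θ * S`. One-dependence provides decay only over two
steps, so a plain geometric series is not available. -/
theorem sum_range_le_of_two_step {u : ℕ → ℝ} {θ : ℝ} (hu : ∀ j, 0 ≤ u j) (hθ : θ < 1)
    (h : ∀ j, u (j + 2) ≤ θ * u j) (m : ℕ) :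
    ∑ j ∈ range m, u j ≤ (u 0 + u 1) / (1 - θ) := by
  rw [le_div_iff₀ (by linarith)]
  have h1 : ∑ j ∈ range m, u j ≤ ∑ j ∈ range (m + 2), u j :=
    sum_le_sum_of_subset_of_nonneg (by simp) fun j _ _ => hu j
  have h2 : ∑ j ∈ range m, u (j + 2) ≤ θ * ∑ j ∈ range m, u j := by
    rw [mul_sum]; exact sum_le_sum fun j _ => h j
  have h3 : ∑ j ∈ range (m + 2), u j = ∑ j ∈ range m, u (j + 2) + u 1 + u 0 := by
    rw [sum_range_succ', sum_range_succ']
  linarith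

/-- A linear recursion with rapidly decaying coefficients, as satisfied by the generating functions
of the partial sums of a one-dependent sequence. -/
structure DecayingRecursion (a : ℤ → ℂ) (c : ℤ → ℕ → ℂ) (b : ℤ → ℕ → ℝ) : Prop where
  init : ∀ k ≤ 0, a k = 1
  step : ∀ (k : ℤ) (N : ℕ), k ≤ N → a k = a (k - 1) + ∑ j ∈ range N, a (k - j - 2) * c k j
  norm_le : ∀ k j, ‖c k j‖ ≤ b k j
  zero_le : ∀ k, b k 0 ≤ 0.0205
  one_le : ∀ k, b k 1 ≤ 2.02 * b k 0
  succ_le : ∀ k j, b k (j + 1) ≤ 2.02 * b k j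
  two_step : ∀ k j, b k (j + 2) ≤ 0.042 * b k j

namespace DecayingRecursion

variable {a : ℤ → ℂ} {c : ℤ → ℕ → ℂ} {b : ℤ → ℕ → ℝ}

theorem nonneg (H : DecayingRecursion a c b) (k : ℤ) (j : ℕ) : 0 ≤ b k j :=
  (norm_nonneg _).trans (H.norm_le k j)

/-- The weights `(10 / 9) ^ (j + 1)` are the possible growth of `a (k-j-2) / a (k-1)`. The decay
survives them because `0.042 * (10 / 9) ^ 2 < 0.052`. -/
theorem weighted_two_step (H : DecayingRecursion a c b) (k : ℤ) (j : ℕ) :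
    (10 / 9 : ℝ) ^ (j + 2 + 1) * b k (j + 2) ≤ 0.052 * ((10 / 9) ^ (j + 1) * b k j) := by
  have h1 := H.two_step k j
  have h2 := H.nonneg k j
  have h3 : (0 : ℝ) < (10 / 9) ^ (j + 1) := by positivity
  have h4 : (10 / 9 : ℝ) ^ (j + 2 + 1) = (10 / 9) ^ (j + 1) * (100 / 81) := by ring
  rw [h4]
  nlinarith [mul_nonneg h3.le h2]

theorem norm_ratio_sub_one_le_of_quotients (H : DecayingRecursion a c b) {k : ℤ}
    (ha : a (k - 1) ≠ 0) (hq : ∀ j : ℕ, ‖a (k - j - 2) / a (k - 1)‖ ≤ (10 / 9) ^ (j + 1)) :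
    ‖a k / a (k - 1) - 1‖ ≤ 4 * b k 0 := by
  have h1 : a k / a (k - 1) - 1 =
      ∑ j ∈ range k.toNat, a (k - j - 2) / a (k - 1) * c k j := by
    rw [H.step k k.toNat (Int.self_le_toNat k), add_div, div_self ha, add_sub_cancel_left, sum_div]
    exact sum_congr rfl fun j _ => by ring
  have h2 : ‖a k / a (k - 1) - 1‖ ≤ ∑ j ∈ range k.toNat, (10 / 9 : ℝ) ^ (j + 1) * b k j := by
    rw [h1]
    refine norm_sum_le_of_le _ fun j _ => ?_
    rw [norm_mul]
    exact mul_le_mul (hq j) (H.norm_le k j) (norm_nonneg _) (by positivity)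
  have h3 := sum_range_le_of_two_step (u := fun j => (10 / 9 : ℝ) ^ (j + 1) * b k j) (θ := 0.052)
    (fun j => mul_nonneg (by positivity) (H.nonneg k j)) (by norm_num)
    (fun j => H.weighted_two_step k j) k.toNat
  have h4 := H.one_le k
  have h5 := H.nonneg k 0
  refine h2.trans (h3.trans ?_)
  -- With `b k 1 ≤ 2.02 * b k 0`, what is needed is `10 / 9 + (100 / 81) * 2.02 ≤ 4 * 0.948`.
  rw [div_le_iff₀ (by norm_num)]
  norm_num
  linarith

/-- The induction carries nonvanishing and closeness together. Earlier ratios lie within `4 * 0.0205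
< 1 / 10` of 1, so their inverses are at most `10 / 9`. Chaining these bounds the quotients in the
recursion for the next ratio, which is then itself within `1 / 10` of 1 and cannot vanish. -/
theorem ratio_bounds_aux (H : DecayingRecursion a c b) (m : ℕ) :
    ∀ k : ℤ, k ≤ m → a k ≠ 0 ∧ ‖a k / a (k - 1) - 1‖ ≤ 4 * b k 0 := by
  induction m with
  | zero =>
    intro k hk
    have hk : k ≤ 0 := by simpa using hk
    rw [H.init k hk, H.init (k - 1) (by omega)]
    simpa using H.nonneg k 0
  | succ m ih =>
    intro k hk
    rcases (show k ≤ m ∨ k = m + 1 by push_cast at hk; omega) with h | rfl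
    · exact ih k h
    have hlow : ∀ i : ℤ, i ≤ m → ‖a (i - 1) / a i‖ ≤ 10 / 9 := by
      intro i hi
      obtain ⟨h1, h2⟩ := ih i hi
      have h3 := (ih (i - 1) (by omega)).1
      have h4 := H.zero_le i
      have h5 : 9 / 10 ≤ ‖a i / a (i - 1)‖ := by
        have := norm_sub_norm_le 1 (1 - a i / a (i - 1))
        rw [norm_one, norm_sub_rev, sub_sub_cancel] at this
        linarith
      rw [← inv_div, norm_inv]
      exact (inv_anti₀ (by norm_num) h5).trans (by norm_num)
    have ha : a ((m : ℤ) + 1 - 1) ≠ 0 := (ih _ (by omega)).1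
    have hq : ∀ j : ℕ, ‖a ((m : ℤ) + 1 - j - 2) / a ((m : ℤ) + 1 - 1)‖ ≤ (10 / 9) ^ (j + 1) := by
      intro j
      induction j with
      | zero =>
        have := hlow m le_rfl
        have e1 : (m : ℤ) + 1 - (0 : ℕ) - 2 = m - 1 := by push_cast; ring
        have e2 : (m : ℤ) + 1 - 1 = m := by ring
        rw [e1, e2]; simpa using this
      | succ j ihj =>
        have h6 := hlow ((m : ℤ) + 1 - j - 2) (by omega)
        have h7 := (ih ((m : ℤ) + 1 - j - 2) (by omega)).1
        have e1 : (m : ℤ) + 1 - (j + 1 : ℕ) - 2 = (m : ℤ) + 1 - j - 2 - 1 := by push_cast; ring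
        have e3 : a ((m : ℤ) + 1 - j - 2 - 1) / a ((m : ℤ) + 1 - 1) =
            a ((m : ℤ) + 1 - j - 2) / a ((m : ℤ) + 1 - 1) *
            (a ((m : ℤ) + 1 - j - 2 - 1) / a ((m : ℤ) + 1 - j - 2)) := by
          field_simp
        rw [e1, e3, norm_mul, pow_succ]
        exact mul_le_mul ihj h6 (norm_nonneg _) (by positivity)
    have h8 := H.norm_ratio_sub_one_le_of_quotients ha hq
    refine ⟨?_, h8⟩
    intro h9
    rw [h9, zero_div, zero_sub, norm_neg, norm_one] at h8
    linarith [H.zero_le ((m : ℤ) + 1)]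

theorem ne_zero (H : DecayingRecursion a c b) (k : ℤ) : a k ≠ 0 :=
  (H.ratio_bounds_aux k.toNat k (Int.self_le_toNat k)).1

theorem norm_ratio_sub_one_le (H : DecayingRecursion a c b) (k : ℤ) :
    ‖a k / a (k - 1) - 1‖ ≤ 4 * b k 0 :=
  (H.ratio_bounds_aux k.toNat k (Int.self_le_toNat k)).2

theorem norm_inv_ratio_le (H : DecayingRecursion a c b) (k : ℤ) :
    ‖a (k - 1) / a k‖ ≤ 10 / 9 := by
  have h2 := H.norm_ratio_sub_one_le k
  have h4 := H.zero_le k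
  have h5 : 9 / 10 ≤ ‖a k / a (k - 1)‖ := by
    have := norm_sub_norm_le 1 (1 - a k / a (k - 1))
    rw [norm_one, norm_sub_rev, sub_sub_cancel] at this
    linarith
  rw [← inv_div, norm_inv]
  exact (inv_anti₀ (by norm_num) h5).trans (by norm_num)

theorem norm_quotient_le (H : DecayingRecursion a c b) (k : ℤ) (j : ℕ) :
    ‖a (k - j - 2) / a (k - 1)‖ ≤ (10 / 9) ^ (j + 1) := by
  induction j with
  | zero =>
    have := H.norm_inv_ratio_le (k - 1)
    have e1 : k - (0 : ℕ) - 2 = k - 1 - 1 := by push_cast; ring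
    rw [e1]; simpa using this
  | succ j ihj =>
    have h6 := H.norm_inv_ratio_le (k - j - 2)
    have h7 := H.ne_zero (k - j - 2)
    have e1 : k - (j + 1 : ℕ) - 2 = k - j - 2 - 1 := by push_cast; ring
    have e3 : a (k - j - 2 - 1) / a (k - 1) =
        a (k - j - 2) / a (k - 1) * (a (k - j - 2 - 1) / a (k - j - 2)) := by
      field_simp
    rw [e1, e3, norm_mul, pow_succ]
    exact mul_le_mul ihj h6 (norm_nonneg _) (by positivity)

theorem norm_inv_ratio_sub_one_le (H : DecayingRecursion a c b) (k : ℤ) :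
    ‖a (k - 1) / a k - 1‖ ≤ 4.5 * b k 0 := by
  have h1 := H.ne_zero k
  have h2 := H.ne_zero (k - 1)
  have e : a (k - 1) / a k - 1 = -(a (k - 1) / a k * (a k / a (k - 1) - 1)) := by
    field_simp; ring
  rw [e, norm_neg, norm_mul]
  have h3 := mul_le_mul (H.norm_inv_ratio_le k) (H.norm_ratio_sub_one_le k) (norm_nonneg _)
    (by norm_num)
  linarith [H.nonneg k 0]

/-- For a ratio `r`, the expression `1 / r - 1 + (r - 1)` equals `-(1 / r - 1) * (r - 1)`, hence is
quadratic in `r - 1`. This permits replacing an inverse ratio by `2 - r` in the third order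
expansion. -/
theorem norm_inv_ratio_expansion_le (H : DecayingRecursion a c b) (k : ℤ) :
    ‖a (k - 1) / a k - 1 + (a k / a (k - 1) - 1)‖ ≤ 18 * b k 0 ^ 2 := by
  have h1 := H.ne_zero k
  have h2 := H.ne_zero (k - 1)
  have e : a (k - 1) / a k - 1 + (a k / a (k - 1) - 1)
      = -((a (k - 1) / a k - 1) * (a k / a (k - 1) - 1)) := by
    field_simp; ring
  rw [e, norm_neg, norm_mul]
  have h0 := H.nonneg k 0
  have h3 := mul_le_mul (H.norm_inv_ratio_sub_one_le k) (H.norm_ratio_sub_one_le k) (norm_nonneg _)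
    (by positivity)
  nlinarith

theorem norm_second_quotient_sub_one_le (H : DecayingRecursion a c b) (k : ℤ) :
    ‖a (k - 3) / a (k - 1) - 1‖ ≤ 5.1 * (b (k - 1) 0 + b (k - 2) 0) := by
  have h2 := H.ne_zero (k - 2)
  have e : a (k - 3) / a (k - 1) - 1 = (a (k - 2) / a (k - 1) - 1) * (a (k - 3) / a (k - 2))
      + (a (k - 3) / a (k - 2) - 1) := by
    field_simp; ring
  have h3 := H.norm_inv_ratio_sub_one_le (k - 1)
  have h4 := H.norm_inv_ratio_sub_one_le (k - 2)
  have h5 := H.norm_inv_ratio_le (k - 2)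
  have e1 : k - 1 - 1 = k - 2 := by ring
  have e2 : k - 2 - 1 = k - 3 := by ring
  rw [e1] at h3
  rw [e2] at h4 h5
  have h0 := H.nonneg (k - 1) 0
  have h0' := H.nonneg (k - 2) 0
  rw [e]
  refine (norm_add_le _ _).trans ?_
  rw [norm_mul]
  have h6 := mul_le_mul h3 h5 (norm_nonneg _) (by positivity)
  linarith

/-- The two leading terms of the recursion are kept exactly and the rest is summed by the two-step
estimate. The constants are `(10 / 9) ^ 3 / 0.948` and `(10 / 9) ^ 4 / 0.948`, rounded up. -/
theorem norm_ratio_remainder_le (H : DecayingRecursion a c b) (k : ℤ) :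
    ‖a k / a (k - 1) - 1 - a (k - 2) / a (k - 1) * c k 0 - a (k - 3) / a (k - 1) * c k 1‖
      ≤ 1.46 * b k 2 + 1.62 * b k 3 := by
  have ha := H.ne_zero (k - 1)
  have h1 : a k / a (k - 1) - 1 - a (k - 2) / a (k - 1) * c k 0 - a (k - 3) / a (k - 1) * c k 1 =
      ∑ j ∈ range k.toNat, a (k - (j + 2 : ℕ) - 2) / a (k - 1) * c k (j + 2) := by
    have h2 := H.step k (k.toNat + 2) (by push_cast; have := Int.self_le_toNat k; omega)
    rw [sum_range_succ', sum_range_succ'] at h2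
    have e1 : k - (0 + 1 : ℕ) - 2 = k - 3 := by push_cast; ring
    have e2 : k - (0 : ℕ) - 2 = k - 2 := by push_cast; ring
    rw [e1, e2] at h2
    rw [h2, add_div, div_self ha]
    have h3 : ∑ j ∈ range k.toNat, a (k - (j + 2 : ℕ) - 2) / a (k - 1) * c k (j + 2)
        = (∑ j ∈ range k.toNat, a (k - (j + 1 + 1 : ℕ) - 2) * c k (j + 1 + 1)) / a (k - 1) := by
      rw [sum_div]
      exact sum_congr rfl fun j _ => by ring
    rw [h3]
    ring
  have h2 : ∑ j ∈ range k.toNat, (10 / 9 : ℝ) ^ (j + 2 + 1) * b k (j + 2)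
      ≤ ((10 / 9 : ℝ) ^ 3 * b k 2 + (10 / 9 : ℝ) ^ 4 * b k 3) / (1 - 0.052) :=
    sum_range_le_of_two_step (u := fun j => (10 / 9 : ℝ) ^ (j + 2 + 1) * b k (j + 2)) (θ := 0.052)
      (fun j => mul_nonneg (by positivity) (H.nonneg k _)) (by norm_num)
      (fun j => H.weighted_two_step k (j + 2)) k.toNat
  have h3 := H.nonneg k 2
  have h4 := H.nonneg k 3
  rw [h1]
  refine (norm_sum_le_of_le _ fun j _ => ?_).trans (h2.trans ?_)
  · rw [norm_mul]
    exact mul_le_mul (H.norm_quotient_le k _) (H.norm_le k _) (norm_nonneg _) (by positivity)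
  · rw [div_le_iff₀ (by norm_num)]
    norm_num
    linarith

end DecayingRecursion

end Recursion

/-! ### Expansion of the ratios in powers of `z` and comparison of the products. -/

section LocalExpansion

open Finset

/-- A decaying recursion whose coefficients are expanded in powers of `z`; the coefficients of the
expansions are thought of as the moments of a one-dependent sequence. -/
structure ExpandedRecursion (z : ℂ) (B : ℝ) (a : ℤ → ℂ) (c : ℤ → ℕ → ℂ) (b : ℤ → ℕ → ℝ)
    (ν₁ ν₂ ν₃ mix e₂₂ m₃ : ℤ → ℝ) : Prop extends DecayingRecursion a c b where
  z_le : ‖z‖ ≤ 2.01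
  B_nonneg : 0 ≤ B
  ν₁_nonneg : ∀ k, 0 ≤ ν₁ k
  ν₂_nonneg : ∀ k, 0 ≤ ν₂ k
  ν₃_nonneg : ∀ k, 0 ≤ ν₃ k
  mix_nonneg : ∀ k, 0 ≤ mix k
  e₂₂_nonneg : ∀ k, 0 ≤ e₂₂ k
  m₃_nonneg : ∀ k, 0 ≤ m₃ k
  ν₁_le : ∀ k, ν₁ k ≤ 1 / 100
  ν₂_le : ∀ k, ν₂ k ≤ ν₁ k
  mix_le : ∀ k, mix k ≤ B * ν₁ k
  b_zero : ∀ k, b k 0 ≤ 1.01 * ‖z‖ * ν₁ k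
  c_zero : ∀ k, ‖c k 0 - ν₁ k * z‖ ≤ 0.505 * ‖z‖ ^ 2 * ν₂ k
  c_zero' : ∀ k, ‖c k 0 - ν₁ k * z - ν₂ k / 2 * z ^ 2‖ ≤ 0.17 * ‖z‖ ^ 3 * ν₃ k
  b_one : ∀ k, b k 1 ≤ 1.03 * ‖z‖ ^ 2 * mix k
  c_one : ∀ k, ‖c k 1 - mix k * z ^ 2‖ ≤ 1.03 * ‖z‖ ^ 3 * e₂₂ k
  b_two : ∀ k, b k 2 ≤ 2.1 * ‖z‖ ^ 2 * (ν₁ k * ν₁ (k - 2))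
  b_two' : ∀ k, b k 2 ≤ 1.04 * ‖z‖ ^ 3 * m₃ k

namespace ExpandedRecursion

variable {z : ℂ} {B : ℝ} {a : ℤ → ℂ} {c : ℤ → ℕ → ℂ} {b : ℤ → ℕ → ℝ}
  {ν₁ ν₂ ν₃ mix e₂₂ m₃ : ℤ → ℝ}

/-- Only the term `c k 0` is of first order in `z`. Its multiplier `a (k-2) / a (k-1)` differs from
1 by a multiple of `‖z‖ * ν₁ (k-1)`, and the terms with more factors are already of order `‖z‖ ^ 2`.
-/
theorem norm_ratio_first_order (H : ExpandedRecursion z B a c b ν₁ ν₂ ν₃ mix e₂₂ m₃) (k : ℤ) :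
    ‖a k / a (k - 1) - 1 - ν₁ k * z‖ ≤ ‖z‖ ^ 2 * (0.51 * ν₂ k + 4.6 * (ν₁ k * ν₁ (k - 1))
      + 1.35 * mix k + 3.1 * (ν₁ k * ν₁ (k - 2))) := by
  have R := H.toDecayingRecursion
  have e : a k / a (k - 1) - 1 - ν₁ k * z =
      (a k / a (k - 1) - 1 - a (k - 2) / a (k - 1) * c k 0 - a (k - 3) / a (k - 1) * c k 1)
      + (c k 0 - ν₁ k * z) + c k 0 * (a (k - 1 - 1) / a (k - 1) - 1)
      + a (k - 3) / a (k - 1) * c k 1 := by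
    rw [show k - 1 - 1 = k - 2 by ring]; ring
  have h1 := R.norm_ratio_remainder_le k
  have h2 := H.c_zero k
  have hz := norm_nonneg z
  have h3 : ‖c k 0 * (a (k - 1 - 1) / a (k - 1) - 1)‖ ≤ (1.01 * ‖z‖ * ν₁ k) *
      (4.5 * (1.01 * ‖z‖ * ν₁ (k - 1))) := by
    rw [norm_mul]
    refine mul_le_mul ((R.norm_le k 0).trans (H.b_zero k))
      ((R.norm_inv_ratio_sub_one_le (k - 1)).trans ?_) (norm_nonneg _)
      (mul_nonneg (by positivity) (H.ν₁_nonneg k))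
    exact mul_le_mul_of_nonneg_left (H.b_zero _) (by norm_num)
  have h4 : ‖a (k - 3) / a (k - 1) * c k 1‖ ≤ (10 / 9) ^ 2 * (1.03 * ‖z‖ ^ 2 * mix k) := by
    rw [norm_mul]
    have := R.norm_quotient_le k 1
    rw [show k - (1 : ℕ) - 2 = k - 3 by push_cast; ring] at this
    exact mul_le_mul this ((R.norm_le k 1).trans (H.b_one k)) (norm_nonneg _) (by positivity)
  have h5 := H.b_two k
  have h6 := R.two_step k 1
  have h7 := H.b_one k
  have hx : 0 ≤ ‖z‖ ^ 2 * ν₂ k := mul_nonneg (by positivity) (H.ν₂_nonneg k)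
  have hy : 0 ≤ ‖z‖ ^ 2 * (ν₁ k * ν₁ (k - 1)) :=
    mul_nonneg (by positivity) (mul_nonneg (H.ν₁_nonneg _) (H.ν₁_nonneg _))
  have hw : 0 ≤ ‖z‖ ^ 2 * (ν₁ k * ν₁ (k - 2)) :=
    mul_nonneg (by positivity) (mul_nonneg (H.ν₁_nonneg _) (H.ν₁_nonneg _))
  have hm : 0 ≤ ‖z‖ ^ 2 * mix k := mul_nonneg (by positivity) (H.mix_nonneg k)
  rw [e]
  refine (norm_add₃_le.trans (add_le_add_left (add_le_add_left (norm_add_le _ _) _) _)).trans ?_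
  nlinarith

/-- Coefficient in the exponential majorant of the ratios. -/
noncomputable def majorantCoeff (ν₁ ν₂ mix : ℤ → ℝ) (k : ℤ) : ℝ :=
  0.51 * ν₂ k + 0.16 * ν₁ k + 1.35 * mix k

/-- The triangle bound `1 + ‖v‖` would discard the sign of the real part, whose negativity away from
`t = 0` is the only source of Gaussian decay. -/
theorem norm_le_exp_re (v : ℂ) : ‖1 + v‖ ≤ Real.exp (v.re + ‖v‖ ^ 2 / 2) := by
  refine le_of_sq_le_sq ?_ (Real.exp_pos _).le
  rw [← Real.exp_nat_mul, ← Complex.normSq_eq_norm_sq, ← Complex.normSq_eq_norm_sq,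
    Complex.normSq_apply, Complex.normSq_apply]
  refine le_trans (le_of_eq ?_) (Real.add_one_le_exp _)
  simp
  ring

theorem norm_ratio_le (H : ExpandedRecursion z B a c b ν₁ ν₂ ν₃ mix e₂₂ m₃) (k : ℤ) :
    ‖a k / a (k - 1)‖ ≤ Real.exp (ν₁ k * z.re + ‖z‖ ^ 2 * majorantCoeff ν₁ ν₂ mix k) := by
  have R := H.toDecayingRecursion
  have h0 := norm_le_exp_re (a k / a (k - 1) - 1)
  rw [add_sub_cancel] at h0
  refine h0.trans (Real.exp_le_exp.2 ?_)
  have h1 := H.norm_ratio_first_order k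
  have h2 : (a k / a (k - 1) - 1).re ≤ ν₁ k * z.re + ‖a k / a (k - 1) - 1 - ν₁ k * z‖ := by
    have := Complex.re_le_norm (a k / a (k - 1) - 1 - ν₁ k * z)
    simp at this ⊢
    linarith
  have h3 : ‖a k / a (k - 1) - 1‖ ^ 2 ≤ (4 * (1.01 * ‖z‖ * ν₁ k)) ^ 2 :=
    pow_le_pow_left₀ (norm_nonneg _) ((R.norm_ratio_sub_one_le k).trans
      (mul_le_mul_of_nonneg_left (H.b_zero k) (by norm_num))) 2
  have hn := H.ν₁_nonneg k
  have h4 : ν₁ k * ν₁ (k - 1) ≤ ν₁ k * (1 / 100) := mul_le_mul_of_nonneg_left (H.ν₁_le _) hn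
  have h5 : ν₁ k * ν₁ (k - 2) ≤ ν₁ k * (1 / 100) := mul_le_mul_of_nonneg_left (H.ν₁_le _) hn
  have h6 : ν₁ k * ν₁ k ≤ ν₁ k * (1 / 100) := mul_le_mul_of_nonneg_left (H.ν₁_le _) hn
  -- The coefficient `8.2` exceeds `4.04 ^ 2 / 2`, the quadratic term of `norm_le_exp_re`. With `ν₁
  -- ≤ 1 / 100` the products contribute `(4.6 + 3.1 + 8.2) / 100 ≤ 0.16`.
  have h7 : 0.51 * ν₂ k + 4.6 * (ν₁ k * ν₁ (k - 1)) + 1.35 * mix k + 3.1 * (ν₁ k * ν₁ (k - 2))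
      + 8.2 * (ν₁ k * ν₁ k) ≤ majorantCoeff ν₁ ν₂ mix k := by
    unfold majorantCoeff
    linarith
  have h8 := mul_le_mul_of_nonneg_left h7 (sq_nonneg ‖z‖)
  have h9 : 0 ≤ ‖z‖ ^ 2 * (ν₁ k * ν₁ k) := by positivity
  nlinarith

/-- The coefficient of `z ^ 2` in the logarithm of the `k`-th ratio. -/
noncomputable def secondCoeff (ν₁ ν₂ mix : ℤ → ℝ) (k : ℤ) : ℝ :=
  ν₂ k / 2 - ν₁ k ^ 2 / 2 + (mix k - ν₁ (k - 1) * ν₁ k)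

theorem abs_secondCoeff_le (H : ExpandedRecursion z B a c b ν₁ ν₂ ν₃ mix e₂₂ m₃) (k : ℤ) :
    |secondCoeff ν₁ ν₂ mix k| ≤ ν₂ k / 2 + ν₁ k ^ 2 / 2 + mix k + ν₁ (k - 1) * ν₁ k := by
  have h1 := H.ν₂_nonneg k
  have h2 := H.mix_nonneg k
  have h3 := mul_nonneg (H.ν₁_nonneg (k - 1)) (H.ν₁_nonneg k)
  have h4 := sq_nonneg (ν₁ k)
  unfold secondCoeff
  rw [abs_le]
  constructor <;> linarith

/-- The approximating exponential obeys the same majorant as the ratio, as the telescoping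
comparison of products requires. -/
theorem norm_exp_le (H : ExpandedRecursion z B a c b ν₁ ν₂ ν₃ mix e₂₂ m₃) (k : ℤ) :
    ‖Complex.exp (ν₁ k * z + secondCoeff ν₁ ν₂ mix k * z ^ 2)‖
      ≤ Real.exp (ν₁ k * z.re + ‖z‖ ^ 2 * majorantCoeff ν₁ ν₂ mix k) := by
  rw [Complex.norm_exp, Real.exp_le_exp, Complex.add_re, Complex.re_ofReal_mul]
  have h1 : (secondCoeff ν₁ ν₂ mix k * z ^ 2 : ℂ).re ≤ |secondCoeff ν₁ ν₂ mix k| * ‖z‖ ^ 2 := by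
    refine (Complex.re_le_norm _).trans (le_of_eq ?_)
    rw [norm_mul, norm_pow, Complex.norm_real, Real.norm_eq_abs]
  have h2 : |secondCoeff ν₁ ν₂ mix k| ≤ majorantCoeff ν₁ ν₂ mix k := by
    have h3 := H.abs_secondCoeff_le k
    have h4 := mul_le_mul_of_nonneg_right (H.ν₁_le (k - 1)) (H.ν₁_nonneg k)
    have h5 := mul_le_mul_of_nonneg_right (H.ν₁_le k) (H.ν₁_nonneg k)
    have h6 := H.mix_nonneg k
    have h7 := H.ν₂_nonneg k
    have h8 := H.ν₁_nonneg k
    unfold majorantCoeff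
    nlinarith
  nlinarith [mul_le_mul_of_nonneg_right h2 (sq_nonneg ‖z‖)]

theorem norm_ratio_third_order (H : ExpandedRecursion z B a c b ν₁ ν₂ ν₃ mix e₂₂ m₃) (k : ℤ) :
    ‖a k / a (k - 1) - (1 + ν₁ k * z
        + (ν₂ k / 2 + (mix k - ν₁ (k - 1) * ν₁ k) : ℝ) * z ^ 2)‖
      ≤ ‖z‖ ^ 3 * (5 * m₃ k + 0.17 * ν₃ k + 19 * (ν₁ k * ν₁ (k - 1) ^ 2)
        + 1.01 * (ν₁ k * (0.51 * ν₂ (k - 1) + 4.6 * (ν₁ (k - 1) * ν₁ (k - 2))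
          + 1.35 * mix (k - 1) + 3.1 * (ν₁ (k - 1) * ν₁ (k - 3))))
        + 0.51 * (ν₂ k * ν₁ (k - 1)) + 5.4 * (mix k * (ν₁ (k - 1) + ν₁ (k - 2)))
        + 1.03 * e₂₂ k) := by
  have R := H.toDecayingRecursion
  have hz := norm_nonneg z
  have hn := H.ν₁_nonneg k
  have hn1 := H.ν₁_nonneg (k - 1)
  have hn2 := H.ν₁_nonneg (k - 2)
  have hb0 := (R.norm_le k 0).trans (H.b_zero k)
  -- The factor `a (k-2) / a (k-1)` is an inverse ratio. It is replaced by `2` minus that ratio and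
  -- then by `1 - ν₁ (k-1) * z`; this produces the term `-ν₁ (k-1) * ν₁ k` that completes `mix k` to
  -- a covariance. Each of the seven summands is of third order.
  have e : a k / a (k - 1) - (1 + ν₁ k * z
        + (ν₂ k / 2 + (mix k - ν₁ (k - 1) * ν₁ k) : ℝ) * z ^ 2) =
      (a k / a (k - 1) - 1 - a (k - 2) / a (k - 1) * c k 0 - a (k - 3) / a (k - 1) * c k 1)
      + (c k 0 - ν₁ k * z - ν₂ k / 2 * z ^ 2)
      + c k 0 * (a (k - 1 - 1) / a (k - 1) - 1 + (a (k - 1) / a (k - 1 - 1) - 1))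
      + -(c k 0 * (a (k - 1) / a (k - 1 - 1) - 1 - ν₁ (k - 1) * z))
      + -((c k 0 - ν₁ k * z) * (ν₁ (k - 1) * z))
      + (a (k - 3) / a (k - 1) - 1) * c k 1 + (c k 1 - mix k * z ^ 2) := by
    rw [show k - 1 - 1 = k - 2 by ring]
    push_cast
    ring
  have h1 : ‖a k / a (k - 1) - 1 - a (k - 2) / a (k - 1) * c k 0 - a (k - 3) / a (k - 1) * c k 1‖
      ≤ ‖z‖ ^ 3 * (5 * m₃ k) := by
    have := H.b_two' k
    have h3 := R.succ_le k 2
    have h4 : 0 ≤ ‖z‖ ^ 3 * m₃ k := mul_nonneg (by positivity) (H.m₃_nonneg k)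
    exact (R.norm_ratio_remainder_le k).trans (by nlinarith)
  have h2 := H.c_zero' k
  have h3 : ‖c k 0 * (a (k - 1 - 1) / a (k - 1) - 1 + (a (k - 1) / a (k - 1 - 1) - 1))‖
      ≤ ‖z‖ ^ 3 * (19 * (ν₁ k * ν₁ (k - 1) ^ 2)) := by
    rw [norm_mul]
    have h5 := pow_le_pow_left₀ (R.nonneg (k - 1) 0) (H.b_zero (k - 1)) 2
    have h6 : ‖a (k - 1 - 1) / a (k - 1) - 1 + (a (k - 1) / a (k - 1 - 1) - 1)‖
        ≤ 18 * (1.01 * ‖z‖ * ν₁ (k - 1)) ^ 2 :=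
      (R.norm_inv_ratio_expansion_le (k - 1)).trans (by linarith)
    refine (mul_le_mul hb0 h6 (norm_nonneg _) (by positivity)).trans ?_
    have : 0 ≤ ‖z‖ ^ 3 * (ν₁ k * ν₁ (k - 1) ^ 2) := by positivity
    nlinarith
  have h4 : ‖-(c k 0 * (a (k - 1) / a (k - 1 - 1) - 1 - ν₁ (k - 1) * z))‖
      ≤ ‖z‖ ^ 3 * (1.01 * (ν₁ k * (0.51 * ν₂ (k - 1) + 4.6 * (ν₁ (k - 1) * ν₁ (k - 2))
          + 1.35 * mix (k - 1) + 3.1 * (ν₁ (k - 1) * ν₁ (k - 3))))) := by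
    rw [norm_neg, norm_mul]
    have h5 := H.norm_ratio_first_order (k - 1)
    rw [show k - 1 - 2 = k - 3 by ring, show (k - 1 - 1 : ℤ) = k - 2 by ring] at h5
    rw [show (k - 1 - 1 : ℤ) = k - 2 by ring]
    refine (mul_le_mul hb0 h5 (norm_nonneg _) (by positivity)).trans (le_of_eq ?_)
    ring
  have h5 : ‖-((c k 0 - ν₁ k * z) * (ν₁ (k - 1) * z))‖
      ≤ ‖z‖ ^ 3 * (0.51 * (ν₂ k * ν₁ (k - 1))) := by
    rw [norm_neg, norm_mul, norm_mul, Complex.norm_real, Real.norm_of_nonneg hn1]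
    refine (mul_le_mul_of_nonneg_right (H.c_zero k) (by positivity)).trans ?_
    have : 0 ≤ ‖z‖ ^ 3 * (ν₂ k * ν₁ (k - 1)) :=
      mul_nonneg (by positivity) (mul_nonneg (H.ν₂_nonneg k) hn1)
    nlinarith
  have h6 : ‖(a (k - 3) / a (k - 1) - 1) * c k 1‖
      ≤ ‖z‖ ^ 3 * (5.4 * (mix k * (ν₁ (k - 1) + ν₁ (k - 2)))) := by
    rw [norm_mul]
    have h7 : ‖a (k - 3) / a (k - 1) - 1‖ ≤ 5.1 * (1.01 * ‖z‖ * (ν₁ (k - 1) + ν₁ (k - 2))) := by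
      refine (R.norm_second_quotient_sub_one_le k).trans ?_
      linarith [H.b_zero (k - 1), H.b_zero (k - 2)]
    refine (mul_le_mul h7 ((R.norm_le k 1).trans (H.b_one k)) (norm_nonneg _)
      (by positivity)).trans ?_
    have : 0 ≤ ‖z‖ ^ 3 * (mix k * (ν₁ (k - 1) + ν₁ (k - 2))) :=
      mul_nonneg (by positivity) (mul_nonneg (H.mix_nonneg k) (by positivity))
    nlinarith
  have h7 := H.c_one k
  rw [e]
  refine (norm_add_le_of_le (norm_add_le_of_le (norm_add_le_of_le (norm_add_le_of_le
    (norm_add_le_of_le (norm_add_le_of_le h1 h2) h3) h4) h5) h6) h7).trans (le_of_eq ?_)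
  ring

theorem norm_exp_sub_quadratic_le (u : ℂ) :
    ‖Complex.exp u - (1 + u + u ^ 2 / 2)‖ ≤ ‖u‖ ^ 3 * Real.exp ‖u‖ := by
  have := Complex.norm_exp_sub_sum_le_norm_mul_exp u 3
  simpa [Finset.sum_range_succ, Nat.factorial] using this

/-- The second order Taylor polynomial of the exponential has `z ^ 2` coefficient `secondCoeff + ν₁
^ 2 / 2`, exactly that of the ratio. The rest is of third order because `secondCoeff` is at most a
multiple of `ν₁`. -/
theorem norm_exp_third_order (H : ExpandedRecursion z B a c b ν₁ ν₂ ν₃ mix e₂₂ m₃) (k : ℤ) :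
    ‖Complex.exp (ν₁ k * z + secondCoeff ν₁ ν₂ mix k * z ^ 2) - (1 + ν₁ k * z
        + (ν₂ k / 2 + (mix k - ν₁ (k - 1) * ν₁ k) : ℝ) * z ^ 2)‖
      ≤ ‖z‖ ^ 3 * ((5 + 3 * B) ^ 3 * Real.exp (5 + 3 * B) * ν₁ k ^ 3
        + (3 + 2 * B) * (ν₁ k * (ν₂ k / 2 + ν₁ k ^ 2 / 2 + mix k + ν₁ (k - 1) * ν₁ k))) := by
  set s := secondCoeff ν₁ ν₂ mix k with hs
  have hz := norm_nonneg z
  have hz2 := H.z_le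
  have hB := H.B_nonneg
  have hn := H.ν₁_nonneg k
  have hn1 := H.ν₁_nonneg (k - 1)
  have hs1 : |s| ≤ ν₂ k / 2 + ν₁ k ^ 2 / 2 + mix k + ν₁ (k - 1) * ν₁ k := H.abs_secondCoeff_le k
  have hs2 : |s| ≤ (0.6 + B) * ν₁ k := by
    have h1 := H.ν₂_le k
    have h2 := H.mix_le k
    have h4 := mul_le_mul_of_nonneg_right (H.ν₁_le (k - 1)) (H.ν₁_nonneg k)
    have h5 := mul_le_mul_of_nonneg_right (H.ν₁_le k) (H.ν₁_nonneg k)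
    nlinarith
  set u : ℂ := ν₁ k * z + s * z ^ 2 with hu
  have hu1 : ‖u‖ ≤ ‖z‖ * ((5 + 3 * B) * ν₁ k) := by
    have h1 : ‖u‖ ≤ ν₁ k * ‖z‖ + |s| * ‖z‖ ^ 2 := by
      refine (norm_add_le _ _).trans (le_of_eq ?_)
      rw [norm_mul, norm_mul, norm_pow, Complex.norm_real, Complex.norm_real,
        Real.norm_of_nonneg hn, Real.norm_eq_abs]
    have h2 : |s| * ‖z‖ ^ 2 ≤ ((0.6 + B) * ν₁ k) * (2.01 * ‖z‖) := by
      refine mul_le_mul hs2 (by nlinarith) (by positivity) (by positivity)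
    have h3 : 0 ≤ ν₁ k * ‖z‖ := by positivity
    have h4 : 0 ≤ B * (ν₁ k * ‖z‖) := by positivity
    nlinarith
  have hu2 : ‖u‖ ≤ 5 + 3 * B := by
    have h1 : ‖z‖ * ν₁ k ≤ 1 := by nlinarith [H.ν₁_le k]
    nlinarith
  have e : Complex.exp u - (1 + ν₁ k * z
        + (ν₂ k / 2 + (mix k - ν₁ (k - 1) * ν₁ k) : ℝ) * z ^ 2)
      = (Complex.exp u - (1 + u + u ^ 2 / 2)) + ν₁ k * s * z ^ 3 + s ^ 2 / 2 * z ^ 4 := by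
    have : (ν₂ k / 2 + (mix k - ν₁ (k - 1) * ν₁ k) : ℝ) = s + ν₁ k ^ 2 / 2 := by
      rw [hs]; unfold secondCoeff; ring
    rw [this, hu]
    push_cast
    ring
  have h1 : ‖Complex.exp u - (1 + u + u ^ 2 / 2)‖
      ≤ ‖z‖ ^ 3 * ((5 + 3 * B) ^ 3 * Real.exp (5 + 3 * B) * ν₁ k ^ 3) := by
    refine (norm_exp_sub_quadratic_le u).trans ?_
    calc ‖u‖ ^ 3 * Real.exp ‖u‖ ≤ (‖z‖ * ((5 + 3 * B) * ν₁ k)) ^ 3 * Real.exp (5 + 3 * B) := by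
          gcongr
      _ = _ := by ring
  have h2 : ‖(ν₁ k * s * z ^ 3 : ℂ)‖ ≤ ‖z‖ ^ 3 * (ν₁ k * |s|) := by
    rw [norm_mul, norm_mul, norm_pow, Complex.norm_real, Complex.norm_real,
        Real.norm_of_nonneg hn, Real.norm_eq_abs]
    exact le_of_eq (by ring)
  have h3 : ‖(s ^ 2 / 2 * z ^ 4 : ℂ)‖ ≤ ‖z‖ ^ 3 * ((1.1 + 1.1 * B) * (ν₁ k * |s|)) := by
    rw [norm_mul, norm_div, norm_pow, norm_pow, Complex.norm_real, Real.norm_eq_abs,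
      Complex.norm_ofNat]
    calc |s| ^ 2 / 2 * ‖z‖ ^ 4 = |s| * (|s| * ‖z‖) * ‖z‖ ^ 3 / 2 := by ring
      _ ≤ ((0.6 + B) * ν₁ k) * (|s| * 2.01) * ‖z‖ ^ 3 / 2 := by gcongr
      _ ≤ _ := by
        have h4 : 0 ≤ ‖z‖ ^ 3 * (ν₁ k * |s|) := by positivity
        have h5 : 0 ≤ B * (‖z‖ ^ 3 * (ν₁ k * |s|)) := by positivity
        nlinarith
  rw [e]
  refine (norm_add_le_of_le (norm_add_le_of_le h1 h2) h3).trans ?_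
  have h6 : ν₁ k * |s| ≤ ν₁ k * (ν₂ k / 2 + ν₁ k ^ 2 / 2 + mix k + ν₁ (k - 1) * ν₁ k) :=
    mul_le_mul_of_nonneg_left hs1 hn
  have h7 : (1 + (1.1 + 1.1 * B)) * (ν₁ k * |s|) ≤ (3 + 2 * B) *
      (ν₁ k * (ν₂ k / 2 + ν₁ k ^ 2 / 2 + mix k + ν₁ (k - 1) * ν₁ k)) :=
    mul_le_mul (by linarith) h6 (by positivity) (by positivity)
  have h8 := mul_le_mul_of_nonneg_left h7 (show 0 ≤ ‖z‖ ^ 3 by positivity)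
  linarith

/-- The local error of third order. -/
noncomputable def localError (ν₁ ν₂ ν₃ mix e₂₂ m₃ : ℤ → ℝ) (k : ℤ) : ℝ :=
  ν₁ k ^ 3 + ν₁ (k - 1) ^ 3 + ν₁ (k - 2) ^ 3 + ν₁ (k - 3) ^ 3 + ν₁ k * ν₂ k + ν₃ k
    + (ν₁ (k - 2) + ν₁ (k - 1) + ν₁ k) * mix k + (e₂₂ k + ν₂ (k - 1) * ν₁ k + ν₁ (k - 1) * ν₂ k)
    + (m₃ k + mix (k - 1) * ν₁ k)

theorem mul_mul_le_cubes {x y t : ℝ} (hx : 0 ≤ x) (hy : 0 ≤ y) (ht : 0 ≤ t) :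
    x * y * t ≤ x ^ 3 + y ^ 3 + t ^ 3 := by
  nlinarith [mul_nonneg (add_nonneg (add_nonneg hx hy) ht) (sq_nonneg (x - y)),
    mul_nonneg (add_nonneg (add_nonneg hx hy) ht) (sq_nonneg (x - t)),
    mul_nonneg (add_nonneg (add_nonneg hx hy) ht) (sq_nonneg (y - t)), pow_nonneg hx 3,
    pow_nonneg hy 3, pow_nonneg ht 3]

/-- The constant in `norm_ratio_sub_exp_le`. -/
noncomputable def localConst (B : ℝ) : ℝ :=
  100 + (5 + 3 * B) ^ 3 * Real.exp (5 + 3 * B) + 4 * (3 + 2 * B)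

theorem norm_ratio_sub_exp_le (H : ExpandedRecursion z B a c b ν₁ ν₂ ν₃ mix e₂₂ m₃) (k : ℤ) :
    ‖a k / a (k - 1) - Complex.exp (ν₁ k * z + secondCoeff ν₁ ν₂ mix k * z ^ 2)‖
      ≤ localConst B * ‖z‖ ^ 3 * localError ν₁ ν₂ ν₃ mix e₂₂ m₃ k := by
  have h1 := H.norm_ratio_third_order k
  have h2 := H.norm_exp_third_order k
  have h3 := norm_sub_le_norm_sub_add_norm_sub (a k / a (k - 1)) (1 + ν₁ k * z
        + (ν₂ k / 2 + (mix k - ν₁ (k - 1) * ν₁ k) : ℝ) * z ^ 2)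
        (Complex.exp (ν₁ k * z + secondCoeff ν₁ ν₂ mix k * z ^ 2))
  rw [norm_sub_rev] at h2
  refine h3.trans ((add_le_add h1 h2).trans ?_)
  have e2 : localConst B * ‖z‖ ^ 3 * localError ν₁ ν₂ ν₃ mix e₂₂ m₃ k
      = ‖z‖ ^ 3 * (localConst B * localError ν₁ ν₂ ν₃ mix e₂₂ m₃ k) := by ring
  rw [e2, ← mul_add]
  refine mul_le_mul_of_nonneg_left ?_ (by positivity)
  have hB := H.B_nonneg
  have n0 := H.ν₁_nonneg k
  have n1 := H.ν₁_nonneg (k - 1)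
  have n2 := H.ν₁_nonneg (k - 2)
  have n3 := H.ν₁_nonneg (k - 3)
  have q1 := mul_mul_le_cubes n0 n1 n1
  have q2 := mul_mul_le_cubes n0 n1 n2
  have q3 := mul_mul_le_cubes n0 n1 n3
  have q4 := mul_mul_le_cubes n0 n0 n1
  have c0 := pow_nonneg n0 3
  have c1 := pow_nonneg n1 3
  have c2 := pow_nonneg n2 3
  have c3 := pow_nonneg n3 3
  have p1 := mul_nonneg n0 (H.ν₂_nonneg k)
  have p2 := mul_nonneg (H.ν₂_nonneg (k - 1)) n0
  have p3 := mul_nonneg n1 (H.ν₂_nonneg k)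
  have p4 := mul_nonneg (H.mix_nonneg (k - 1)) n0
  have p5 := mul_nonneg n0 (H.mix_nonneg k)
  have p6 := mul_nonneg n1 (H.mix_nonneg k)
  have p7 := mul_nonneg n2 (H.mix_nonneg k)
  have p8 := H.ν₃_nonneg k
  have p9 := H.e₂₂_nonneg k
  have p10 := H.m₃_nonneg k
  set L := localError ν₁ ν₂ ν₃ mix e₂₂ m₃ k with hL
  have hL' : L = ν₁ k ^ 3 + ν₁ (k - 1) ^ 3 + ν₁ (k - 2) ^ 3 + ν₁ (k - 3) ^ 3 + ν₁ k * ν₂ k + ν₃ k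
    + (ν₁ (k - 2) * mix k + ν₁ (k - 1) * mix k + ν₁ k * mix k)
    + (e₂₂ k + ν₂ (k - 1) * ν₁ k + ν₁ (k - 1) * ν₂ k) + (m₃ k + mix (k - 1) * ν₁ k) := by
    rw [hL]; unfold localError; ring
  have t1 : 5 * m₃ k + 0.17 * ν₃ k + 19 * (ν₁ k * ν₁ (k - 1) ^ 2)
        + 1.01 * (ν₁ k * (0.51 * ν₂ (k - 1) + 4.6 * (ν₁ (k - 1) * ν₁ (k - 2))
          + 1.35 * mix (k - 1) + 3.1 * (ν₁ (k - 1) * ν₁ (k - 3))))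
        + 0.51 * (ν₂ k * ν₁ (k - 1)) + 5.4 * (mix k * (ν₁ (k - 1) + ν₁ (k - 2)))
        + 1.03 * e₂₂ k ≤ 100 * L := by
    rw [hL']; linarith
  have t2 : ν₁ k ^ 3 ≤ L := by rw [hL']; linarith
  have t3 : ν₁ k * (ν₂ k / 2 + ν₁ k ^ 2 / 2 + mix k + ν₁ (k - 1) * ν₁ k) ≤ 2 * (L + ν₁ k ^ 3) := by
    rw [hL']; linarith
  have t4 : ν₁ k * (ν₂ k / 2 + ν₁ k ^ 2 / 2 + mix k + ν₁ (k - 1) * ν₁ k) ≤ 4 * L := by linarith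
  have s1 := mul_le_mul_of_nonneg_left t2
    (show 0 ≤ (5 + 3 * B) ^ 3 * Real.exp (5 + 3 * B) by positivity)
  have s2 := mul_le_mul_of_nonneg_left t4 (show 0 ≤ 3 + 2 * B by positivity)
  unfold localConst
  linarith

/-- Factors are exchanged one at a time. The exchanged index lacks its majorant `exp (α i)`, and `M`
pays for supplying it, so every term carries the full exponential. -/
theorem norm_prod_sub_prod_le {φ g : ℕ → ℂ} {α δ : ℕ → ℝ} {M : ℝ}
    (hφ : ∀ i, ‖φ i‖ ≤ Real.exp (α i)) (hg : ∀ i, ‖g i‖ ≤ Real.exp (α i))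
    (hα : ∀ i, Real.exp (-α i) ≤ M) (hδ : ∀ i, ‖φ i - g i‖ ≤ δ i) (m : ℕ) :
    ‖∏ i ∈ range m, φ i - ∏ i ∈ range m, g i‖
      ≤ M * (∑ i ∈ range m, δ i) * Real.exp (∑ i ∈ range m, α i) := by
  induction m with
  | zero => simp
  | succ m ih =>
    have e : (∏ i ∈ range m, φ i) * φ m - (∏ i ∈ range m, g i) * g m =
        φ m * (∏ i ∈ range m, φ i - ∏ i ∈ range m, g i)
          + (φ m - g m) * ∏ i ∈ range m, g i := by ring
    have h1 : ‖∏ i ∈ range m, g i‖ ≤ Real.exp (∑ i ∈ range m, α i) := by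
      rw [norm_prod, Real.exp_sum]
      exact prod_le_prod (fun i _ => norm_nonneg _) fun i _ => hg i
    have h2 : 1 ≤ M * Real.exp (α m) := by
      have := mul_le_mul_of_nonneg_right (hα m) (Real.exp_pos (α m)).le
      rwa [← Real.exp_add, neg_add_cancel, Real.exp_zero] at this
    have hδ0 : 0 ≤ δ m := (norm_nonneg _).trans (hδ m)
    rw [prod_range_succ, prod_range_succ, sum_range_succ, sum_range_succ, Real.exp_add, e]
    refine (norm_add_le _ _).trans ?_
    rw [norm_mul, norm_mul]
    have h3 := mul_le_mul (hφ m) ih (norm_nonneg _) (Real.exp_pos _).le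
    have h4 := mul_le_mul (hδ m) h1 (norm_nonneg _) hδ0
    have h5 : δ m * Real.exp (∑ i ∈ range m, α i)
        ≤ (M * Real.exp (α m)) * (δ m * Real.exp (∑ i ∈ range m, α i)) :=
      le_mul_of_one_le_left (by positivity) h2
    refine (add_le_add h3 (h4.trans h5)).trans (le_of_eq ?_)
    ring

theorem sum_Icc_int_eq {M : Type*} [AddCommMonoid M] (f : ℤ → M) (n : ℕ) :
    ∑ k ∈ Icc (1 : ℤ) n, f k = ∑ i ∈ range n, f (i + 1) := by
  symm
  refine sum_bij (fun i _ => (i : ℤ) + 1) ?_ ?_ ?_ ?_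
  · intro i hi; rw [mem_range] at hi; rw [mem_Icc]; omega
  · intro i _ j _ h; omega
  · intro k hk
    rw [mem_Icc] at hk
    exact ⟨(k - 1).toNat, by rw [mem_range]; omega, by omega⟩
  · intro i _; rfl

theorem norm_sub_exp_le (H : ExpandedRecursion z B a c b ν₁ ν₂ ν₃ mix e₂₂ m₃) (n : ℕ) :
    ‖a n - Complex.exp ((∑ k ∈ Icc (1 : ℤ) n, ν₁ k : ℝ) * z
        + (∑ k ∈ Icc (1 : ℤ) n, secondCoeff ν₁ ν₂ mix k : ℝ) * z ^ 2)‖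
      ≤ 2 * localConst B * (∑ k ∈ Icc (1 : ℤ) n, localError ν₁ ν₂ ν₃ mix e₂₂ m₃ k) * ‖z‖ ^ 3
        * Real.exp ((∑ k ∈ Icc (1 : ℤ) n, ν₁ k) * z.re
          + ‖z‖ ^ 2 * ∑ k ∈ Icc (1 : ℤ) n, majorantCoeff ν₁ ν₂ mix k) := by
  have hre : -2.01 ≤ z.re := by
    linarith [(abs_le.1 (Complex.abs_re_le_norm z)).1, H.z_le]
  have hmaj : ∀ k, 0 ≤ majorantCoeff ν₁ ν₂ mix k := by
    intro k
    have h1 := H.ν₁_nonneg k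
    have h2 := H.ν₂_nonneg k
    have h3 := H.mix_nonneg k
    unfold majorantCoeff
    positivity
  have key := norm_prod_sub_prod_le (M := 2)
    (φ := fun i : ℕ => a ((i : ℤ) + 1) / a ((i : ℤ) + 1 - 1))
    (g := fun i : ℕ => Complex.exp (ν₁ ((i : ℤ) + 1) * z
      + secondCoeff ν₁ ν₂ mix ((i : ℤ) + 1) * z ^ 2))
    (fun i => H.norm_ratio_le _) (fun i => H.norm_exp_le _)
    (fun i => by
      have h1 := H.ν₁_nonneg ((i : ℤ) + 1)
      have h2 := H.ν₁_le ((i : ℤ) + 1)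
      have h3 := mul_nonneg (sq_nonneg ‖z‖) (hmaj ((i : ℤ) + 1))
      -- As `z.re ≥ -2.01` and `ν₁ ≤ 1 / 100`, no single exponent is below `-0.03`, so `M = 2` is
      -- ample.
      have h4 : -(ν₁ ((i : ℤ) + 1) * z.re + ‖z‖ ^ 2 * majorantCoeff ν₁ ν₂ mix ((i : ℤ) + 1))
          ≤ 0.03 := by nlinarith
      refine (Real.exp_le_exp.2 h4).trans ?_
      have := Real.exp_bound_div_one_sub_of_interval (x := 0.03) (by norm_num) (by norm_num)
      exact this.trans (by norm_num))
    (fun i => H.norm_ratio_sub_exp_le _) n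
  -- The product of ratios telescopes down to `a 0 = 1`.
  have hprod : ∀ m : ℕ, ∏ i ∈ range m, a ((i : ℤ) + 1) / a ((i : ℤ) + 1 - 1) = a m := by
    intro m
    induction m with
    | zero => simp [H.init]
    | succ m ih =>
      have := H.ne_zero m
      rw [prod_range_succ, ih, add_sub_cancel_right]
      push_cast
      field_simp
  rw [hprod, ← Complex.exp_sum, ← mul_sum] at key
  simp only [sum_Icc_int_eq]
  convert! key using 1
  · congr 2
    push_cast
    rw [sum_add_distrib, sum_mul, sum_mul]
  · simp only [sum_add_distrib, ← sum_mul, ← mul_sum]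
    ring

end ExpandedRecursion

end LocalExpansion

set_option linter.unusedSectionVars false

/-! ### A class of functions for which integrability is automatic. -/

section BoundedMeasurable

variable {Ω : Type*} [MeasurableSpace Ω]

/-- Bounded measurable functions. -/
def BddMeas {E : Type*} [NormedAddCommGroup E] [MeasurableSpace E] (f : Ω → E) : Prop :=
  Measurable f ∧ ∃ C : ℝ, ∀ ω, ‖f ω‖ ≤ C

namespace BddMeas

variable {𝕜 : Type*} [RCLike 𝕜] {f g : Ω → 𝕜}

theorem const (c : 𝕜) : BddMeas fun _ : Ω => c := ⟨measurable_const, ‖c‖, fun _ => le_rfl⟩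

theorem add (hf : BddMeas f) (hg : BddMeas g) : BddMeas fun ω => f ω + g ω := by
  obtain ⟨mf, C, hC⟩ := hf
  obtain ⟨mg, D, hD⟩ := hg
  exact ⟨mf.add mg, C + D, fun ω => norm_add_le_of_le (hC ω) (hD ω)⟩

theorem mul (hf : BddMeas f) (hg : BddMeas g) : BddMeas fun ω => f ω * g ω := by
  obtain ⟨mf, C, hC⟩ := hf
  obtain ⟨mg, D, hD⟩ := hg
  refine ⟨mf.mul mg, C * D, fun ω => ?_⟩
  rw [norm_mul]
  exact mul_le_mul (hC ω) (hD ω) (norm_nonneg _) ((norm_nonneg _).trans (hC ω))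

theorem norm (hf : BddMeas f) : BddMeas fun ω => ‖f ω‖ :=
  ⟨hf.1.norm, hf.2.imp fun C hC ω => by rw [norm_norm]; exact hC ω⟩

theorem prod {ι : Type*} {s : Finset ι} {F : ι → Ω → 𝕜} (h : ∀ i ∈ s, BddMeas (F i)) :
    BddMeas fun ω => ∏ i ∈ s, F i ω := by
  classical
  induction s using Finset.induction_on with
  | empty => simpa using const 1
  | insert i s hi ih =>
    simp_rw [Finset.prod_insert hi]
    exact (h i (Finset.mem_insert_self _ _)).mul
      (ih fun j hj => h j (Finset.mem_insert_of_mem hj))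

theorem of_nat {Y : Ω → ℕ} {B : ℕ} (hY : Measurable Y) (hB : ∀ ω, Y ω ≤ B) (φ : ℕ → 𝕜) :
    BddMeas fun ω => φ (Y ω) := by
  refine ⟨(measurable_from_top (f := φ)).comp hY, ∑ i ∈ Finset.range (B + 1), ‖φ i‖, fun ω => ?_⟩
  exact Finset.single_le_sum (f := fun i => ‖φ i‖) (fun i _ => norm_nonneg _)
    (Finset.mem_range.2 (Nat.lt_succ_of_le (hB ω)))

theorem integrable (hf : BddMeas f) (P : Measure Ω) [IsProbabilityMeasure P] : Integrable f P := by
  obtain ⟨mf, C, hC⟩ := hf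
  exact Integrable.of_bound mf.aestronglyMeasurable C (Filter.Eventually.of_forall hC)

theorem memLp (hf : BddMeas f) (P : Measure Ω) [IsProbabilityMeasure P] : MemLp f 2 P := by
  obtain ⟨mf, C, hC⟩ := hf
  exact MemLp.of_bound mf.aestronglyMeasurable C (Filter.Eventually.of_forall hC)

end BddMeas

end BoundedMeasurable

/-! ### The recursion for the generating functions of one-dependent partial sums. -/

section OneDependent

open Finset

variable {Ω : Type*} [mΩ : MeasurableSpace Ω]

/-- A one-dependent sequence of uniformly bounded random variables, vanishing outside `[1, n]`. -/
structure BoundedOneDependent (P : Measure Ω) (X : ℤ → Ω → ℕ) (n B : ℕ) : Prop where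
  measurable : ∀ k, Measurable (X k)
  le : ∀ k ω, X k ω ≤ B
  zero : ∀ k, k ≤ 0 ∨ (n : ℤ) < k → X k = 0
  dep : IsMDependent 1 P X n

/-- The σ-algebra generated by the variables with index in `s`. -/
@[reducible]
def sigmaAlg (X : ℤ → Ω → ℕ) (s : Set ℤ) : MeasurableSpace Ω :=
  ⨆ i ∈ s, MeasurableSpace.comap (X i) inferInstance

theorem measurable_sigmaAlg {X : ℤ → Ω → ℕ} {s : Set ℤ} {i : ℤ} (hi : i ∈ s) :
    Measurable[sigmaAlg X s] (X i) :=
  Measurable.mono (comap_measurable (X i))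
    (le_iSup₂_of_le (f := fun i (_ : i ∈ s) => MeasurableSpace.comap (X i) inferInstance) i hi le_rfl)
    le_rfl

/-- The partial sums, indexed by integers. -/
noncomputable def partialSum (X : ℤ → Ω → ℕ) (k : ℤ) (ω : Ω) : ℕ := ∑ i ∈ Icc (1 : ℤ) k, X i ω

namespace BoundedOneDependent

variable {P : Measure Ω} [IsProbabilityMeasure P] {X : ℤ → Ω → ℕ} {n B : ℕ}

theorem sigmaAlg_le (H : BoundedOneDependent P X n B) (s : Set ℤ) : sigmaAlg X s ≤ mΩ :=
  iSup₂_le fun i _ => (H.measurable i).comap_le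

/-- Half-lines may replace the finite blocks of the definition because the variables outside `[1,
n]` are constant and generate the trivial σ-algebra. -/
theorem indep (H : BoundedOneDependent P X n B) {s t : ℤ} (hst : s + 2 ≤ t) :
    Indep (sigmaAlg X (Set.Iic s)) (sigmaAlg X (Set.Ici t)) P := by
  have hbot : ∀ i, X i = 0 → MeasurableSpace.comap (X i) inferInstance = ⊥ := by
    intro i hi
    rw [hi]
    exact MeasurableSpace.comap_const (0 : ℕ)
  have h1 : sigmaAlg X (Set.Iic s) ≤ sigmaAlg X (Set.Icc 1 s) := by
    refine iSup₂_le fun i hi => ?_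
    rcases le_or_gt i 0 with h | h
    · rw [hbot i (H.zero i (Or.inl h))]; exact bot_le
    · exact le_iSup₂_of_le (f := fun i (_ : i ∈ Set.Icc 1 s) =>
        MeasurableSpace.comap (X i) inferInstance) i ⟨h, hi⟩ le_rfl
  have h2 : sigmaAlg X (Set.Ici t) ≤ sigmaAlg X (Set.Icc t n) := by
    refine iSup₂_le fun i hi => ?_
    rcases lt_or_ge (n : ℤ) i with h | h
    · rw [hbot i (H.zero i (Or.inr h))]; exact bot_le
    · exact le_iSup₂_of_le (f := fun i (_ : i ∈ Set.Icc t (n : ℤ)) =>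
        MeasurableSpace.comap (X i) inferInstance) i ⟨hi, h⟩ le_rfl
  refine indep_of_indep_of_le_left (indep_of_indep_of_le_right ?_ h2) h1
  by_cases hs : 1 ≤ s
  · by_cases ht : t ≤ n
    · exact H.dep s t hs (by push_cast; omega) ht
    · have : sigmaAlg X (Set.Icc t n) = ⊥ := by
        rw [Set.Icc_eq_empty ht]; simp [sigmaAlg]
      rw [this]
      exact indep_bot_right _
  · have : sigmaAlg X (Set.Icc 1 s) = ⊥ := by
      rw [Set.Icc_eq_empty hs]; simp [sigmaAlg]
    rw [this]
    exact indep_bot_left _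

theorem indepFun (H : BoundedOneDependent P X n B) {s t : ℤ} (hst : s + 2 ≤ t)
    {E : Type*} [MeasurableSpace E] {f g : Ω → E}
    (hf : Measurable[sigmaAlg X (Set.Iic s)] f) (hg : Measurable[sigmaAlg X (Set.Ici t)] g) :
    IndepFun f g P := by
  rw [IndepFun_iff_Indep]
  exact indep_of_indep_of_le_left (indep_of_indep_of_le_right (H.indep hst) hg.comap_le) hf.comap_le

theorem integral_mul (H : BoundedOneDependent P X n B) {s t : ℤ} (hst : s + 2 ≤ t)
    {𝕜 : Type*} [RCLike 𝕜] {f g : Ω → 𝕜}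
    (hf : Measurable[sigmaAlg X (Set.Iic s)] f) (hg : Measurable[sigmaAlg X (Set.Ici t)] g) :
    ∫ ω, f ω * g ω ∂P = (∫ ω, f ω ∂P) * ∫ ω, g ω ∂P :=
  (H.indepFun hst hf hg).integral_fun_mul_eq_mul_integral
    (hf.mono (H.sigmaAlg_le _) le_rfl).aestronglyMeasurable
    (hg.mono (H.sigmaAlg_le _) le_rfl).aestronglyMeasurable

theorem measurable_past {s k : ℤ} (hk : k ≤ s) {E : Type*} [MeasurableSpace E] (φ : ℕ → E) :
    Measurable[sigmaAlg X (Set.Iic s)] fun ω => φ (X k ω) :=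
  (measurable_from_top (f := φ)).comp (measurable_sigmaAlg hk)

theorem measurable_future {t k : ℤ} (hk : t ≤ k) {E : Type*} [MeasurableSpace E] (φ : ℕ → E) :
    Measurable[sigmaAlg X (Set.Ici t)] fun ω => φ (X k ω) :=
  (measurable_from_top (f := φ)).comp (measurable_sigmaAlg hk)

theorem bdd (H : BoundedOneDependent P X n B) (k : ℤ) {𝕜 : Type*} [RCLike 𝕜] (φ : ℕ → 𝕜) :
    BddMeas fun ω => φ (X k ω) := BddMeas.of_nat (H.measurable k) (H.le k) φ

theorem partialSum_eq (H : BoundedOneDependent P X n B) (k : ℤ) (ω : Ω) :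
    partialSum X k ω = partialSum X (k - 1) ω + X k ω := by
  unfold partialSum
  rcases le_or_gt k 0 with h | h
  · rw [H.zero k (Or.inl h), Icc_eq_empty (by omega), Icc_eq_empty (by omega)]; simp
  · have : Icc (1 : ℤ) k = insert k (Icc 1 (k - 1)) := by
      ext i; simp only [mem_Icc, mem_insert]; omega
    rw [this, sum_insert (by simp), add_comm]

theorem measurable_partialSum {s k : ℤ} (hk : k ≤ s) :
    Measurable[sigmaAlg X (Set.Iic s)] (partialSum X k) := by
  unfold partialSum
  refine Finset.measurable_fun_sum _ fun i hi => measurable_sigmaAlg ?_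
  rw [mem_Icc] at hi
  exact hi.2.trans hk

theorem bdd_partialSum (H : BoundedOneDependent P X n B) (k : ℤ) {𝕜 : Type*} [RCLike 𝕜]
    (φ : ℕ → 𝕜) : BddMeas fun ω => φ (partialSum X k ω) := by
  refine BddMeas.of_nat (B := (Icc (1 : ℤ) k).card * B)
    ((measurable_partialSum le_rfl).mono (H.sigmaAlg_le _) le_rfl) (fun ω => ?_) φ
  exact (sum_le_card_nsmul _ _ _ fun i _ => H.le i ω).trans (by simp)

end BoundedOneDependent

/-- `w ^ X k - 1`. -/
def powSub (w : ℂ) (X : ℤ → Ω → ℕ) (k : ℤ) (ω : Ω) : ℂ := w ^ X k ω - 1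

/-- The product of `w ^ X i - 1` over `k - j ≤ i ≤ k`. -/
def powSubProd (w : ℂ) (X : ℤ → Ω → ℕ) (k : ℤ) (j : ℕ) (ω : Ω) : ℂ :=
  ∏ i ∈ range (j + 1), powSub w X (k - i) ω

theorem powSubProd_zero (w : ℂ) (X : ℤ → Ω → ℕ) (k : ℤ) (ω : Ω) :
    powSubProd w X k 0 ω = powSub w X k ω := by simp [powSubProd]

theorem powSubProd_succ (w : ℂ) (X : ℤ → Ω → ℕ) (k : ℤ) (j : ℕ) (ω : Ω) :
    powSubProd w X k (j + 1) ω = powSubProd w X k j ω * powSub w X (k - (j + 1)) ω := by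
  simp [powSubProd, prod_range_succ]

namespace BoundedOneDependent

variable {P : Measure Ω} [IsProbabilityMeasure P] {X : ℤ → Ω → ℕ} {n B : ℕ}

theorem measurable_powSubProd_future (w : ℂ) {t k : ℤ} {j : ℕ} (hk : t ≤ k - j) :
    Measurable[sigmaAlg X (Set.Ici t)] (powSubProd w X k j) := by
  unfold powSubProd
  refine Finset.measurable_fun_prod _ fun i hi => measurable_future ?_ fun m => w ^ m - 1
  rw [mem_range] at hi
  omega

theorem bdd_powSub (H : BoundedOneDependent P X n B) (w : ℂ) (k : ℤ) : BddMeas (powSub w X k) :=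
  H.bdd k fun m => w ^ m - 1

theorem bdd_powSubProd (H : BoundedOneDependent P X n B) (w : ℂ) (k : ℤ) (j : ℕ) :
    BddMeas (powSubProd w X k j) :=
  BddMeas.prod fun i _ => H.bdd_powSub w (k - i)

/-- At each stage `w ^ X (k-m-1)` is split as `1 + (w ^ X (k-m-1) - 1)`. In the first part the index
`k-m-1` is absent, so the past up to `k-m-2` is independent of the product starting at `k-m` and the
integral factorizes. The second part lengthens the product by one factor. -/
theorem integral_pow_mul_expansion (H : BoundedOneDependent P X n B) (w : ℂ) (k : ℤ) (m : ℕ) :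
    ∫ ω, w ^ partialSum X (k - 1) ω * powSub w X k ω ∂P =
      ∑ j ∈ range m, (∫ ω, w ^ partialSum X (k - j - 2) ω ∂P) * (∫ ω, powSubProd w X k j ω ∂P)
      + ∫ ω, w ^ partialSum X (k - m - 1) ω * powSubProd w X k m ω ∂P := by
  induction m with
  | zero => simp [powSubProd_zero]
  | succ m ih =>
    rw [ih, sum_range_succ, add_assoc]
    congr 1
    have h1 : ∀ ω, w ^ partialSum X (k - m - 1) ω * powSubProd w X k m ω =
        w ^ partialSum X (k - m - 2) ω * powSubProd w X k m ω
        + w ^ partialSum X (k - (m + 1 : ℕ) - 1) ω * powSubProd w X k (m + 1) ω := by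
      intro ω
      have e1 : k - (m + 1 : ℕ) - 1 = k - m - 2 := by push_cast; ring
      have e2 : k - m - 1 - 1 = k - m - 2 := by ring
      have e3 : k - ((m : ℤ) + 1) = k - m - 1 := by ring
      rw [H.partialSum_eq (k - m - 1), e1, e2, powSubProd_succ, powSub, e3, pow_add]
      ring
    simp_rw [h1]
    rw [integral_add (((H.bdd_partialSum _ fun i => w ^ i).mul (H.bdd_powSubProd w k m)).integrable P)
      (((H.bdd_partialSum _ fun i => w ^ i).mul (H.bdd_powSubProd w k (m + 1))).integrable P),
      H.integral_mul (f := fun ω => w ^ partialSum X (k - m - 2) ω) (s := k - m - 2) (t := k - m)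
        (by omega)
        ((measurable_from_top (f := fun i : ℕ => w ^ i)).comp (measurable_partialSum le_rfl))
        (measurable_powSubProd_future w le_rfl)]

theorem integral_pow_partialSum (H : BoundedOneDependent P X n B) (w : ℂ) (k : ℤ) (N : ℕ)
    (hN : k ≤ N) :
    ∫ ω, w ^ partialSum X k ω ∂P = ∫ ω, w ^ partialSum X (k - 1) ω ∂P +
      ∑ j ∈ range N, (∫ ω, w ^ partialSum X (k - j - 2) ω ∂P) * (∫ ω, powSubProd w X k j ω ∂P) := by
  have h1 : ∀ ω, w ^ partialSum X k ω =
      w ^ partialSum X (k - 1) ω + w ^ partialSum X (k - 1) ω * powSub w X k ω := by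
    intro ω
    rw [H.partialSum_eq k, powSub, pow_add]; ring
  simp_rw [h1]
  rw [integral_add ((H.bdd_partialSum _ fun i => w ^ i).integrable P)
    (((H.bdd_partialSum _ fun i => w ^ i).mul (H.bdd_powSub w k)).integrable P),
    H.integral_pow_mul_expansion w k N]
  -- For `N ≥ k` the product reaches an index `k - N ≤ 0`, where the variable vanishes; no remainder
  -- is left.
  have h2 : ∀ ω, powSubProd w X k N ω = 0 := by
    intro ω
    refine prod_eq_zero (i := N) (by simp) ?_
    rw [powSub, H.zero (k - N) (Or.inl (by omega))]
    simp
  simp [h2]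

end BoundedOneDependent

end OneDependent

/-! ### Expansion of the recursion coefficients in moments. -/

section MomentExpansion

open Finset

variable {Ω : Type*} [mΩ : MeasurableSpace Ω]

/-- `E X_{k-1}(X_{k-1} - 1) X_k + E X_{k-1} X_k (X_k - 1)`. -/
noncomputable def mixed22 (P : Measure Ω) (X : ℤ → Ω → ℕ) (k : ℤ) : ℝ :=
  (∫ ω, (X (k - 1) ω : ℝ) * ((X (k - 1) ω : ℝ) - 1) * (X k ω : ℝ) ∂P)
    + ∫ ω, (X (k - 1) ω : ℝ) * ((X k ω : ℝ) * ((X k ω : ℝ) - 1)) ∂P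

/-- `E X_{k-2} X_{k-1} X_k`. -/
noncomputable def mixed3 (P : Measure Ω) (X : ℤ → Ω → ℕ) (k : ℤ) : ℝ :=
  ∫ ω, (X (k - 2) ω : ℝ) * (X (k - 1) ω : ℝ) * (X k ω : ℝ) ∂P

theorem natCast_mul_sub_one_nonneg (m : ℕ) : 0 ≤ (m : ℝ) * ((m : ℝ) - 1) := by
  rw [← Nat.cast_descFactorial_two]; positivity

theorem nu_one (P : Measure Ω) (X : ℤ → Ω → ℕ) (k : ℤ) : nu P X 1 k = ∫ ω, (X k ω : ℝ) ∂P := by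
  simp [nu]

theorem nu_two (P : Measure Ω) (X : ℤ → Ω → ℕ) (k : ℤ) :
    nu P X 2 k = ∫ ω, (X k ω : ℝ) * ((X k ω : ℝ) - 1) ∂P := by
  simp only [nu, Nat.cast_descFactorial_two]

theorem nu_nonneg (P : Measure Ω) (X : ℤ → Ω → ℕ) (j : ℕ) (k : ℤ) : 0 ≤ nu P X j k :=
  integral_nonneg fun _ => by positivity

theorem mixed_nonneg (P : Measure Ω) (X : ℤ → Ω → ℕ) (k : ℤ) : 0 ≤ mixed P X k :=
  integral_nonneg fun ω => by positivity

theorem mixed22_nonneg (P : Measure Ω) (X : ℤ → Ω → ℕ) (k : ℤ) : 0 ≤ mixed22 P X k :=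
  add_nonneg
    (integral_nonneg fun _ => mul_nonneg (natCast_mul_sub_one_nonneg _) (Nat.cast_nonneg _))
    (integral_nonneg fun _ => mul_nonneg (Nat.cast_nonneg _) (natCast_mul_sub_one_nonneg _))

theorem mixed3_nonneg (P : Measure Ω) (X : ℤ → Ω → ℕ) (k : ℤ) : 0 ≤ mixed3 P X k :=
  integral_nonneg fun ω => by positivity

theorem norm_integral_sub_le_integral {P : Measure Ω} [IsProbabilityMeasure P] {f g : Ω → ℂ}
    {u : Ω → ℝ} (hf : BddMeas f) (hg : BddMeas g) (hu : BddMeas u)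
    (h : ∀ ω, ‖f ω - g ω‖ ≤ u ω) :
    ‖∫ ω, f ω ∂P - ∫ ω, g ω ∂P‖ ≤ ∫ ω, u ω ∂P := by
  rw [← integral_sub (hf.integrable P) (hg.integrable P)]
  exact norm_integral_le_of_norm_le (hu.integrable P) (Filter.Eventually.of_forall h)

namespace BoundedOneDependent

variable {P : Measure Ω} [IsProbabilityMeasure P] {X : ℤ → Ω → ℕ} {n B : ℕ} {w : ℂ}

theorem bdd_cast (H : BoundedOneDependent P X n B) (k : ℤ) :
    BddMeas fun ω => (X k ω : ℝ) := H.bdd k fun m => (m : ℝ)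

theorem bdd_cast_mul (H : BoundedOneDependent P X n B) (k : ℤ) :
    BddMeas fun ω => (X k ω : ℝ) * ((X k ω : ℝ) - 1) := H.bdd k fun m => (m : ℝ) * ((m : ℝ) - 1)

theorem norm_powSub_le (H : BoundedOneDependent P X n B) (hK : ∀ j ≤ B, ‖w‖ ^ j ≤ 1.01)
    (k : ℤ) (ω : Ω) : ‖powSub w X k ω‖ ≤ 1.01 * ‖w - 1‖ * X k ω :=
  norm_pow_sub_one_le hK (H.le k ω)

theorem norm_powSub_le_const (H : BoundedOneDependent P X n B) (hK : ∀ j ≤ B, ‖w‖ ^ j ≤ 1.01)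
    (k : ℤ) (ω : Ω) : ‖powSub w X k ω‖ ≤ 2.01 := by
  have h1 := hK _ (H.le k ω)
  have h2 := norm_sub_le (w ^ X k ω) 1
  rw [norm_pow, norm_one] at h2
  unfold powSub
  linarith

theorem norm_powSub_sub_le (H : BoundedOneDependent P X n B) (hK : ∀ j ≤ B, ‖w‖ ^ j ≤ 1.01)
    (k : ℤ) (ω : Ω) : ‖powSub w X k ω - (X k ω : ℝ) * (w - 1)‖
      ≤ 0.505 * ‖w - 1‖ ^ 2 * ((X k ω : ℝ) * ((X k ω : ℝ) - 1)) := by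
  have := norm_pow_sub_one_sub_le hK (H.le k ω)
  rw [Nat.cast_descFactorial_two] at this
  rw [Complex.ofReal_natCast]
  refine this.trans (le_of_eq ?_)
  ring

theorem integral_norm_powSub_le (H : BoundedOneDependent P X n B)
    (hK : ∀ j ≤ B, ‖w‖ ^ j ≤ 1.01) (k : ℤ) :
    ∫ ω, ‖powSub w X k ω‖ ∂P ≤ 1.01 * ‖w - 1‖ * nu P X 1 k := by
  rw [nu_one, ← integral_const_mul]
  exact integral_mono ((H.bdd_powSub w k).norm.integrable P)
    (((BddMeas.const _).mul (H.bdd_cast k)).integrable P) fun ω => H.norm_powSub_le hK k ω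

theorem integral_norm_powSubProd_succ_le (H : BoundedOneDependent P X n B)
    (hK : ∀ j ≤ B, ‖w‖ ^ j ≤ 1.01) (k : ℤ) (j : ℕ) :
    ∫ ω, ‖powSubProd w X k (j + 1) ω‖ ∂P ≤ 2.01 * ∫ ω, ‖powSubProd w X k j ω‖ ∂P := by
  rw [← integral_const_mul]
  refine integral_mono ((H.bdd_powSubProd w k (j + 1)).norm.integrable P)
    (((BddMeas.const _).mul (H.bdd_powSubProd w k j).norm).integrable P) fun ω => ?_
  simp only [powSubProd_succ, norm_mul]
  rw [mul_comm]
  exact mul_le_mul_of_nonneg_right (H.norm_powSub_le_const hK _ ω) (norm_nonneg _)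

/-- The factor adjacent to the shorter product is dropped at the cost `2.01`. The one beyond it is
separated by a gap and therefore independent, which yields a small factor for every two steps. -/
theorem integral_norm_powSubProd_two_step_le (H : BoundedOneDependent P X n B)
    (hK : ∀ j ≤ B, ‖w‖ ^ j ≤ 1.01) (k : ℤ) (j : ℕ) :
    ∫ ω, ‖powSubProd w X k (j + 2) ω‖ ∂P ≤
      2.01 * ((∫ ω, ‖powSub w X (k - j - 2) ω‖ ∂P) * ∫ ω, ‖powSubProd w X k j ω‖ ∂P) := by
  have h1 := H.integral_mul (s := k - j - 2) (t := k - j) (by omega)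
    (f := fun ω => ‖powSub w X (k - j - 2) ω‖) (g := fun ω => ‖powSubProd w X k j ω‖)
    (measurable_past (k := k - j - 2) le_rfl fun m => ‖w ^ m - 1‖)
    (measurable_norm.comp (measurable_powSubProd_future w le_rfl))
  rw [← h1, ← integral_const_mul]
  refine integral_mono ((H.bdd_powSubProd w k (j + 2)).norm.integrable P)
    (((BddMeas.const _).mul ((H.bdd_powSub w _).norm.mul
      (H.bdd_powSubProd w k j).norm)).integrable P) fun ω => ?_
  have e : k - (((j + 1 : ℕ) : ℤ) + 1) = k - j - 2 := by push_cast; ring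
  simp only [powSubProd_succ, norm_mul]
  rw [e]
  have h2 := mul_le_mul_of_nonneg_right (H.norm_powSub_le_const hK (k - (j + 1)) ω)
    (mul_nonneg (norm_nonneg (powSub w X (k - j - 2) ω)) (norm_nonneg (powSubProd w X k j ω)))
  linarith

theorem expandedRecursion (H : BoundedOneDependent P X n B) (hK : ∀ j ≤ B, ‖w‖ ^ j ≤ 1.01)
    (hz : ‖w - 1‖ ≤ 2.01) (h1 : ∀ k, nu P X 1 k ≤ 1 / 100) (h2 : ∀ k, nu P X 2 k ≤ nu P X 1 k) :
    ExpandedRecursion (w - 1) B (fun k => ∫ ω, w ^ partialSum X k ω ∂P)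
      (fun k j => ∫ ω, powSubProd w X k j ω ∂P) (fun k j => ∫ ω, ‖powSubProd w X k j ω‖ ∂P)
      (nu P X 1) (nu P X 2) (nu P X 3) (mixed P X) (mixed22 P X) (mixed3 P X) := by
  have hzn := norm_nonneg (w - 1)
  have hb0 : ∀ k, ∫ ω, ‖powSub w X k ω‖ ∂P ≤ 1.01 * ‖w - 1‖ * nu P X 1 k :=
    H.integral_norm_powSub_le hK
  -- Here `1.01 * 2.01 / 100 < 0.0205`, and this in turn gives the two-step rate `2.01 * 0.0205 <
  -- 0.042`.
  have hb0' : ∀ k, ∫ ω, ‖powSub w X k ω‖ ∂P ≤ 0.0205 := by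
    intro k
    have h3 := h1 k
    have h4 := nu_nonneg P X 1 k
    refine (hb0 k).trans ?_
    nlinarith
  have hpos : ∀ k j, 0 ≤ ∫ ω, ‖powSubProd w X k j ω‖ ∂P := fun k j =>
    integral_nonneg fun ω => norm_nonneg _
  refine
    { init := ?_, step := fun k N hN => H.integral_pow_partialSum w k N hN,
      norm_le := fun k j => norm_integral_le_integral_norm _, zero_le := ?_, one_le := ?_,
      succ_le := ?_, two_step := ?_, z_le := hz, B_nonneg := Nat.cast_nonneg _,
      ν₁_nonneg := nu_nonneg P X 1, ν₂_nonneg := nu_nonneg P X 2, ν₃_nonneg := nu_nonneg P X 3,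
      mix_nonneg := mixed_nonneg P X, e₂₂_nonneg := mixed22_nonneg P X,
      m₃_nonneg := mixed3_nonneg P X, ν₁_le := h1, ν₂_le := h2, mix_le := ?_, b_zero := ?_,
      c_zero := ?_, c_zero' := ?_, b_one := ?_, c_one := ?_, b_two := ?_, b_two' := ?_ }
  · intro k hk
    simp [partialSum, Icc_eq_empty (show ¬ (1 : ℤ) ≤ k by omega)]
  · intro k
    simpa only [powSubProd_zero] using hb0' k
  · intro k
    have := H.integral_norm_powSubProd_succ_le hK k 0
    have := hpos k 0
    simp only [zero_add] at *
    linarith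
  · intro k j
    have := H.integral_norm_powSubProd_succ_le hK k j
    linarith [hpos k j]
  · intro k j
    have h3 := H.integral_norm_powSubProd_two_step_le hK k j
    have h4 := mul_le_mul_of_nonneg_right (hb0' (k - j - 2)) (hpos k j)
    linarith [hpos k j]
  · intro k
    rw [nu_one, mixed, ← integral_const_mul]
    refine integral_mono (((H.bdd_cast _).mul (H.bdd_cast _)).integrable P)
      (((BddMeas.const _).mul (H.bdd_cast _)).integrable P) fun ω => ?_
    exact mul_le_mul_of_nonneg_right (Nat.cast_le.2 (H.le _ ω)) (Nat.cast_nonneg _)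
  · intro k
    simpa only [powSubProd_zero] using hb0 k
  · intro k
    have e : (nu P X 1 k : ℂ) * (w - 1) = ∫ ω, ((X k ω : ℝ) : ℂ) * (w - 1) ∂P := by
      rw [integral_mul_const, integral_complex_ofReal, nu_one]
    rw [e, nu_two, ← integral_const_mul]
    simp only [powSubProd_zero]
    exact norm_integral_sub_le_integral (H.bdd_powSub w k)
      ((H.bdd k fun m => ((m : ℝ) : ℂ)).mul (BddMeas.const _))
      ((BddMeas.const _).mul (H.bdd_cast_mul k)) fun ω => H.norm_powSub_sub_le hK k ω
  · intro k
    have e : (nu P X 1 k : ℂ) * (w - 1) + (nu P X 2 k : ℂ) / 2 * (w - 1) ^ 2 =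
        ∫ ω, (((X k ω : ℝ) : ℂ) * (w - 1)
          + (((X k ω).descFactorial 2 : ℝ) : ℂ) * (1 / 2 * (w - 1) ^ 2)) ∂P := by
      rw [integral_add (((H.bdd k fun m => ((m : ℝ) : ℂ)).mul (BddMeas.const _)).integrable P)
        (((H.bdd k fun m => ((m.descFactorial 2 : ℝ) : ℂ)).mul (BddMeas.const _)).integrable P),
        integral_mul_const, integral_mul_const, integral_complex_ofReal, integral_complex_ofReal, nu_one, nu]
      ring
    have e3 : 0.17 * ‖w - 1‖ ^ 3 * nu P X 3 k
        = ∫ ω, 0.17 * ‖w - 1‖ ^ 3 * ((X k ω).descFactorial 3 : ℝ) ∂P := by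
      rw [integral_const_mul, nu]
    rw [sub_sub, e, e3]
    simp only [powSubProd_zero]
    refine norm_integral_sub_le_integral (H.bdd_powSub w k)
      (((H.bdd k fun m => ((m : ℝ) : ℂ)).mul (BddMeas.const _)).add
        ((H.bdd k fun m => ((m.descFactorial 2 : ℝ) : ℂ)).mul (BddMeas.const _)))
      ((BddMeas.const _).mul (H.bdd k fun m => (m.descFactorial 3 : ℝ))) fun ω => ?_
    have := norm_pow_sub_one_sub_sub_le hK (H.le k ω)
    have e4 : powSub w X k ω - (((X k ω : ℝ) : ℂ) * (w - 1)
          + (((X k ω).descFactorial 2 : ℝ) : ℂ) * (1 / 2 * (w - 1) ^ 2)) =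
        w ^ X k ω - 1 - X k ω * (w - 1) - ((X k ω).descFactorial 2 : ℂ) / 2 * (w - 1) ^ 2 := by
      rw [powSub]; push_cast; ring
    rw [e4]
    refine this.trans ?_
    have h5 : 0 ≤ ‖w - 1‖ ^ 3 * ((X k ω).descFactorial 3 : ℝ) := by positivity
    linarith
  · intro k
    rw [mixed, ← integral_const_mul]
    refine integral_mono ((H.bdd_powSubProd w k 1).norm.integrable P)
      (((BddMeas.const _).mul ((H.bdd_cast _).mul (H.bdd_cast _))).integrable P) fun ω => ?_
    have h3 := mul_le_mul (H.norm_powSub_le hK k ω) (H.norm_powSub_le hK (k - 1) ω)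
      (norm_nonneg _) (by positivity)
    have e : powSubProd w X k 1 ω = powSub w X k ω * powSub w X (k - 1) ω := by
      have := powSubProd_succ w X k 0 ω
      simpa [powSubProd_zero] using this
    simp only [e, norm_mul]
    have h5 : 0 ≤ ‖w - 1‖ ^ 2 * ((X (k - 1) ω : ℝ) * (X k ω : ℝ)) := by positivity
    nlinarith
  · intro k
    have e : (mixed P X k : ℂ) * (w - 1) ^ 2 =
        ∫ ω, (((X (k - 1) ω : ℝ) : ℂ) * ((X k ω : ℝ) : ℂ)) * (w - 1) ^ 2 ∂P := by
      rw [integral_mul_const, mixed, ← integral_complex_ofReal]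
      simp
    rw [e, mixed22, ← integral_add (((H.bdd_cast_mul _).mul (H.bdd_cast _)).integrable P)
      (((H.bdd_cast _).mul (H.bdd_cast_mul _)).integrable P), ← integral_const_mul]
    refine norm_integral_sub_le_integral (H.bdd_powSubProd w k 1)
      (((H.bdd _ fun m => ((m : ℝ) : ℂ)).mul (H.bdd k fun m => ((m : ℝ) : ℂ))).mul
        (BddMeas.const _))
      ((BddMeas.const _).mul (((H.bdd_cast_mul _).mul (H.bdd_cast _)).add
        ((H.bdd_cast _).mul (H.bdd_cast_mul _)))) fun ω => ?_
    have e : powSubProd w X k 1 ω = powSub w X k ω * powSub w X (k - 1) ω := by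
      have := powSubProd_succ w X k 0 ω
      simpa [powSubProd_zero] using this
    -- Linearizing one factor at a time leaves a second order remainder in one variable times a
    -- first order factor in the other, hence the mixed moments collected in `mixed22`.
    have e5 : powSub w X k ω * powSub w X (k - 1) ω
        - (((X (k - 1) ω : ℝ) : ℂ) * ((X k ω : ℝ) : ℂ)) * (w - 1) ^ 2
        = (powSub w X k ω - (X k ω : ℝ) * (w - 1)) * powSub w X (k - 1) ω
          + (X k ω : ℝ) * (w - 1) * (powSub w X (k - 1) ω - (X (k - 1) ω : ℝ) * (w - 1)) := by
      ring
    rw [e, e5]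
    refine (norm_add_le _ _).trans ?_
    rw [norm_mul, norm_mul, norm_mul, Complex.norm_real, Real.norm_of_nonneg (Nat.cast_nonneg _)]
    have q1 := natCast_mul_sub_one_nonneg (X k ω)
    have q2 := natCast_mul_sub_one_nonneg (X (k - 1) ω)
    have h3 := mul_le_mul (H.norm_powSub_sub_le hK k ω) (H.norm_powSub_le hK (k - 1) ω)
      (norm_nonneg _) (mul_nonneg (by positivity) q1)
    have h4 := mul_le_mul_of_nonneg_left (H.norm_powSub_sub_le hK (k - 1) ω)
      (show 0 ≤ (X k ω : ℝ) * ‖w - 1‖ by positivity)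
    have h5 : 0 ≤ ‖w - 1‖ ^ 3 * ((X (k - 1) ω : ℝ) * ((X (k - 1) ω : ℝ) - 1) * (X k ω : ℝ)) :=
      mul_nonneg (by positivity) (mul_nonneg q2 (Nat.cast_nonneg _))
    have h6 : 0 ≤ ‖w - 1‖ ^ 3 * ((X (k - 1) ω : ℝ) * ((X k ω : ℝ) * ((X k ω : ℝ) - 1))) :=
      mul_nonneg (by positivity) (mul_nonneg (Nat.cast_nonneg _) q1)
    linarith
  · intro k
    have h3 := H.integral_norm_powSubProd_two_step_le hK k 0
    simp only [powSubProd_zero, zero_add, Nat.cast_zero, sub_zero] at h3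
    have h4 := mul_le_mul (hb0 (k - 2)) (hb0 k) (integral_nonneg fun ω => norm_nonneg _)
      (mul_nonneg (by positivity) (nu_nonneg P X 1 _))
    have h5 : 0 ≤ ‖w - 1‖ ^ 2 * (nu P X 1 k * nu P X 1 (k - 2)) :=
      mul_nonneg (by positivity) (mul_nonneg (nu_nonneg P X 1 _) (nu_nonneg P X 1 _))
    nlinarith
  · intro k
    rw [mixed3, ← integral_const_mul]
    refine integral_mono ((H.bdd_powSubProd w k 2).norm.integrable P)
      (((BddMeas.const _).mul (((H.bdd_cast _).mul (H.bdd_cast _)).mul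
        (H.bdd_cast _))).integrable P) fun ω => ?_
    have h3 := mul_le_mul (mul_le_mul (H.norm_powSub_le hK k ω) (H.norm_powSub_le hK (k - 1) ω)
      (norm_nonneg _) (by positivity)) (H.norm_powSub_le hK (k - 2) ω)
      (norm_nonneg _) (by positivity)
    have e : powSubProd w X k 2 ω
        = powSub w X k ω * powSub w X (k - 1) ω * powSub w X (k - 2) ω := by
      rw [powSubProd_succ, powSubProd_succ, powSubProd_zero]
      norm_num
    simp only [e, norm_mul]
    have h5 : 0 ≤ ‖w - 1‖ ^ 3 * ((X (k - 2) ω : ℝ) * (X (k - 1) ω : ℝ) * (X k ω : ℝ)) := by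
      positivity
    linarith

end BoundedOneDependent

end MomentExpansion

/-! ### Sums of the local quantities: `λ`, `Γ₂`, `R₀`, `R₁` and the main comparison with `G`. -/

section Sums

open Finset

variable {Ω : Type*} [mΩ : MeasurableSpace Ω]

theorem sum_Icc_shift_le {f : ℤ → ℝ} (hf : ∀ k, 0 ≤ f k) (h0 : ∀ k ≤ 0, f k = 0) (n j : ℕ) :
    ∑ k ∈ Icc (1 : ℤ) n, f (k - j) ≤ ∑ k ∈ Icc (1 : ℤ) n, f k := by
  have h1 : ∑ k ∈ Icc (1 : ℤ) n, f (k - j) = ∑ k ∈ Icc (1 - j : ℤ) (n - j), f k := by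
    refine sum_bij (fun k _ => k - j) ?_ ?_ ?_ ?_
    · intro k hk; rw [mem_Icc] at *; omega
    · intro k _ i _ h; omega
    · intro k hk; rw [mem_Icc] at hk; exact ⟨k + j, by rw [mem_Icc]; omega, by omega⟩
    · intro k _; rfl
  have h2 : ∑ k ∈ Icc (1 - j : ℤ) n, f k = ∑ k ∈ Icc (1 : ℤ) n, f k := by
    symm
    refine sum_subset (fun k hk => ?_) fun k hk hk' => ?_
    · rw [mem_Icc] at *; omega
    · rw [mem_Icc] at *; exact h0 k (by omega)
  rw [h1, ← h2]
  refine sum_le_sum_of_subset_of_nonneg (fun k hk => ?_) fun k _ _ => hf k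
  rw [mem_Icc] at *; omega

namespace BoundedOneDependent

variable {P : Measure Ω} [IsProbabilityMeasure P] {X : ℤ → Ω → ℕ} {n B : ℕ}

theorem sumS_eq (X : ℤ → Ω → ℕ) (n : ℕ) (ω : Ω) : sumS X n ω = partialSum X n ω := rfl

theorem lam_eq (H : BoundedOneDependent P X n B) :
    lam P X n = ∑ k ∈ Icc (1 : ℤ) n, nu P X 1 k := by
  simp only [nu_one, lam, sumS, Nat.cast_sum]
  exact integral_finsetSum _ fun k _ => (H.bdd_cast k).integrable P

theorem covariance_eq (H : BoundedOneDependent P X n B) (k : ℤ) :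
    covariance (fun ω => (X (k - 1) ω : ℝ)) (fun ω => (X k ω : ℝ)) P =
      mixed P X k - nu P X 1 (k - 1) * nu P X 1 k := by
  rw [covariance_eq_sub ((H.bdd_cast _).memLp P) ((H.bdd_cast _).memLp P), nu_one, nu_one, mixed]
  rfl

theorem variance_eq (H : BoundedOneDependent P X n B) (k : ℤ) :
    variance (fun ω => (X k ω : ℝ)) P = nu P X 2 k + nu P X 1 k - nu P X 1 k ^ 2 := by
  rw [variance_eq_sub ((H.bdd_cast _).memLp P), nu_two, nu_one,
    ← integral_add ((H.bdd_cast_mul k).integrable P) ((H.bdd_cast k).integrable P)]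
  congr 2
  funext ω
  simp only [Pi.pow_apply]
  ring

/-- Only neighbouring covariances survive, since `S_{m-1}` is independent of `X (m+1)`. The
covariance term at `k = 1` vanishes because `X 0 = 0`. -/
theorem variance_partialSum (H : BoundedOneDependent P X n B) (m : ℕ) :
    variance (fun ω => (partialSum X m ω : ℝ)) P =
      ∑ k ∈ Icc (1 : ℤ) m, (nu P X 2 k + nu P X 1 k - nu P X 1 k ^ 2
        + 2 * (mixed P X k - nu P X 1 (k - 1) * nu P X 1 k)) := by
  have hS : ∀ k, MemLp (fun ω => (partialSum X k ω : ℝ)) 2 P := fun k =>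
    (H.bdd_partialSum k fun i => (i : ℝ)).memLp P
  have hX : ∀ k, MemLp (fun ω => (X k ω : ℝ)) 2 P := fun k => (H.bdd_cast k).memLp P
  induction m with
  | zero =>
    have : (fun ω => (partialSum X ((0 : ℕ) : ℤ) ω : ℝ)) = 0 := by
      funext ω; simp [partialSum]
    rw [this, variance_zero]
    simp
  | succ m ih =>
    have e1 : (fun ω => (partialSum X ((m + 1 : ℕ) : ℤ) ω : ℝ)) =
        (fun ω => (partialSum X m ω : ℝ)) + fun ω => (X (m + 1 : ℤ) ω : ℝ) := by
      funext ω
      rw [H.partialSum_eq]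
      push_cast
      simp
    have e2 : (fun ω => (partialSum X m ω : ℝ)) =
        (fun ω => (partialSum X (m - 1 : ℤ) ω : ℝ)) + fun ω => (X m ω : ℝ) := by
      funext ω
      rw [H.partialSum_eq]
      push_cast
      simp
    have h1 : covariance (fun ω => (partialSum X m ω : ℝ)) (fun ω => (X (m + 1 : ℤ) ω : ℝ)) P =
        mixed P X (m + 1) - nu P X 1 m * nu P X 1 (m + 1) := by
      rw [e2, covariance_add_left (hS _) (hX _) (hX _),
        (H.indepFun (f := fun ω => (partialSum X (m - 1 : ℤ) ω : ℝ)) (s := m - 1) (t := m + 1) (by omega)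
          ((measurable_from_top (f := fun i : ℕ => (i : ℝ))).comp (measurable_partialSum le_rfl))
          (measurable_future le_rfl fun i => (i : ℝ))).covariance_eq_zero (hS _) (hX _), zero_add]
      have := H.covariance_eq (m + 1)
      rwa [add_sub_cancel_right] at this
    rw [e1, variance_add (hS _) (hX _), ih, h1, H.variance_eq, ExpandedRecursion.sum_Icc_int_eq, ExpandedRecursion.sum_Icc_int_eq,
      sum_range_succ, add_sub_cancel_right]
    ring

/-- This exact identity is what makes `G` match to second order: summing the `z ^ 2` coefficients of
the ratios leaves no error. -/
theorem Gam2_eq (H : BoundedOneDependent P X n B) :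
    Gam2 P X n = ∑ k ∈ Icc (1 : ℤ) n,
      ExpandedRecursion.secondCoeff (nu P X 1) (nu P X 2) (mixed P X) k := by
  have h1 := H.variance_partialSum n
  have h2 := H.lam_eq
  unfold Gam2
  simp only [sumS_eq]
  rw [h1, h2, ← sum_sub_distrib, sum_div]
  refine sum_congr rfl fun k _ => ?_
  unfold ExpandedRecursion.secondCoeff
  ring

theorem nu_of_nonpos (H : BoundedOneDependent P X n B) {j : ℕ} (hj : j ≠ 0) {k : ℤ} (hk : k ≤ 0) :
    nu P X j k = 0 := by
  simp [nu, H.zero k (Or.inl hk), Nat.descFactorial_eq_zero_iff_lt.2 (Nat.pos_of_ne_zero hj)]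

theorem mixed_of_nonpos (H : BoundedOneDependent P X n B) {k : ℤ} (hk : k ≤ 1) :
    mixed P X k = 0 := by
  simp [mixed, H.zero (k - 1) (Or.inl (by omega))]

theorem sum_mixed_le (H : BoundedOneDependent P X n B) (h1 : ∀ k, nu P X 1 k ≤ 1 / 100) :
    ∑ k ∈ Icc (1 : ℤ) n, mixed P X k ≤
      ∑ k ∈ Icc (2 : ℤ) n,
        |covariance (fun ω => (X (k - 1) ω : ℝ)) (fun ω => (X k ω : ℝ)) P| + lam P X n / 100 := by
  have e : ∑ k ∈ Icc (1 : ℤ) n, mixed P X k = ∑ k ∈ Icc (2 : ℤ) n, mixed P X k := by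
    symm
    refine sum_subset (fun k hk => ?_) fun k hk hk' => ?_
    · rw [mem_Icc] at *; omega
    · rw [mem_Icc] at *; exact H.mixed_of_nonpos (by omega)
  have h2 : ∑ k ∈ Icc (2 : ℤ) n, nu P X 1 k ≤ lam P X n := by
    rw [H.lam_eq]
    refine sum_le_sum_of_subset_of_nonneg (fun k hk => ?_) fun k _ _ => nu_nonneg P X 1 k
    rw [mem_Icc] at *; omega
  have h3 : ∑ k ∈ Icc (2 : ℤ) n, mixed P X k ≤ ∑ k ∈ Icc (2 : ℤ) n,
      (|covariance (fun ω => (X (k - 1) ω : ℝ)) (fun ω => (X k ω : ℝ)) P| + nu P X 1 k / 100) := by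
    refine sum_le_sum fun k _ => ?_
    have h4 := le_abs_self (covariance (fun ω => (X (k - 1) ω : ℝ)) (fun ω => (X k ω : ℝ)) P)
    have h5 := H.covariance_eq k
    have h6 := mul_le_mul_of_nonneg_right (h1 (k - 1)) (nu_nonneg P X 1 k)
    linarith
  rw [sum_add_distrib, ← sum_div] at h3
  linarith

theorem Eplus22_eq (P : Measure Ω) (X : ℤ → Ω → ℕ) (k : ℤ) : Eplus22 P X k =
    mixed22 P X k + nu P X 2 (k - 1) * nu P X 1 k + nu P X 1 (k - 1) * nu P X 2 k := by
  simp only [Eplus22, Eplus2, mixed22, nu_one, nu_two]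
  ring

theorem Eplus3_eq (P : Measure Ω) (X : ℤ → Ω → ℕ) (k : ℤ) :
    Eplus3 P (fun ω => (X (k - 2) ω : ℝ)) (fun ω => (X (k - 1) ω : ℝ)) (fun ω => (X k ω : ℝ)) =
      mixed3 P X k + nu P X 1 (k - 2) * mixed P X k + (mixed P X (k - 1)
        + nu P X 1 (k - 2) * nu P X 1 (k - 1)) * nu P X 1 k := by
  simp only [Eplus3, Eplus2, mixed3, nu_one, mixed]
  rw [show k - 1 - 1 = k - 2 by ring]

/-- Apart from the cubes of shifted `ν₁`, every term of the local error already occurs in `R₁`. Each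
of the three shifted sums of cubes is again at most `R₁`, giving the factor 4. -/
theorem sum_localError_le (H : BoundedOneDependent P X n B) :
    ∑ k ∈ Icc (1 : ℤ) n, ExpandedRecursion.localError (nu P X 1) (nu P X 2) (nu P X 3) (mixed P X)
      (mixed22 P X) (mixed3 P X) k ≤ 4 * R1 P X n := by
  have hcube : ∑ k ∈ Icc (1 : ℤ) n, nu P X 1 k ^ 3 ≤ R1 P X n := by
    refine sum_le_sum fun k _ => ?_
    rw [Eplus22_eq, Eplus3_eq]
    have n0 := nu_nonneg P X 1
    have n2 := nu_nonneg P X 2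
    have n3 := nu_nonneg P X 3 k
    have m := mixed_nonneg P X
    have m2 := mixed22_nonneg P X k
    have m3 := mixed3_nonneg P X k
    have := mul_nonneg (n0 k) (n2 k)
    have := mul_nonneg (add_nonneg (add_nonneg (n0 (k - 2)) (n0 (k - 1))) (n0 k)) (m k)
    have := mul_nonneg (n2 (k - 1)) (n0 k)
    have := mul_nonneg (n0 (k - 1)) (n2 k)
    have := mul_nonneg (n0 (k - 2)) (m k)
    have := mul_nonneg (add_nonneg (m (k - 1)) (mul_nonneg (n0 (k - 2)) (n0 (k - 1)))) (n0 k)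
    linarith
  have hshift : ∀ j : ℕ, ∑ k ∈ Icc (1 : ℤ) n, nu P X 1 (k - j) ^ 3
      ≤ ∑ k ∈ Icc (1 : ℤ) n, nu P X 1 k ^ 3 := fun j =>
    sum_Icc_shift_le (f := fun k => nu P X 1 k ^ 3) (fun k => pow_nonneg (nu_nonneg P X 1 k) 3)
      (fun k hk => by simp [H.nu_of_nonpos one_ne_zero hk]) n j
  have s1 := hshift 1
  have s2 := hshift 2
  have s3 := hshift 3
  push_cast at s1 s2 s3
  have hmain : ∑ k ∈ Icc (1 : ℤ) n, ExpandedRecursion.localError (nu P X 1) (nu P X 2) (nu P X 3)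
      (mixed P X) (mixed22 P X) (mixed3 P X) k ≤ R1 P X n
        + ∑ k ∈ Icc (1 : ℤ) n, nu P X 1 (k - 1) ^ 3 + ∑ k ∈ Icc (1 : ℤ) n, nu P X 1 (k - 2) ^ 3
        + ∑ k ∈ Icc (1 : ℤ) n, nu P X 1 (k - 3) ^ 3 := by
    rw [R1, ← sum_add_distrib, ← sum_add_distrib, ← sum_add_distrib]
    refine sum_le_sum fun k _ => ?_
    rw [Eplus22_eq, Eplus3_eq]
    unfold ExpandedRecursion.localError
    have h1 := mul_nonneg (nu_nonneg P X 1 (k - 2)) (mixed_nonneg P X k)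
    have h2 := mul_nonneg (mul_nonneg (nu_nonneg P X 1 (k - 2)) (nu_nonneg P X 1 (k - 1)))
      (nu_nonneg P X 1 k)
    linarith
  linarith

theorem R1_nonneg (H : BoundedOneDependent P X n B) : 0 ≤ R1 P X n := by
  have h1 := H.sum_localError_le
  have h2 : 0 ≤ ∑ k ∈ Icc (1 : ℤ) n, ExpandedRecursion.localError (nu P X 1) (nu P X 2) (nu P X 3)
      (mixed P X) (mixed22 P X) (mixed3 P X) k := by
    refine sum_nonneg fun k _ => ?_
    unfold ExpandedRecursion.localError
    have n0 := nu_nonneg P X 1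
    have n2 := nu_nonneg P X 2
    have n3 := nu_nonneg P X 3 k
    have m := mixed_nonneg P X
    have m2 := mixed22_nonneg P X k
    have m3 := mixed3_nonneg P X k
    have := n0 k
    have := n0 (k - 1)
    have := n0 (k - 2)
    have := n0 (k - 3)
    have := n2 k
    have := n2 (k - 1)
    have := m k
    have := m (k - 1)
    positivity
  linarith

theorem sum_sq_shift_le (H : BoundedOneDependent P X n B) (j : ℕ) :
    ∑ k ∈ Icc (1 : ℤ) n, nu P X 1 (k - j) ^ 2 ≤ ∑ k ∈ Icc (1 : ℤ) n, nu P X 1 k ^ 2 :=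
  sum_Icc_shift_le (f := fun k => nu P X 1 k ^ 2) (fun k => sq_nonneg _)
      (fun k hk => by simp [H.nu_of_nonpos one_ne_zero hk]) n j

theorem abs_Gam2_le_R0 (H : BoundedOneDependent P X n B) : |Gam2 P X n| ≤ 2 * R0 P X n := by
  have h1 := H.sum_sq_shift_le 1
  push_cast at h1
  have h2 : |Gam2 P X n| ≤ ∑ k ∈ Icc (1 : ℤ) n,
      (nu P X 2 k + nu P X 1 k ^ 2 + mixed P X k + nu P X 1 (k - 1) ^ 2) := by
    rw [H.Gam2_eq]
    refine (abs_sum_le_sum_abs _ _).trans (sum_le_sum fun k _ => ?_)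
    have n2 := nu_nonneg P X 2 k
    have m := mixed_nonneg P X k
    have p := mul_nonneg (nu_nonneg P X 1 (k - 1)) (nu_nonneg P X 1 k)
    have q := two_mul_le_add_sq (nu P X 1 (k - 1)) (nu P X 1 k)
    unfold ExpandedRecursion.secondCoeff
    rw [abs_le]
    constructor <;> nlinarith
  have h3 : ∑ k ∈ Icc (1 : ℤ) n, nu P X 1 k ^ 2 ≤ R0 P X n :=
    sum_le_sum fun k _ => by linarith [nu_nonneg P X 2 k, mixed_nonneg P X k]
  rw [sum_add_distrib] at h2
  have h4 : R0 P X n = ∑ k ∈ Icc (1 : ℤ) n, (nu P X 2 k + nu P X 1 k ^ 2 + mixed P X k) := rfl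
  linarith

/-- Boundedness by `B` lowers third order moments to second order ones, and the smallness of `ν₁`
absorbs products. This lets the Poisson bound be stated with `R₀` alone. -/
theorem R1_le_R0 (H : BoundedOneDependent P X n B) (h1 : ∀ k, nu P X 1 k ≤ 1 / 100) :
    R1 P X n ≤ (2 + 4 * B) * R0 P X n := by
  have hB : (0 : ℝ) ≤ B := Nat.cast_nonneg B
  have hXB : ∀ k ω, (X k ω : ℝ) ≤ B := fun k ω => Nat.cast_le.2 (H.le k ω)
  have n1 := nu_nonneg P X 1
  have n2 := nu_nonneg P X 2
  have m := mixed_nonneg P X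
  have hν3 : ∀ k, nu P X 3 k ≤ B * nu P X 2 k := by
    intro k
    rw [nu, nu, ← integral_const_mul]
    refine integral_mono ((H.bdd k fun i => (i.descFactorial 3 : ℝ)).integrable P)
      (((BddMeas.const _).mul (H.bdd k fun i => (i.descFactorial 2 : ℝ))).integrable P) fun ω => ?_
    have h3 : (X k ω).descFactorial 3 ≤ B * (X k ω).descFactorial 2 := by
      rw [Nat.descFactorial_succ]
      exact Nat.mul_le_mul_right _ ((Nat.sub_le _ _).trans (H.le k ω))
    simp only
    exact_mod_cast h3
  have hm22 : ∀ k, mixed22 P X k ≤ 2 * B * mixed P X k := by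
    intro k
    rw [mixed22, mixed, ← integral_add (((H.bdd_cast_mul _).mul (H.bdd_cast _)).integrable P)
      (((H.bdd_cast _).mul (H.bdd_cast_mul _)).integrable P), ← integral_const_mul]
    refine integral_mono ((((H.bdd_cast_mul _).mul (H.bdd_cast _)).add
        ((H.bdd_cast _).mul (H.bdd_cast_mul _))).integrable P)
      (((BddMeas.const _).mul ((H.bdd_cast _).mul (H.bdd_cast _))).integrable P) fun ω => ?_
    have h3 : 0 ≤ (X (k - 1) ω : ℝ) * (X k ω : ℝ) := by positivity
    have h4 := mul_le_mul_of_nonneg_right (hXB k ω) h3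
    have h5 := mul_le_mul_of_nonneg_right (hXB (k - 1) ω) h3
    simp only
    nlinarith
  have hm3 : ∀ k, mixed3 P X k ≤ B * mixed P X k := by
    intro k
    rw [mixed3, mixed, ← integral_const_mul]
    refine integral_mono ((((H.bdd_cast _).mul (H.bdd_cast _)).mul (H.bdd_cast _)).integrable P)
      (((BddMeas.const _).mul ((H.bdd_cast _).mul (H.bdd_cast _))).integrable P) fun ω => ?_
    have h3 : 0 ≤ (X (k - 1) ω : ℝ) * (X k ω : ℝ) := by positivity
    have h4 := mul_le_mul_of_nonneg_right (hXB (k - 2) ω) h3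
    simp only
    linarith
  have s1 := H.sum_sq_shift_le 1
  have s2 : ∑ k ∈ Icc (1 : ℤ) n, nu P X 2 (k - 1) ≤ ∑ k ∈ Icc (1 : ℤ) n, nu P X 2 k := by
    have := sum_Icc_shift_le n2 (fun k hk => H.nu_of_nonpos two_ne_zero hk) n 1
    simpa using this
  have s3 : ∑ k ∈ Icc (1 : ℤ) n, mixed P X (k - 1) ≤ ∑ k ∈ Icc (1 : ℤ) n, mixed P X k := by
    have := sum_Icc_shift_le m (fun k hk => H.mixed_of_nonpos (by omega)) n 1
    simpa using this
  push_cast at s1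
  have hmain : R1 P X n ≤ ∑ k ∈ Icc (1 : ℤ) n, ((0.5 + 4 * B) * (nu P X 2 k + nu P X 1 k ^ 2
      + mixed P X k) + 0.5 * nu P X 1 (k - 1) ^ 2 + 0.5 * nu P X 2 (k - 1)
      + 0.5 * mixed P X (k - 1)) := by
    refine sum_le_sum fun k _ => ?_
    rw [Eplus22_eq, Eplus3_eq]
    have a1 := mul_le_mul_of_nonneg_right (h1 k) (sq_nonneg (nu P X 1 k))
    have a2 := mul_le_mul_of_nonneg_right (h1 k) (n2 k)
    have a3 := mul_le_mul_of_nonneg_right (h1 k) (m k)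
    have a4 := mul_le_mul_of_nonneg_right (h1 (k - 1)) (m k)
    have a5 := mul_le_mul_of_nonneg_right (h1 (k - 2)) (m k)
    have a6 := mul_le_mul_of_nonneg_right (h1 k) (n2 (k - 1))
    have a7 := mul_le_mul_of_nonneg_right (h1 (k - 1)) (n2 k)
    have a8 := mul_le_mul_of_nonneg_right (h1 k) (m (k - 1))
    have a9 := mul_le_mul_of_nonneg_right (h1 (k - 2)) (mul_nonneg (n1 (k - 1)) (n1 k))
    have q := two_mul_le_add_sq (nu P X 1 (k - 1)) (nu P X 1 k)
    have b1 := hν3 k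
    have b2 := hm22 k
    have b3 := hm3 k
    have c1 := mul_nonneg hB (n2 k)
    have c2 := mul_nonneg hB (m k)
    have c3 := mul_nonneg hB (sq_nonneg (nu P X 1 k))
    have d1 := n2 k
    have d2 := m k
    have d3 := n2 (k - 1)
    have d4 := m (k - 1)
    have d5 := sq_nonneg (nu P X 1 k)
    have d6 := sq_nonneg (nu P X 1 (k - 1))
    nlinarith
  rw [sum_add_distrib, sum_add_distrib, sum_add_distrib, ← mul_sum, ← mul_sum, ← mul_sum,
    ← mul_sum] at hmain
  have h4 : R0 P X n = ∑ k ∈ Icc (1 : ℤ) n, nu P X 2 k + ∑ k ∈ Icc (1 : ℤ) n, nu P X 1 k ^ 2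
      + ∑ k ∈ Icc (1 : ℤ) n, mixed P X k := by
    rw [R0, sum_add_distrib, sum_add_distrib]
  have h5 : ∑ k ∈ Icc (1 : ℤ) n, (nu P X 2 k + nu P X 1 k ^ 2 + mixed P X k) = R0 P X n := rfl
  rw [h5] at hmain
  have e1 : 0 ≤ ∑ k ∈ Icc (1 : ℤ) n, nu P X 2 k := sum_nonneg fun k _ => n2 k
  have e2 : 0 ≤ ∑ k ∈ Icc (1 : ℤ) n, nu P X 1 k ^ 2 := sum_nonneg fun k _ => sq_nonneg _
  have e3 : 0 ≤ ∑ k ∈ Icc (1 : ℤ) n, mixed P X k := sum_nonneg fun k _ => m k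
  linarith

/-- The smallness assumptions on the moments. -/
structure SmallMoments (P : Measure Ω) (X : ℤ → Ω → ℕ) (n : ℕ) : Prop where
  nu_one_le : ∀ k, nu P X 1 k ≤ 1 / 100
  nu_two_le : ∀ k, nu P X 2 k ≤ nu P X 1 k
  sum_nu_two_le : ∑ k ∈ Icc (1 : ℤ) n, nu P X 2 k ≤ lam P X n / 20
  sum_mixed_le : ∑ k ∈ Icc (1 : ℤ) n, mixed P X k ≤ 3 / 50 * lam P X n
  sum_cov_le : |∑ k ∈ Icc (1 : ℤ) n, (mixed P X k - nu P X 1 (k - 1) * nu P X 1 k)|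
    ≤ lam P X n / 20

theorem lam_nonneg (P : Measure Ω) (X : ℤ → Ω → ℕ) (n : ℕ) : 0 ≤ lam P X n :=
  integral_nonneg fun _ => Nat.cast_nonneg _

/-- The upper bound comes from `1 / 40 + 1 / 20 ≤ 2 / 25`; the squares of `ν₁` count only for the
lower one. -/
theorem abs_Gam2_le (H : BoundedOneDependent P X n B) (hs : SmallMoments P X n) :
    |Gam2 P X n| ≤ 2 / 25 * lam P X n := by
  have h1 := abs_le.1 hs.sum_cov_le
  have h2 : ∑ k ∈ Icc (1 : ℤ) n, nu P X 1 k ^ 2 ≤ lam P X n / 100 := by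
    rw [H.lam_eq, sum_div]
    refine sum_le_sum fun k _ => ?_
    nlinarith [hs.nu_one_le k, nu_nonneg P X 1 k]
  have h3 : 0 ≤ ∑ k ∈ Icc (1 : ℤ) n, nu P X 1 k ^ 2 := sum_nonneg fun k _ => sq_nonneg _
  have h4 : 0 ≤ ∑ k ∈ Icc (1 : ℤ) n, nu P X 2 k := sum_nonneg fun k _ => nu_nonneg P X 2 k
  have h5 := hs.sum_nu_two_le
  have e : Gam2 P X n = (∑ k ∈ Icc (1 : ℤ) n, nu P X 2 k) / 2
      - (∑ k ∈ Icc (1 : ℤ) n, nu P X 1 k ^ 2) / 2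
      + ∑ k ∈ Icc (1 : ℤ) n, (mixed P X k - nu P X 1 (k - 1) * nu P X 1 k) := by
    rw [H.Gam2_eq, sum_div, sum_div, ← sum_sub_distrib, ← sum_add_distrib]
    rfl
  rw [e, abs_le]
  constructor <;> linarith

theorem norm_genFun_sub_exp_le (H : BoundedOneDependent P X n B) (hs : SmallMoments P X n) {w : ℂ}
    (hK : ∀ j ≤ B, ‖w‖ ^ j ≤ 1.01) (hz : ‖w - 1‖ ≤ 2.01) :
    ‖∫ ω, w ^ sumS X n ω ∂P
        - Complex.exp (lam P X n * (w - 1) + Gam2 P X n * (w - 1) ^ 2)‖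
      ≤ 8 * ExpandedRecursion.localConst B * R1 P X n * ‖w - 1‖ ^ 3
        * Real.exp (lam P X n * (w - 1).re + 3 / 10 * lam P X n * ‖w - 1‖ ^ 2) := by
  have E := H.expandedRecursion hK hz hs.nu_one_le hs.nu_two_le
  have h1 := E.norm_sub_exp_le n
  rw [← H.lam_eq, ← H.Gam2_eq] at h1
  refine h1.trans ?_
  have hB : 0 ≤ ExpandedRecursion.localConst B := by
    unfold ExpandedRecursion.localConst; positivity
  -- Numerically `0.51 / 20 + 0.16 + 1.35 * 3 / 50 < 3 / 10`. It matters that this is below `1 / 2`,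
  -- see `exponent_le`.
  have h2 : ∑ k ∈ Icc (1 : ℤ) n, ExpandedRecursion.majorantCoeff (nu P X 1) (nu P X 2) (mixed P X) k
      ≤ 3 / 10 * lam P X n := by
    unfold ExpandedRecursion.majorantCoeff
    rw [sum_add_distrib, sum_add_distrib, ← mul_sum, ← mul_sum, ← mul_sum, ← H.lam_eq]
    linarith [hs.sum_nu_two_le, hs.sum_mixed_le, lam_nonneg P X n]
  have h3 := mul_le_mul_of_nonneg_left H.sum_localError_le
    (show 0 ≤ 2 * ExpandedRecursion.localConst B by positivity)
  have h4 := mul_le_mul_of_nonneg_right h3 (show 0 ≤ ‖w - 1‖ ^ 3 by positivity)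
  refine mul_le_mul (h4.trans (le_of_eq (by ring))) (Real.exp_le_exp.2 ?_) (Real.exp_pos _).le
    (mul_nonneg (mul_nonneg (by positivity) H.R1_nonneg) (by positivity))
  nlinarith [sq_nonneg ‖w - 1‖]

theorem measurable_sumS (H : BoundedOneDependent P X n B) : Measurable (sumS X n) :=
  (measurable_partialSum (X := X) (k := (n : ℤ)) le_rfl).mono (H.sigmaAlg_le _) le_rfl

theorem sumS_le (H : BoundedOneDependent P X n B) (ω : Ω) : sumS X n ω ≤ n * B := by
  refine (sum_le_card_nsmul _ _ _ fun i _ => H.le i ω).trans ?_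
  simp

theorem hasSum_integral_pow_sumS (H : BoundedOneDependent P X n B) (w : ℂ) :
    HasSum (fun k => (P.real {ω | sumS X n ω = k} : ℂ) * w ^ k) (∫ ω, w ^ sumS X n ω ∂P) := by
  have hm : ∀ k, MeasurableSet {ω | sumS X n ω = k} := fun k =>
    H.measurable_sumS (measurableSet_singleton k)
  have h1 : ∫ ω, w ^ sumS X n ω ∂P = ∑ k ∈ range (n * B + 1),
      (P.real {ω | sumS X n ω = k} : ℂ) * w ^ k := by
    have h2 : ∀ ω, w ^ sumS X n ω = ∑ k ∈ range (n * B + 1),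
        {ω | sumS X n ω = k}.indicator (fun _ => w ^ k) ω := by
      intro ω
      rw [sum_eq_single (sumS X n ω)]
      · simp
      · intro k _ hk
        exact Set.indicator_of_notMem (fun h => hk (Eq.symm h)) _
      · intro h
        exact absurd (mem_range.2 (Nat.lt_succ_of_le (H.sumS_le ω))) h
    simp_rw [h2]
    rw [integral_finsetSum _ fun k _ => (integrable_const _).indicator (hm k)]
    refine sum_congr rfl fun k _ => ?_
    rw [integral_indicator_const _ (hm k), Complex.real_smul]
  rw [h1]
  refine hasSum_sum_of_ne_finset_zero fun k hk => ?_
  have : {ω | sumS X n ω = k} = ∅ := by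
    ext ω
    simp only [Set.mem_ofPred_eq, Set.mem_empty_iff_false, iff_false]
    rintro rfl
    exact hk (mem_range.2 (Nat.lt_succ_of_le (H.sumS_le ω)))
  rw [this]
  simp

theorem hasGenFun_sumS (H : BoundedOneDependent P X n B) (r : ℝ) :
    HasGenFun (fun k => P.real {ω | sumS X n ω = k}) (fun w => ∫ ω, w ^ sumS X n ω ∂P) r := by
  refine ⟨?_, fun w _ => H.hasSum_integral_pow_sumS w⟩
  have := H.hasSum_integral_pow_sumS 1
  rw [← Complex.hasSum_ofReal]
  simpa using this

theorem cdfS_eq (H : BoundedOneDependent P X n B) (x : ℕ) :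
    cdfS P X n x = ∑ k ∈ range (x + 1), P.real {ω | sumS X n ω = k} := by
  have hm : ∀ k, MeasurableSet {ω | sumS X n ω = k} := fun k =>
    H.measurable_sumS (measurableSet_singleton k)
  rw [cdfS, ← measureReal_biUnion_finset ?_ fun k _ => hm k]
  · congr 1
    ext ω
    simp
  · intro i _ j _ hij
    refine Set.disjoint_left.2 fun ω h1 h2 => hij ?_
    exact (Eq.symm h1).trans h2

end BoundedOneDependent

end Sums

/-! ### Comparison of `G` with the other laws at the level of transforms. -/

section Comparisons

open Complex

/-- Mean value inequality on a half-plane, which is convex and on which `‖exp‖` is bounded.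
Comparing two laws thus reduces to subtracting their exponents. -/
theorem norm_exp_sub_exp_le {A A' : ℂ} {M : ℝ} (hA : A.re ≤ M) (hA' : A'.re ≤ M) :
    ‖cexp A - cexp A'‖ ≤ ‖A - A'‖ * Real.exp M := by
  have := (convex_halfSpace_re_le M).norm_image_sub_le_of_norm_deriv_le (𝕜 := ℂ) (f := cexp)
    (C := Real.exp M) (fun x _ => Complex.differentiableAt_exp) (fun x hx => by
      rw [Complex.deriv_exp, Complex.norm_exp]
      exact Real.exp_le_exp.2 hx) hA' hA
  rwa [mul_comm] at this

theorem norm_exp_sub_one_sub_le (u : ℂ) : ‖cexp u - (1 + u)‖ ≤ ‖u‖ ^ 2 * Real.exp ‖u‖ := by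
  have := Complex.norm_exp_sub_sum_le_norm_mul_exp u 2
  simpa [Finset.sum_range_succ, Nat.factorial] using this

/-- The point `e ^ (h + i t)` lies on a circle close to the unit circle. -/
structure NearUnitCircle (l h t : ℝ) : Prop where
  one_le : 1 ≤ l
  abs_h : |h| ≤ 1 / 200
  sq_h : l * h ^ 2 ≤ 1
  abs_t : |t| ≤ Real.pi

namespace NearUnitCircle

variable {l h t : ℝ}

theorem exp_bounds (H : NearUnitCircle l h t) :
    h ≤ Real.exp h - 1 ∧ Real.exp h - 1 ≤ h + h ^ 2 ∧ 0.99 ≤ Real.exp h ∧ Real.exp h ≤ 1.01 ∧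
      (Real.exp h - 1) ^ 2 ≤ 4 * h ^ 2 ∧ h ^ 2 / 4 ≤ (Real.exp h - 1) ^ 2 := by
  have h1 := abs_le.1 H.abs_h
  have h2 := abs_le.1 (Real.abs_exp_sub_one_sub_id_le (x := h) (by linarith [H.abs_h]))
  have h3 := Real.add_one_le_exp h
  have h4 : Real.exp h - 1 ≤ h + h ^ 2 := by linarith
  have h5 : h ^ 2 ≤ 1 / 40000 := by
    rw [← sq_abs]
    have := pow_le_pow_left₀ (abs_nonneg h) H.abs_h 2
    norm_num at this ⊢
    exact this
  have h6 : |Real.exp h - 1 - h| ≤ |h| / 2 := by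
    refine (Real.abs_exp_sub_one_sub_id_le (x := h) (by linarith [H.abs_h])).trans ?_
    rw [← sq_abs]
    nlinarith [abs_nonneg h, H.abs_h]
  have h7 : |Real.exp h - 1| ≤ 2 * |h| := Real.abs_exp_sub_one_le (by linarith [H.abs_h])
  have h8 : |h| / 2 ≤ |Real.exp h - 1| := by
    have := abs_sub_abs_le_abs_sub h (h - (Real.exp h - 1))
    rw [sub_sub_cancel, abs_sub_comm h] at this
    linarith
  refine ⟨by linarith, h4, by linarith, by linarith, ?_, ?_⟩
  · rw [← sq_abs, ← sq_abs h]; nlinarith [abs_nonneg (Real.exp h - 1)]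
  · rw [← sq_abs, ← sq_abs (Real.exp h - 1)]; nlinarith [abs_nonneg h]

theorem one_sub_cos_ge (H : NearUnitCircle l h t) : 0.2 * t ^ 2 ≤ 1 - Real.cos t := by
  have h1 := Real.cos_le_one_sub_mul_cos_sq H.abs_t
  have h2 : 0.2 ≤ 2 / Real.pi ^ 2 := by
    rw [le_div_iff₀ (by positivity)]
    nlinarith [Real.pi_lt_d2, Real.pi_pos]
  nlinarith [mul_le_mul_of_nonneg_right h2 (sq_nonneg t)]

theorem norm_le (H : NearUnitCircle l h t) : ‖expCircle h t - 1‖ ≤ 2.01 := by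
  have h1 := norm_sub_le (expCircle h t) 1
  rw [norm_expCircle, norm_one] at h1
  linarith [H.exp_bounds.2.2.2.1]

/-- The angle enters `re z` as `-e ^ h (1 - cos t)` and `‖z‖ ^ 2` as `2 e ^ h (1 - cos t)`. With
coefficient `3 / 10 < 1 / 2` a net negative multiple remains, and `1 - cos t ≥ 0.2 * t ^ 2` turns it
into Gaussian decay. The terms in `h ^ 2` are bounded because `l * h ^ 2 ≤ 1`. -/
theorem exponent_le (H : NearUnitCircle l h t) :
    l * (expCircle h t - 1).re + 3 / 10 * l * ‖expCircle h t - 1‖ ^ 2 + 2.1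
      ≤ l * h + 5 - 0.06 * (l * t ^ 2) := by
  obtain ⟨_, h2, h3, _, h5, _⟩ := H.exp_bounds
  have h6 := H.one_sub_cos_ge
  have hl := H.one_le
  have h7 := H.sq_h
  rw [re_expCircle_sub_one, norm_expCircle_sub_one_sq]
  have h8 : 0.198 * t ^ 2 ≤ Real.exp h * (1 - Real.cos t) := by nlinarith [sq_nonneg t]
  have h9 : (Real.exp h - 1 - Real.exp h * (1 - Real.cos t)) + 3 / 10 * ((Real.exp h - 1) ^ 2 +
      2 * Real.exp h * (1 - Real.cos t)) ≤ h + 2.2 * h ^ 2 - 0.06 * t ^ 2 := by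
    nlinarith [sq_nonneg t]
  nlinarith [mul_le_mul_of_nonneg_left h9 (show 0 ≤ l by linarith)]

theorem translated_exponent_le (H : NearUnitCircle l h t) {μ : ℝ} (h1 : 0.5 * l ≤ μ)
    (h2 : μ ≤ 3 * l) :
    l * h + μ * ((expCircle h t - 1).re - h) ≤ l * h + 5 - 0.06 * (l * t ^ 2) := by
  obtain ⟨_, h4, h5, _, _, _⟩ := H.exp_bounds
  have h6 := H.one_sub_cos_ge
  have hl := H.one_le
  have h7 := H.sq_h
  rw [re_expCircle_sub_one]
  have h8 : 0.198 * t ^ 2 ≤ Real.exp h * (1 - Real.cos t) := by nlinarith [sq_nonneg t]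
  have h9 : Real.exp h - 1 - Real.exp h * (1 - Real.cos t) - h ≤ h ^ 2 - 0.198 * t ^ 2 := by
    linarith
  have h10 := mul_le_mul_of_nonneg_left h9 (show 0 ≤ μ by linarith)
  have h11 := mul_le_mul_of_nonneg_right h2 (sq_nonneg h)
  have h12 := mul_le_mul_of_nonneg_right h1 (sq_nonneg t)
  nlinarith [sq_nonneg t]

/-- The bound is needed on the whole circle, where `‖z‖` may exceed 1 and the series of the
logarithm is useless. The exponential is expanded in `s = h + i t` instead, with `‖s‖ ≤ 4`, and `‖s‖
≤ 2 * ‖z‖` converts the result into powers of `z`. -/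
theorem norm_log_remainder_le (H : NearUnitCircle l h t) :
    ‖((h : ℂ) + t * I) - (expCircle h t - 1) + (expCircle h t - 1) ^ 2 / 2‖
      ≤ 8 * (Real.exp 4 + Real.exp 4 * (4 * Real.exp 4 + 2) / 2) * ‖expCircle h t - 1‖ ^ 3 := by
  obtain ⟨_, _, h3, _, _, h6⟩ := H.exp_bounds
  set s : ℂ := (h : ℂ) + t * I with hs
  set z : ℂ := expCircle h t - 1 with hz
  have hzs : z = cexp s - 1 := rfl
  have hsn : ‖s‖ ^ 2 = h ^ 2 + t ^ 2 := by
    rw [hs, ← Complex.normSq_eq_norm_sq, Complex.normSq_add_mul_I]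
  have hs4 : ‖s‖ ≤ 4 := by
    refine (norm_add_le _ _).trans ?_
    rw [norm_mul, Complex.norm_I, Complex.norm_real, Complex.norm_real, Real.norm_eq_abs,
      Real.norm_eq_abs]
    linarith [H.abs_h, H.abs_t, Real.pi_lt_d2]
  have hle : ‖s‖ ≤ 2 * ‖z‖ := by
    refine le_of_sq_le_sq ?_ (by positivity)
    rw [mul_pow, hsn, norm_expCircle_sub_one_sq]
    nlinarith [H.one_sub_cos_ge, sq_nonneg t]
  have hE : Real.exp ‖s‖ ≤ Real.exp 4 := Real.exp_le_exp.2 hs4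
  have hn := norm_nonneg s
  have e1 : ‖z - s‖ ≤ ‖s‖ ^ 2 * Real.exp 4 := by
    have h1 := norm_exp_sub_one_sub_le s
    have h2 : cexp s - (1 + s) = z - s := by rw [hzs]; ring
    rw [h2] at h1
    exact h1.trans (by gcongr)
  have e2 : ‖cexp s - (1 + s + s ^ 2 / 2)‖ ≤ ‖s‖ ^ 3 * Real.exp 4 :=
    (ExpandedRecursion.norm_exp_sub_quadratic_le s).trans (by gcongr)
  have e3 : ‖z + s‖ ≤ ‖s‖ * (4 * Real.exp 4 + 2) := by
    have h1 : z + s = (z - s) + 2 * s := by ring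
    rw [h1]
    refine (norm_add_le _ _).trans ?_
    rw [norm_mul, Complex.norm_ofNat]
    have : ‖s‖ ^ 2 * Real.exp 4 ≤ ‖s‖ * (4 * Real.exp 4) := by
      rw [pow_two, mul_assoc]
      gcongr
    linarith
  have e4 : s - z + z ^ 2 / 2 = -(cexp s - (1 + s + s ^ 2 / 2)) + (z - s) * (z + s) / 2 := by
    rw [hzs]; ring
  rw [e4]
  refine (norm_add_le _ _).trans ?_
  rw [norm_neg, norm_div, norm_mul, Complex.norm_ofNat]
  calc _ ≤ ‖s‖ ^ 3 * Real.exp 4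
        + (‖s‖ ^ 2 * Real.exp 4) * (‖s‖ * (4 * Real.exp 4 + 2)) / 2 := by gcongr
    _ = (Real.exp 4 + Real.exp 4 * (4 * Real.exp 4 + 2) / 2) * ‖s‖ ^ 3 := by ring
    _ ≤ (Real.exp 4 + Real.exp 4 * (4 * Real.exp 4 + 2) / 2) * (2 * ‖z‖) ^ 3 := by gcongr
    _ = _ := by ring

/-- The common majorant of all the generating functions. -/
noncomputable def majorant (l h t : ℝ) : ℝ := Real.exp (l * h + 5 - 0.06 * (l * t ^ 2))

theorem re_quadratic_le (l g : ℝ) (z : ℂ) :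
    (l * z + g * z ^ 2 : ℂ).re ≤ l * z.re + |g| * ‖z‖ ^ 2 := by
  rw [Complex.add_re, Complex.re_ofReal_mul]
  have h1 : (g * z ^ 2 : ℂ).re ≤ |g| * ‖z‖ ^ 2 := by
    refine (Complex.re_le_norm _).trans (le_of_eq ?_)
    rw [norm_mul, norm_pow, Complex.norm_real, Real.norm_eq_abs]
  linarith

theorem norm_exp_sub_exp_le_majorant (H : NearUnitCircle l h t) {A A' : ℂ}
    (hA : A.re ≤ l * (expCircle h t - 1).re + 3 / 10 * l * ‖expCircle h t - 1‖ ^ 2 + 2.1)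
    (hA' : A'.re ≤ l * (expCircle h t - 1).re + 3 / 10 * l * ‖expCircle h t - 1‖ ^ 2 + 2.1) :
    ‖cexp A - cexp A'‖ ≤ ‖A - A'‖ * majorant l h t :=
  norm_exp_sub_exp_le (hA.trans H.exponent_le) (hA'.trans H.exponent_le)

/-- The extra `0.5` admits a `g` rounded by taking a floor. It costs at most `0.5 * 2.01 ^ 2 ≤ 2.1`,
the slack built into `exponent_le`. -/
theorem re_quadratic_le_of_abs_le (H : NearUnitCircle l h t) {g : ℝ} (hg : |g| ≤ 3 / 10 * l + 0.5) :
    (l * (expCircle h t - 1) + g * (expCircle h t - 1) ^ 2 : ℂ).re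
      ≤ l * (expCircle h t - 1).re + 3 / 10 * l * ‖expCircle h t - 1‖ ^ 2 + 2.1 := by
  have h1 := re_quadratic_le l g (expCircle h t - 1)
  have h2 := H.norm_le
  have h3 := norm_nonneg (expCircle h t - 1)
  nlinarith [mul_le_mul_of_nonneg_right hg (sq_nonneg ‖expCircle h t - 1‖)]

theorem norm_compound_sub_compound_le (H : NearUnitCircle l h t) {g g' : ℝ}
    (hg : |g| ≤ 3 / 10 * l + 0.5) (hg' : |g'| ≤ 3 / 10 * l + 0.5) :
    ‖cexp (l * (expCircle h t - 1) + g * (expCircle h t - 1) ^ 2)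
        - cexp (l * (expCircle h t - 1) + g' * (expCircle h t - 1) ^ 2)‖
      ≤ |g - g'| * ‖expCircle h t - 1‖ ^ 2 * majorant l h t := by
  refine (H.norm_exp_sub_exp_le_majorant (H.re_quadratic_le_of_abs_le hg)
    (H.re_quadratic_le_of_abs_le hg')).trans (le_of_eq ?_)
  rw [add_sub_add_left_eq_sub, ← sub_mul, ← Complex.ofReal_sub, norm_mul, norm_pow,
    Complex.norm_real, Real.norm_eq_abs]

theorem norm_compound_sub_poisson1_le (H : NearUnitCircle l h t) {g : ℝ} (hg : |g| ≤ 3 / 10 * l) :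
    ‖cexp (l * (expCircle h t - 1) + g * (expCircle h t - 1) ^ 2)
        - (cexp (l * (expCircle h t - 1))
          + cexp (l * (expCircle h t - 1)) * (g * (expCircle h t - 1) ^ 2))‖
      ≤ g ^ 2 * ‖expCircle h t - 1‖ ^ 4 * majorant l h t := by
  set z := expCircle h t - 1 with hz
  have e : cexp (l * z + g * z ^ 2) - (cexp (l * z) + cexp (l * z) * (g * z ^ 2)) =
      cexp (l * z) * (cexp (g * z ^ 2) - (1 + g * z ^ 2)) := by
    rw [Complex.exp_add]; ring
  have h1 : ‖(g * z ^ 2 : ℂ)‖ = |g| * ‖z‖ ^ 2 := by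
    rw [norm_mul, norm_pow, Complex.norm_real, Real.norm_eq_abs]
  have h2 := norm_exp_sub_one_sub_le (g * z ^ 2)
  rw [h1] at h2
  rw [e, norm_mul, Complex.norm_exp, Complex.re_ofReal_mul]
  calc _ ≤ Real.exp (l * z.re) * ((|g| * ‖z‖ ^ 2) ^ 2 * Real.exp (|g| * ‖z‖ ^ 2)) := by gcongr
    _ = g ^ 2 * ‖z‖ ^ 4 * Real.exp (l * z.re + |g| * ‖z‖ ^ 2) := by
        rw [Real.exp_add, mul_pow, sq_abs]; ring
    _ ≤ _ := by
        refine mul_le_mul_of_nonneg_left (Real.exp_le_exp.2 (le_trans ?_ H.exponent_le))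
          (by positivity)
        nlinarith [mul_le_mul_of_nonneg_right hg (sq_nonneg ‖z‖)]

/-- Translation by `m` adds `m (h + i t)` to the exponent. This is `m (z - z ^ 2 / 2)` up to third
order, so the linear terms still sum to `l * z` while `-m / 2` appears in front of `z ^ 2`. -/
theorem norm_compound_sub_translated_le (H : NearUnitCircle l h t) {m : ℤ}
    (h1 : |(m : ℝ)| ≤ 0.5 * l + 1) (h2 : 0.5 * l ≤ l - m) (h3 : l - m ≤ 3 * l) :
    ‖cexp (l * (expCircle h t - 1) + (-m / 2 : ℝ) * (expCircle h t - 1) ^ 2)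
        - expCircle h t ^ m * cexp ((l - m : ℝ) * (expCircle h t - 1))‖
      ≤ 8 * (Real.exp 4 + Real.exp 4 * (4 * Real.exp 4 + 2) / 2) * |(m : ℝ)|
        * ‖expCircle h t - 1‖ ^ 3 * majorant l h t := by
  have hr := H.norm_log_remainder_le
  have ht := H.translated_exponent_le h2 h3
  have hq := H.re_quadratic_le_of_abs_le (g := -m / 2) (by
    rw [abs_div, abs_neg, abs_of_pos (show (0 : ℝ) < 2 by norm_num)]; linarith [H.one_le])
  set z := expCircle h t - 1 with hz
  rw [expCircle_zpow, ← Complex.exp_add]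
  refine (norm_exp_sub_exp_le (hq.trans H.exponent_le) (le_trans (le_of_eq ?_) ht)).trans ?_
  · rw [Complex.add_re, Complex.re_ofReal_mul]
    simp
    ring
  · refine mul_le_mul_of_nonneg_right ?_ (Real.exp_pos _).le
    have e : l * z + (-m / 2 : ℝ) * z ^ 2 - (m * ((h : ℂ) + t * I) + (l - m : ℝ) * z)
        = -((m : ℝ) * (((h : ℂ) + t * I) - z + z ^ 2 / 2)) := by
      push_cast; ring
    rw [e, norm_neg, norm_mul, Complex.norm_real, Real.norm_eq_abs]
    refine (mul_le_mul_of_nonneg_left hr (abs_nonneg _)).trans (le_of_eq (by ring))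

theorem norm_log_one_add_sub_quadratic_le {v : ℂ} {κ : ℝ} (hv : ‖v‖ < 1)
    (hκ : 1 / (3 * (1 - ‖v‖)) ≤ κ) : ‖log (1 + v) - (v - v ^ 2 / 2)‖ ≤ κ * ‖v‖ ^ 3 := by
  have h1 := Complex.norm_log_sub_logTaylor_le 2 hv
  have e : logTaylor (2 + 1) v = v - v ^ 2 / 2 := by
    simp [logTaylor_succ, logTaylor_zero]
    ring
  rw [e] at h1
  refine h1.trans ?_
  have h2 := mul_le_mul_of_nonneg_right hκ (show 0 ≤ ‖v‖ ^ 3 by positivity)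
  refine le_trans (le_of_eq ?_) h2
  have : 1 - ‖v‖ ≠ 0 := by linarith
  field_simp
  norm_num

/-- With `α = 2 g / l` one has `r α = l` and `r α ^ 2 = 2 g`, so `-r log (1 - α z)` agrees with `l z
+ g z ^ 2` to second order. The remainder is at most `r α ^ 3 ‖z‖ ^ 3 / 2`. -/
theorem norm_compound_sub_negBinomial_le (H : NearUnitCircle l h t) {g : ℝ} (hg0 : 0 < g)
    (hg : g ≤ 2 / 25 * l) :
    ‖cexp (l * (expCircle h t - 1) + g * (expCircle h t - 1) ^ 2)
        - cexp (-(nbR l g : ℂ) * log (1 - (2 * g / l : ℝ) * (expCircle h t - 1)))‖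
      ≤ 2 * g ^ 2 / l * ‖expCircle h t - 1‖ ^ 3 * majorant l h t := by
  have hzn := H.norm_le
  have hl : 0 < l := by linarith [H.one_le]
  have hq := re_quadratic_le l g (expCircle h t - 1)
  have hq' := H.re_quadratic_le_of_abs_le (g := g) (by rw [abs_of_pos hg0]; linarith)
  rw [abs_of_pos hg0] at hq
  set z := expCircle h t - 1 with hz
  have hn := norm_nonneg z
  set α : ℝ := 2 * g / l with hα
  have hα0 : 0 < α := by positivity
  have hα1 : α ≤ 0.16 := by rw [hα, div_le_iff₀ hl]; linarith
  have hv : ‖(-(α * z) : ℂ)‖ = α * ‖z‖ := by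
    rw [norm_neg, norm_mul, Complex.norm_real, Real.norm_of_nonneg hα0.le]
  have hv1 : α * ‖z‖ ≤ 0.33 := by nlinarith
  have hlog := norm_log_one_add_sub_quadratic_le (v := -(α * z)) (κ := 0.5) (by rw [hv]; linarith)
    (by rw [hv, div_le_iff₀ (by linarith)]; linarith)
  rw [hv, ← sub_eq_add_neg] at hlog
  have hr0 : 0 < nbR l g := by unfold nbR; positivity
  have e : l * z + g * z ^ 2 - -(nbR l g : ℂ) * log (1 - α * z) =
      nbR l g * (log (1 - α * z) - (-(α * z) - (-(α * z)) ^ 2 / 2)) := by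
    have e1 : (nbR l g : ℂ) * α = l := by
      rw [← Complex.ofReal_mul, Complex.ofReal_inj, hα]
      unfold nbR; field_simp
    have e2 : (nbR l g : ℂ) * α ^ 2 = 2 * g := by
      have : nbR l g * α ^ 2 = 2 * g := by rw [hα]; unfold nbR; field_simp
      exact_mod_cast this
    linear_combination -z * e1 - z ^ 2 / 2 * e2
  have hdiff : ‖l * z + g * z ^ 2 - -(nbR l g : ℂ) * log (1 - α * z)‖
      ≤ 2 * g ^ 2 / l * ‖z‖ ^ 3 := by
    rw [e, norm_mul, Complex.norm_real, Real.norm_of_nonneg hr0.le]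
    refine (mul_le_mul_of_nonneg_left hlog hr0.le).trans (le_of_eq ?_)
    rw [hα]; unfold nbR; field_simp; norm_num
  refine (H.norm_exp_sub_exp_le_majorant hq' ?_).trans
    (mul_le_mul_of_nonneg_right hdiff (Real.exp_pos _).le)
  -- The real part of the second exponent is controlled through its distance from the first, which
  -- is only a small multiple of `l * ‖z‖ ^ 2`.
  have h3 : (-(nbR l g : ℂ) * log (1 - α * z)).re ≤ (l * z + g * z ^ 2 : ℂ).re
      + 2 * g ^ 2 / l * ‖z‖ ^ 3 := by
    have := Complex.abs_re_le_norm (l * z + g * z ^ 2 - -(nbR l g : ℂ) * log (1 - α * z))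
    rw [Complex.sub_re] at this
    linarith [(abs_le.1 this).1]
  have h4 : 2 * g ^ 2 / l * ‖z‖ ^ 3 ≤ 0.1 * l * ‖z‖ ^ 2 := by
    have h5 : 2 * g ^ 2 / l ≤ 0.0128 * l := by
      rw [div_le_iff₀ hl]; nlinarith
    calc 2 * g ^ 2 / l * ‖z‖ ^ 3 ≤ (0.0128 * l) * ‖z‖ ^ 3 := by gcongr
      _ = 0.0128 * l * ‖z‖ ^ 2 * ‖z‖ := by ring
      _ ≤ 0.0128 * l * ‖z‖ ^ 2 * 2.01 := by gcongr
      _ ≤ _ := by nlinarith [mul_nonneg hl.le (sq_nonneg ‖z‖)]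
  have h6 := mul_le_mul_of_nonneg_right hg (sq_nonneg ‖z‖)
  nlinarith [mul_nonneg hl.le (sq_nonneg ‖z‖)]

/-- Here `N log (1 + p z)` is expanded to second order using `N p = l`; the matching `g` is `-l p /
2`. -/
theorem norm_compound_sub_binomial_le (H : NearUnitCircle l h t) {N : ℕ} {p : ℝ}
    (hp : N * p = l) (hp0 : 0 < p) (hp1 : p ≤ 0.2) :
    ‖cexp (l * (expCircle h t - 1) + (-(l * p / 2) : ℝ) * (expCircle h t - 1) ^ 2)
        - (1 + p * (expCircle h t - 1)) ^ N‖
      ≤ 0.6 * (l * p ^ 2) * ‖expCircle h t - 1‖ ^ 3 * majorant l h t := by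
  have hzn := H.norm_le
  have hl : 0 < l := by linarith [H.one_le]
  have hlp : 0 < l * p := by positivity
  have habs : |-(l * p / 2)| = l * p / 2 := by rw [abs_neg, abs_of_pos (by positivity)]
  have hlp1 : l * p ≤ l * 0.2 := by gcongr
  have hq := re_quadratic_le l (-(l * p / 2)) (expCircle h t - 1)
  have hq' := H.re_quadratic_le_of_abs_le (g := -(l * p / 2)) (by rw [habs]; linarith)
  rw [habs] at hq
  set z := expCircle h t - 1 with hz
  have hn := norm_nonneg z
  have hv : ‖(p * z : ℂ)‖ = p * ‖z‖ := by
    rw [norm_mul, Complex.norm_real, Real.norm_of_nonneg hp0.le]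
  have hv1 : p * ‖z‖ ≤ 0.41 := by nlinarith
  have hlog := norm_log_one_add_sub_quadratic_le (v := p * z) (κ := 0.6) (by rw [hv]; linarith)
    (by rw [hv, div_le_iff₀ (by linarith)]; linarith)
  rw [hv] at hlog
  have hne : 1 + (p : ℂ) * z ≠ 0 := by
    intro h0
    have : ‖(p * z : ℂ)‖ = 1 := by
      rw [eq_neg_of_add_eq_zero_right h0, norm_neg, norm_one]
    rw [hv] at this
    linarith
  have hexp : (1 + p * z) ^ N = cexp (N * log (1 + p * z)) := by
    rw [Complex.exp_nat_mul, Complex.exp_log hne]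
  have e : l * z + (-(l * p / 2) : ℝ) * z ^ 2 - N * log (1 + p * z) =
      -(N * (log (1 + p * z) - (p * z - (p * z) ^ 2 / 2))) := by
    have e1 : (N : ℂ) * p = l := by exact_mod_cast hp
    push_cast
    linear_combination (-z + p * z ^ 2 / 2) * e1
  have hdiff : ‖l * z + (-(l * p / 2) : ℝ) * z ^ 2 - N * log (1 + p * z)‖
      ≤ 0.6 * (l * p ^ 2) * ‖z‖ ^ 3 := by
    rw [e, norm_neg, norm_mul, Complex.norm_natCast]
    refine (mul_le_mul_of_nonneg_left hlog (Nat.cast_nonneg N)).trans (le_of_eq ?_)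
    rw [← hp]; ring
  rw [hexp]
  refine (H.norm_exp_sub_exp_le_majorant hq' ?_).trans
    (mul_le_mul_of_nonneg_right hdiff (Real.exp_pos _).le)
  have h3 : (N * log (1 + p * z)).re ≤ (l * z + (-(l * p / 2) : ℝ) * z ^ 2 : ℂ).re
      + 0.6 * (l * p ^ 2) * ‖z‖ ^ 3 := by
    have := Complex.abs_re_le_norm (l * z + (-(l * p / 2) : ℝ) * z ^ 2 - N * log (1 + p * z))
    rw [Complex.sub_re] at this
    linarith [(abs_le.1 this).1]
  have h4 : 0.6 * (l * p ^ 2) * ‖z‖ ^ 3 ≤ 0.1 * l * ‖z‖ ^ 2 := by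
    calc 0.6 * (l * p ^ 2) * ‖z‖ ^ 3 ≤ 0.6 * (l * 0.2 ^ 2) * ‖z‖ ^ 3 := by gcongr
      _ = 0.6 * (l * 0.2 ^ 2) * ‖z‖ ^ 2 * ‖z‖ := by ring
      _ ≤ 0.6 * (l * 0.2 ^ 2) * ‖z‖ ^ 2 * 2.01 := by gcongr
      _ ≤ _ := by nlinarith [mul_nonneg hl.le (sq_nonneg ‖z‖)]
  have h6 := mul_le_mul_of_nonneg_right hlp1 (sq_nonneg ‖z‖)
  nlinarith [mul_nonneg hl.le (sq_nonneg ‖z‖)]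

end NearUnitCircle

end Comparisons

/-! ### Generating functions of the approximating laws. -/

section GeneratingFunctions

open Complex

theorem hasGenFun_of_hasSum {a : ℕ → ℝ} {f : ℂ → ℂ} {r : ℝ}
    (h : ∀ w, ‖w‖ = r ∨ w = 1 → HasSum (fun k => (a k : ℂ) * w ^ k) (f w)) (h1 : f 1 = 1) :
    HasGenFun a f r := by
  refine ⟨?_, fun w hw => h w (Or.inl hw)⟩
  have := h 1 (Or.inr rfl)
  rw [h1] at this
  rw [← Complex.hasSum_ofReal]
  simpa using this

theorem hasGenFun_compoundMass (l g r : ℝ) :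
    HasGenFun (compoundMass l g) (fun w => cexp (l * (w - 1) + g * (w - 1) ^ 2)) r :=
  hasGenFun_of_hasSum (fun w _ => hasSum_compoundMass l g w) (by simp)

theorem hasGenFun_poissonMass (l r : ℝ) :
    HasGenFun (poissonMass l) (fun w => cexp (l * (w - 1))) r :=
  hasGenFun_of_hasSum (fun w _ => hasSum_poissonMass l w) (by simp)

theorem hasGenFun_poissonMass_add_poissonMass1 (l g r : ℝ) :
    HasGenFun (fun k => poissonMass l k + poissonMass1 l g k)
      (fun w => cexp (l * (w - 1)) + cexp (l * (w - 1)) * (g * (w - 1) ^ 2)) r :=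
  hasGenFun_of_hasSum (fun w _ => by
    simpa [add_mul] using (hasSum_poissonMass l w).add (hasSum_poissonMass1 l g w)) (by simp)

theorem hasGenFun_binMass (N : ℕ) (p r : ℝ) :
    HasGenFun (binMass N p) (fun w => (1 + p * (w - 1)) ^ N) r := by
  refine hasGenFun_of_hasSum (fun w _ => ?_) (by simp)
  have e : (1 + p * (w - 1)) ^ N = ∑ k ∈ Finset.range (N + 1), (binMass N p k : ℂ) * w ^ k := by
    rw [show (1 + p * (w - 1) : ℂ) = p * w + (1 - p) by ring, add_pow]
    refine Finset.sum_congr rfl fun k _ => ?_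
    simp only [binMass]
    push_cast
    ring
  rw [e]
  refine hasSum_sum_of_ne_finset_zero fun k hk => ?_
  have : N < k := by simpa [Nat.lt_succ_iff] using hk
  simp [binMass, Nat.choose_eq_zero_of_lt this]

theorem ring_choose_eq_gamma {r : ℝ} (hr : 0 < r) (k : ℕ) :
    (Ring.choose ((r : ℂ) + k - 1) k : ℂ) =
      ((Real.Gamma (r + k) / (k.factorial * Real.Gamma r) : ℝ) : ℂ) := by
  have h1 := Ring.factorial_nsmul_multichoose_eq_ascPochhammer (r : ℂ) k
  rw [Polynomial.ascPochhammer_smeval_eq_eval, ← Complex.Gamma_add_nat_div_Gamma_eq] at h1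
  · have e : (Ring.choose ((r : ℂ) + k - 1) k : ℂ) = Ring.multichoose (r : ℂ) k := by
      rw [Ring.choose]
      congr 1
      ring
    rw [e]
    have h2 : ((k.factorial : ℕ) : ℂ) ≠ 0 := by exact_mod_cast k.factorial_ne_zero
    rw [nsmul_eq_mul, mul_comm, ← eq_div_iff h2] at h1
    rw [h1, show (r : ℂ) + k = ((r + k : ℝ) : ℂ) by push_cast; rfl, Complex.Gamma_ofReal,
      Complex.Gamma_ofReal]
    push_cast
    rw [div_div, mul_comm (Complex.ofReal _) (k.factorial : ℂ)]
  · intro j hj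
    have : r = -(j : ℝ) := by exact_mod_cast hj
    linarith [Nat.cast_nonneg (α := ℝ) j]

theorem hasSum_nbMass {r q : ℝ} (hr : 0 < r) (hq : 0 < q) {w : ℂ} (hw : ‖(1 - q) * w‖ < 1) :
    HasSum (fun k => (nbMass r q k : ℂ) * w ^ k)
      (cexp (r * (Real.log q - log (1 - (1 - q) * w)))) := by
  have h1 := (Complex.one_div_one_sub_cpow_hasFPowerSeriesOnBall_zero (r : ℂ)).hasSum
    (y := (1 - q) * w) (by
      rw [Metric.mem_eball, edist_zero_right, ← ofReal_norm]
      exact ENNReal.ofReal_lt_one.2 hw)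
  simp only [FormalMultilinearSeries.ofScalars_apply_eq, zero_add, smul_eq_mul] at h1
  have hne : 1 - (1 - q) * w ≠ 0 := by
    intro h
    rw [← sub_eq_zero.1 h, norm_one] at hw
    exact lt_irrefl _ hw
  have h2 := h1.mul_left ((q ^ r : ℝ) : ℂ)
  convert! h2 using 1
  · funext k
    rw [ring_choose_eq_gamma hr]
    simp only [nbMass]
    push_cast
    rw [mul_pow]
    ring
  · rw [Complex.cpow_def_of_ne_zero hne, one_div, ← Complex.exp_neg, Real.rpow_def_of_pos hq,
      Complex.ofReal_exp, ← Complex.exp_add]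
    congr 1
    push_cast
    ring

/-- The negative binomial series converges only for `‖(1 - q) w‖ < 1`; `g ≤ l / 2` ensures `1 - q ≤
1 / 2`, which suffices for radii up to `1.01`. The passage to the variable `w - 1` is the identity
`1 - (1 - q) w = q (1 - (2 g / l) (w - 1))`. -/
theorem hasGenFun_nbMass {l g r : ℝ} (hl : 0 < l) (hg : 0 < g) (hg' : g ≤ l / 2)
    (hr : r ≤ 1.01) :
    HasGenFun (nbMass (nbR l g) (nbQ l g))
      (fun w => cexp (-(nbR l g : ℂ) * log (1 - (2 * g / l : ℝ) * (w - 1)))) r := by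
  have hR : 0 < nbR l g := by unfold nbR; positivity
  have hQ : 0 < nbQ l g := by unfold nbQ; positivity
  have hs : l + 2 * g ≠ 0 := by positivity
  have hQ' : 1 - nbQ l g = 2 * g / (l + 2 * g) := by unfold nbQ; field_simp; ring
  have hQ2 : 1 - nbQ l g ≤ 1 / 2 := by
    rw [hQ', div_le_iff₀ (by positivity)]
    linarith
  have hQ0 : 0 ≤ 1 - nbQ l g := by rw [hQ']; positivity
  refine hasGenFun_of_hasSum (fun w hw => ?_) (by simp)
  have hw1 : ‖w‖ ≤ 1.01 := by
    rcases hw with hw | rfl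
    · linarith
    · norm_num
  have hlt : ‖((1 : ℂ) - (nbQ l g : ℝ)) * w‖ < 1 := by
    rw [norm_mul, ← Complex.ofReal_one, ← Complex.ofReal_sub, Complex.norm_real,
      Real.norm_of_nonneg hQ0]
    nlinarith [norm_nonneg w]
  have hne : 1 - ((1 : ℂ) - (nbQ l g : ℝ)) * w ≠ 0 := by
    intro h
    rw [← sub_eq_zero.1 h, norm_one] at hlt
    exact lt_irrefl _ hlt
  convert! hasSum_nbMass hR hQ hlt using 2
  have e : 1 - ((1 : ℂ) - (nbQ l g : ℝ)) * w
      = (nbQ l g : ℝ) * (1 - (2 * g / l : ℝ) * (w - 1)) := by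
    have hl' : (l : ℂ) ≠ 0 := by exact_mod_cast hl.ne'
    have hs' : (l : ℂ) + 2 * g ≠ 0 := by exact_mod_cast hs
    simp only [nbQ]
    push_cast
    field_simp
    ring
  have hne' : (1 - (2 * g / l : ℝ) * (w - 1) : ℂ) ≠ 0 := by
    intro h
    rw [e, h, mul_zero] at hne
    exact hne rfl
  rw [e, Complex.log_ofReal_mul hQ hne']
  ring

/-- The Poisson parameter is `l` minus the translation, so the law has mean exactly `l`. Reindexing
turns the translated sum into an ordinary distribution function at `x - ⌊-2 * g⌋`. -/
theorem TPdist_eq (l g : ℝ) (x : ℕ) :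
    TPdist l g x = ∑ k ∈ Finset.range ((x : ℤ) - ⌊-2 * g⌋ + 1).toNat,
      poissonMass (l - ⌊-2 * g⌋) k := by
  have hμ : l + 2 * g + Int.fract (-2 * g) = l - ⌊-2 * g⌋ := by
    rw [Int.fract]; ring
  rw [TPdist, hμ]
  refine Finset.sum_nbij' (fun k => (k - ⌊-2 * g⌋).toNat) (fun k => (k : ℤ) + ⌊-2 * g⌋) ?_ ?_ ?_ ?_
    ?_ <;> intro k hk <;> simp at hk ⊢ <;> omega

theorem distFun_add (a b : ℕ → ℝ) (x : ℕ) :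
    distFun (fun k => a k + b k) x = distFun a x + distFun b x := Finset.sum_add_distrib

end GeneratingFunctions

/-! ### From transforms to weighted bounds for distribution functions. -/

section NonuniformComparisons

open Complex

/-- `C` converts bounds for the difference of generating functions near the unit circle into
nonuniform bounds for the difference of distribution functions. -/
def NonuniformConst (B : ℕ) (C : ℝ) : Prop :=
  ∀ (l : ℝ), 1 ≤ l → ∀ (a b : ℕ → ℝ) (f g : ℂ → ℂ) (x y : ℤ) (A : ℝ) (p : ℕ), 0 ≤ A → p ≤ 3 →
    (∀ h, |h| ≤ 1 / 200 → HasGenFun a f (Real.exp h) ∧ HasGenFun b g (Real.exp h)) →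
    (∀ h t, NearUnitCircle l h t → |h| ≤ 1 / (200 * (B + 1)) →
      ‖f (expCircle h t) - expCircle h t ^ (x - y) * g (expCircle h t)‖
        ≤ A * ‖expCircle h t - 1‖ ^ (p + 1) * NearUnitCircle.majorant l h t) →
    (1 + ((x : ℝ) - l) ^ 2 / l) * |(∑ k ∈ Finset.range (x + 1).toNat, a k)
        - ∑ k ∈ Finset.range (y + 1).toNat, b k| ≤ C * (A / √l ^ (p + 1))

theorem exists_nonuniformConst (B : ℕ) : ∃ C, 0 < C ∧ NonuniformConst B C := by
  -- With this `η` the powers `‖w‖ ^ j`, `j ≤ B`, are at most `e ^ (1 / 200) ≤ 1.01`, as the moment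
  -- expansions demand.
  have hη : (0 : ℝ) < 1 / (200 * (B + 1)) := by positivity
  have hη2 : (1 : ℝ) / (200 * (B + 1)) ≤ 1 / 200 := by
    apply one_div_le_one_div_of_le (by norm_num)
    linarith [Nat.cast_nonneg (α := ℝ) B]
  obtain ⟨C, hC, h⟩ := nonuniform_bound (K := 5) hη (by linarith) (show (0 : ℝ) < 0.06 by norm_num)
  refine ⟨C, hC, fun l hl a b f g x y A p hA hp hgen hb => ?_⟩
  refine h l hl a b f g x y A p hA hp fun u hu => ?_
  have h0 : 0 < l := by linarith
  have hs : 1 ≤ √l := Real.one_le_sqrt.2 hl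
  have h1 : |u| ≤ 1 / (200 * (B + 1)) := by
    rw [hu]
    exact div_le_self hη.le hs
  have h2 := hgen u (h1.trans hη2)
  refine ⟨h2.1, h2.2, fun t ht => hb u t ⟨hl, h1.trans hη2, ?_, ht⟩ h1⟩
  rw [← sq_abs, hu, div_pow, Real.sq_sqrt h0.le, mul_div_cancel₀ _ h0.ne']
  nlinarith

namespace NonuniformConst

variable {B : ℕ} {C l g : ℝ}

theorem distFun_sub_le (hC : NonuniformConst B C) (hl : 1 ≤ l) {a b : ℕ → ℝ} {f g : ℂ → ℂ}
    {A : ℝ} {p : ℕ} (hA : 0 ≤ A) (hp : p ≤ 3)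
    (hf : ∀ h, |h| ≤ 1 / 200 → HasGenFun a f (Real.exp h))
    (hg : ∀ h, |h| ≤ 1 / 200 → HasGenFun b g (Real.exp h))
    (hfg : ∀ h t, NearUnitCircle l h t → |h| ≤ 1 / (200 * (B + 1)) →
      ‖f (expCircle h t) - g (expCircle h t)‖
        ≤ A * ‖expCircle h t - 1‖ ^ (p + 1) * NearUnitCircle.majorant l h t) (x : ℕ) :
    (1 + ((x : ℝ) - l) ^ 2 / l) * |distFun a x - distFun b x| ≤ C * (A / √l ^ (p + 1)) := by
  have := hC l hl a b f g x x A p hA hp (fun h hh => ⟨hf h hh, hg h hh⟩)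
    (fun h t H hh => by simpa using hfg h t H hh)
  have e : ((x : ℤ) + 1).toNat = x + 1 := by omega
  rw [e] at this
  exact_mod_cast this

theorem compound_sub_compound_le (hC : NonuniformConst B C) (hl : 1 ≤ l) {g' : ℝ}
    (hg : |g| ≤ 3 / 10 * l + 0.5) (hg' : |g'| ≤ 3 / 10 * l + 0.5) (x : ℕ) :
    (1 + ((x : ℝ) - l) ^ 2 / l) * |distFun (compoundMass l g) x - distFun (compoundMass l g') x|
      ≤ C * (|g - g'| / √l ^ 2) :=
  hC.distFun_sub_le hl (p := 1) (abs_nonneg _) (by norm_num)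
    (fun h _ => hasGenFun_compoundMass l g _) (fun h _ => hasGenFun_compoundMass l g' _)
    (fun _ _ H _ => H.norm_compound_sub_compound_le hg hg') x

theorem compound_sub_poisson_le (hC : NonuniformConst B C) (hl : 1 ≤ l)
    (hg : |g| ≤ 3 / 10 * l + 0.5) (x : ℕ) :
    (1 + ((x : ℝ) - l) ^ 2 / l) * |distFun (compoundMass l g) x - distFun (poissonMass l) x|
      ≤ C * (|g| / √l ^ 2) :=
  hC.distFun_sub_le hl (p := 1) (abs_nonneg _) (by norm_num)
    (fun h _ => hasGenFun_compoundMass l g _) (fun h _ => hasGenFun_poissonMass l _)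
    (fun _ _ H _ => by
      simpa using H.norm_compound_sub_compound_le hg (g' := 0) (by rw [abs_zero]; linarith)) x

theorem compound_sub_poisson1_le (hC : NonuniformConst B C) (hl : 1 ≤ l)
    (hg : |g| ≤ 3 / 10 * l) (x : ℕ) :
    (1 + ((x : ℝ) - l) ^ 2 / l) * |distFun (compoundMass l g) x - distFun (poissonMass l) x
        - distFun (poissonMass1 l g) x| ≤ C * (g ^ 2 / √l ^ 4) := by
  rw [sub_sub, ← distFun_add]
  exact hC.distFun_sub_le hl (p := 3) (sq_nonneg _) (by norm_num)
    (fun h _ => hasGenFun_compoundMass l g _)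
    (fun h _ => hasGenFun_poissonMass_add_poissonMass1 l g _)
    (fun _ _ H _ => H.norm_compound_sub_poisson1_le hg) x

theorem compound_sub_negBinomial_le (hC : NonuniformConst B C) (hl : 1 ≤ l) (hg : 0 < g)
    (hg' : g ≤ 2 / 25 * l) (x : ℕ) :
    (1 + ((x : ℝ) - l) ^ 2 / l)
        * |distFun (compoundMass l g) x - distFun (nbMass (nbR l g) (nbQ l g)) x|
      ≤ C * (2 * g ^ 2 / l / √l ^ 3) :=
  hC.distFun_sub_le hl (p := 2) (by positivity) (by norm_num)
    (fun h _ => hasGenFun_compoundMass l g _)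
    (fun h hh => hasGenFun_nbMass (by linarith) hg (by linarith) (by
      have h1 := abs_le.1 hh
      have h2 := abs_le.1 (Real.abs_exp_sub_one_sub_id_le (x := h) (by linarith))
      nlinarith))
    (fun _ _ H _ => H.norm_compound_sub_negBinomial_le hg hg') x

theorem compound_sub_binomial_le (hC : NonuniformConst B C) (hl : 1 ≤ l) {N : ℕ} {p : ℝ}
    (hp : N * p = l) (hp0 : 0 < p) (hp1 : p ≤ 0.2) (x : ℕ) :
    (1 + ((x : ℝ) - l) ^ 2 / l)
        * |distFun (compoundMass l (-(l * p / 2))) x - distFun (binMass N p) x|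
      ≤ C * (0.6 * (l * p ^ 2) / √l ^ 3) :=
  hC.distFun_sub_le hl (p := 2) (by positivity) (by norm_num)
    (fun h _ => hasGenFun_compoundMass l _ _)
    (fun h _ => hasGenFun_binMass N p _)
    (fun _ _ H _ => H.norm_compound_sub_binomial_le hp hp0 hp1) x

/-- The constant in `NearUnitCircle.norm_compound_sub_translated_le`. -/
noncomputable def translationConst : ℝ :=
  8 * (Real.exp 4 + Real.exp 4 * (4 * Real.exp 4 + 2) / 2)

theorem translationConst_pos : 0 < translationConst := by
  unfold translationConst
  positivity

theorem compound_sub_translated_le (hC : NonuniformConst B C) (hl : 1 ≤ l)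
    (h1 : |((⌊-2 * g⌋ : ℤ) : ℝ)| ≤ 0.5 * l + 1) (h2 : 0.5 * l ≤ l - (⌊-2 * g⌋ : ℤ))
    (h3 : l - (⌊-2 * g⌋ : ℤ) ≤ 3 * l) (x : ℕ) :
    (1 + ((x : ℝ) - l) ^ 2 / l)
        * |distFun (compoundMass l (-(⌊-2 * g⌋ : ℤ) / 2)) x - TPdist l g x|
      ≤ C * (translationConst * |((⌊-2 * g⌋ : ℤ) : ℝ)| / √l ^ 3) := by
  rw [TPdist_eq]
  have := hC l hl (compoundMass l (-(⌊-2 * g⌋ : ℤ) / 2)) (poissonMass (l - (⌊-2 * g⌋ : ℤ)))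
    _ _ x (x - ⌊-2 * g⌋) (translationConst * |((⌊-2 * g⌋ : ℤ) : ℝ)|) 2
    (by have := translationConst_pos; positivity) (by norm_num)
    (fun h _ => ⟨hasGenFun_compoundMass _ _ _, hasGenFun_poissonMass _ _⟩)
    (fun h t H _ => by
      rw [sub_sub_cancel]
      exact H.norm_compound_sub_translated_le h1 h2 h3)
  have e : ((x : ℤ) + 1).toNat = x + 1 := by omega
  rw [e] at this
  exact_mod_cast this

end NonuniformConst

end NonuniformComparisons

/-! ### The effect of rounding the number of trials. -/

section BinomialParameters

/-- As `M ≥ 6.25 * l ≥ 6.25`, rounding down loses at most `0.16 * M`, whence `1 / N ≤ 2.4 * γ / l ^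
2`. The rounding error in the second order coefficient is `γ (M - N) / N`, at most `γ / N`. -/
theorem floor_quotient_bounds {l γ M N : ℝ} (hl : 1 ≤ l) (h0 : 0 < γ) (h1 : γ ≤ 2 / 25 * l)
    (hM : M * (2 * γ) = l ^ 2) (hN : N ≤ M) (hN' : M < N + 1) :
    0 < N ∧ l / N ≤ 0.2 ∧ l * (l / N) ^ 2 ≤ 5.76 * (γ ^ 2 / l) ∧
      |l * (l / N) / 2 - γ| ≤ 2.4 * (γ ^ 2 / l ^ 2) := by
  have hl0 : 0 < l := by linarith
  have h2 : 6.25 * l ≤ M := by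
    by_contra! h
    nlinarith [mul_lt_mul_of_pos_right h h0]
  have hM0 : 0 < M := by linarith
  have h3 : 0.84 * M ≤ N := by linarith
  have hN0 : 0 < N := by linarith
  have h4 : 1 / N ≤ 2.4 * (γ / l ^ 2) := by
    rw [← hM, div_le_iff₀ hN0]
    field_simp
    linarith
  have h5 : l / N ≤ 2.4 * (γ / l) := by
    have := mul_le_mul_of_nonneg_left h4 hl0.le
    calc l / N = l * (1 / N) := by ring
      _ ≤ l * (2.4 * (γ / l ^ 2)) := this
      _ = 2.4 * (γ / l) := by field_simp
  refine ⟨hN0, ?_, ?_, ?_⟩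
  · rw [div_le_iff₀ hN0]
    linarith
  · calc l * (l / N) ^ 2 ≤ l * (2.4 * (γ / l)) ^ 2 := by gcongr
      _ = 5.76 * (γ ^ 2 / l) := by field_simp; norm_num
  · have e : l * (l / N) / 2 - γ = γ * (M - N) * (1 / N) := by
      field_simp
      rw [← hM]
      ring
    rw [e, abs_of_nonneg (mul_nonneg (mul_nonneg h0.le (by linarith)) (by positivity))]
    calc γ * (M - N) * (1 / N) ≤ γ * 1 * (2.4 * (γ / l ^ 2)) := by
          gcongr
          linarith
      _ = 2.4 * (γ ^ 2 / l ^ 2) := by ring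

theorem binomial_parameters {l g : ℝ} (hl : 1 ≤ l) (hg : g < 0) (hg' : |g| ≤ 2 / 25 * l) :
    (0 : ℝ) < binN l g ∧ l / binN l g ≤ 0.2 ∧ l * (l / binN l g) ^ 2 ≤ 5.76 * (g ^ 2 / l) ∧
      |g - -(l * (l / binN l g) / 2)| ≤ 2.4 * (g ^ 2 / l ^ 2) := by
  have h0 : 0 < |g| := abs_pos.2 hg.ne
  have h1 := floor_quotient_bounds hl h0 hg' (M := l ^ 2 / (2 * |g|)) (by field_simp)
    (Nat.floor_le (by positivity)) (Nat.lt_floor_add_one _)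
  rw [sq_abs] at h1
  have e : g - -(l * (l / binN l g) / 2) = l * (l / binN l g) / 2 - |g| := by
    rw [abs_of_neg hg]
    ring
  rw [e]
  exact h1

end BinomialParameters

/-! ### The six estimates for surely bounded variables. -/

section BoundedCase

variable {Ω : Type*} [MeasurableSpace Ω] {P : Measure Ω} [IsProbabilityMeasure P]
  {X : ℤ → Ω → ℕ} {n B : ℕ}

theorem norm_expCircle_pow_le {h t : ℝ} {B j : ℕ} (hh : |h| ≤ 1 / (200 * (B + 1))) (hj : j ≤ B) :
    ‖expCircle h t‖ ^ j ≤ 1.01 := by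
  rw [norm_expCircle, ← Real.exp_nat_mul]
  have h1 : (j : ℝ) * h ≤ 1 / 200 := by
    have hj' : (j : ℝ) ≤ B + 1 := by exact_mod_cast hj.trans (Nat.le_succ B)
    have hB : (0 : ℝ) < B + 1 := by positivity
    calc (j : ℝ) * h ≤ j * |h| := by gcongr; exact le_abs_self h
      _ ≤ (B + 1) * (1 / (200 * (B + 1))) := by gcongr
      _ = 1 / 200 := by field_simp
  have h2 := Real.exp_bound_div_one_sub_of_interval (x := 1 / 200) (by norm_num) (by norm_num)
  calc Real.exp (j * h) ≤ Real.exp (1 / 200) := Real.exp_le_exp.2 h1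
    _ ≤ 1.01 := h2.trans (by norm_num)

theorem mul_abs_sub_le_add {W a b c A A' : ℝ} (hW : 0 ≤ W) (h1 : W * |a - b| ≤ A)
    (h2 : W * |b - c| ≤ A') : W * |a - c| ≤ A + A' := by
  have := mul_le_mul_of_nonneg_left (abs_sub_le a b c) hW
  linarith

theorem weight_nonneg {l : ℝ} (hl : 1 ≤ l) (x : ℕ) : 0 ≤ 1 + ((x : ℝ) - l) ^ 2 / l := by
  positivity

theorem sqrt_pow_three {l : ℝ} (hl : 0 ≤ l) : √l ^ 3 = l * √l := by
  rw [pow_succ, Real.sq_sqrt hl]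

theorem sqrt_pow_four {l : ℝ} (hl : 0 ≤ l) : √l ^ 4 = l ^ 2 := by
  rw [show 4 = 2 * 2 from rfl, pow_mul, Real.sq_sqrt hl]

namespace BoundedOneDependent

/-- The constant in the approximation by the compound Poisson measure. -/
noncomputable def compoundConst (B : ℕ) : ℝ := 8 * ExpandedRecursion.localConst B

theorem compoundConst_nonneg (B : ℕ) : 0 ≤ compoundConst B := by
  unfold compoundConst ExpandedRecursion.localConst
  positivity

theorem cdfS_sub_compound_le (H : BoundedOneDependent P X n B) (hs : SmallMoments P X n)
    (hl : 1 ≤ lam P X n) {C : ℝ} (hC : NonuniformConst B C) (x : ℕ) :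
    (1 + ((x : ℝ) - lam P X n) ^ 2 / lam P X n)
        * |cdfS P X n x - distFun (compoundMass (lam P X n) (Gam2 P X n)) x|
      ≤ C * compoundConst B * (R1 P X n / (lam P X n * √(lam P X n))) := by
  rw [H.cdfS_eq, ← sqrt_pow_three (by linarith), mul_assoc, ← mul_div_assoc]
  refine hC.distFun_sub_le hl (p := 2) (mul_nonneg (compoundConst_nonneg B) H.R1_nonneg)
    (by norm_num) (fun h _ => H.hasGenFun_sumS _) (fun h _ => hasGenFun_compoundMass _ _ _)
    (fun h t hN hh => ?_) x
  refine (H.norm_genFun_sub_exp_le hs (fun j hj => norm_expCircle_pow_le hh hj) hN.norm_le).trans ?_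
  have h0 : 0 ≤ compoundConst B * R1 P X n * ‖expCircle h t - 1‖ ^ (2 + 1) :=
    mul_nonneg (mul_nonneg (compoundConst_nonneg B) H.R1_nonneg) (by positivity)
  refine mul_le_mul_of_nonneg_left (Real.exp_le_exp.2 ?_) h0
  linarith [hN.exponent_le]

variable {C : ℝ}

/-- Both `R₁ / (l √l)` and `|Γ₂| / l` are of order `R₀ / l`, by `R1_le_R0`, `abs_Gam2_le_R0` and `√l
≥ 1`. -/
theorem cdfS_sub_poisson_le (H : BoundedOneDependent P X n B) (hs : SmallMoments P X n)
    (hl : 1 ≤ lam P X n) (hC0 : 0 < C) (hC : NonuniformConst B C) (x : ℕ) :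
    (1 + ((x : ℝ) - lam P X n) ^ 2 / lam P X n)
        * |cdfS P X n x - distFun (poissonMass (lam P X n)) x|
      ≤ C * (compoundConst B * (2 + 4 * B) + 2) * (R0 P X n / lam P X n) := by
  have hg := H.abs_Gam2_le hs
  have h1 := mul_abs_sub_le_add (weight_nonneg hl x) (H.cdfS_sub_compound_le hs hl hC x)
    (hC.compound_sub_poisson_le hl (by linarith) x)
  refine h1.trans ?_
  have hR := H.R1_le_R0 hs.nu_one_le
  have hR0 := H.abs_Gam2_le_R0
  have hR1 := H.R1_nonneg
  have hD := compoundConst_nonneg B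
  set l := lam P X n
  have hl0 : 0 < l := by linarith
  rw [Real.sq_sqrt hl0.le]
  have h2 : R1 P X n / (l * √l) ≤ (2 + 4 * B) * R0 P X n / l := by
    calc R1 P X n / (l * √l) ≤ R1 P X n / (l * 1) := by
          gcongr
          exact Real.one_le_sqrt.2 hl
      _ ≤ (2 + 4 * B) * R0 P X n / l := by rw [mul_one]; gcongr
  calc C * compoundConst B * (R1 P X n / (l * √l)) + C * (|Gam2 P X n| / l)
      ≤ C * compoundConst B * ((2 + 4 * B) * R0 P X n / l) + C * (2 * R0 P X n / l) := by gcongr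
    _ = _ := by ring

theorem cdfS_sub_poisson_sub_poisson1_le (H : BoundedOneDependent P X n B)
    (hs : SmallMoments P X n) (hl : 1 ≤ lam P X n) (hC0 : 0 < C) (hC : NonuniformConst B C)
    (x : ℕ) :
    (1 + ((x : ℝ) - lam P X n) ^ 2 / lam P X n)
        * |cdfS P X n x - distFun (poissonMass (lam P X n)) x
            - distFun (poissonMass1 (lam P X n) (Gam2 P X n)) x|
      ≤ C * (compoundConst B + 4) * (R0 P X n ^ 2 / lam P X n ^ 2
          + R1 P X n / (lam P X n * √(lam P X n))) := by
  have hg := H.abs_Gam2_le hs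
  have h0 := hC.compound_sub_poisson1_le hl (by linarith) x (g := Gam2 P X n)
  rw [sub_sub] at h0 ⊢
  have h1 := mul_abs_sub_le_add (weight_nonneg hl x) (H.cdfS_sub_compound_le hs hl hC x) h0
  refine h1.trans ?_
  have hR0 := H.abs_Gam2_le_R0
  have hR1 := H.R1_nonneg
  have hD := compoundConst_nonneg B
  set l := lam P X n
  have hl0 : 0 < l := by linarith
  rw [sqrt_pow_four hl0.le]
  have h2 : Gam2 P X n ^ 2 ≤ 4 * R0 P X n ^ 2 := by
    rw [← sq_abs]
    nlinarith [abs_nonneg (Gam2 P X n)]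
  have h3 : 0 ≤ C * compoundConst B * (R0 P X n ^ 2 / l ^ 2) := by positivity
  have h4 : 0 ≤ C * 4 * (R1 P X n / (l * √l)) := by positivity
  have h5 : C * (Gam2 P X n ^ 2 / l ^ 2) ≤ C * (4 * R0 P X n ^ 2 / l ^ 2) := by gcongr
  have h6 : C * (4 * R0 P X n ^ 2 / l ^ 2) = 4 * C * (R0 P X n ^ 2 / l ^ 2) := by ring
  linarith

/-- An intermediate compound measure with integer translation `m = ⌊-2 Γ₂⌋` separates two errors.
Rounding `Γ₂` to `-m / 2` costs half the fractional part over `l`, and the third order term of the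
translation costs a multiple of `|m| / (l √l)`. -/
theorem cdfS_sub_translated_le (H : BoundedOneDependent P X n B)
    (hs : SmallMoments P X n) (hl : 1 ≤ lam P X n) (hC0 : 0 < C) (hC : NonuniformConst B C)
    (x : ℕ) :
    (1 + ((x : ℝ) - lam P X n) ^ 2 / lam P X n)
        * |cdfS P X n x - TPdist (lam P X n) (Gam2 P X n) x|
      ≤ C * (compoundConst B + 2 * NonuniformConst.translationConst + 1)
        * ((R1 P X n + |Gam2 P X n|) / (lam P X n * √(lam P X n))
          + Int.fract (-2 * Gam2 P X n) / lam P X n) := by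
  have hg := H.abs_Gam2_le hs
  have hR1 := H.R1_nonneg
  have h0 := H.cdfS_sub_compound_le hs hl hC x
  have hD := compoundConst_nonneg B
  have hT := NonuniformConst.translationConst_pos
  set T := NonuniformConst.translationConst
  set D := compoundConst B
  set l := lam P X n
  set g := Gam2 P X n
  have hl0 : 0 < l := by linarith
  have hfr := Int.fract_nonneg (-2 * g)
  have hfr1 := Int.fract_lt_one (-2 * g)
  have hfl : ((⌊-2 * g⌋ : ℤ) : ℝ) = -2 * g - Int.fract (-2 * g) := by
    rw [Int.fract]; ring
  have h1 := hC.compound_sub_translated_le (g := g) hl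
  have h2 := hC.compound_sub_compound_le (g := g) (g' := -(⌊-2 * g⌋ : ℤ) / 2) hl
    (by linarith)
  simp only [hfl] at h1 h2
  set d := Int.fract (-2 * g)
  have hg2 := abs_le.1 hg
  have hm : |-2 * g - d| ≤ 2 * |g| + d := by
    refine (abs_sub _ _).trans (le_of_eq ?_)
    rw [abs_mul, abs_of_nonneg hfr]
    norm_num
  have h3 := h1 (by linarith) (by linarith) (by linarith) x
  have h4 := h2 (by rw [abs_div, abs_neg, abs_of_pos (show (0 : ℝ) < 2 by norm_num)]; linarith) x
  have h5 := mul_abs_sub_le_add (weight_nonneg hl x) h0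
    (mul_abs_sub_le_add (weight_nonneg hl x) h4 h3)
  refine h5.trans ?_
  have e : g - -(-2 * g - d) / 2 = -(d / 2) := by ring
  rw [e, abs_neg, abs_of_nonneg (by linarith), Real.sq_sqrt hl0.le, sqrt_pow_three hl0.le]
  have h6 : d / (l * √l) ≤ d / l := by
    apply div_le_div_of_nonneg_left hfr hl0
    nlinarith [Real.one_le_sqrt.2 hl]
  have h7 : C * (T * |-2 * g - d| / (l * √l)) ≤ C * (T * (2 * |g| + d) / (l * √l)) := by gcongr
  have h8 : C * (T * (2 * |g| + d) / (l * √l))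
      = 2 * (C * T) * (|g| / (l * √l)) + (C * T) * (d / (l * √l)) := by ring
  have h9 := mul_le_mul_of_nonneg_left h6 (show 0 ≤ C * T by positivity)
  have h10 : 0 ≤ R1 P X n / (l * √l) := by positivity
  have h11 : 0 ≤ |g| / (l * √l) := by positivity
  have h12 : 0 ≤ d / l := by positivity
  have h13 : 0 ≤ C * D := by positivity
  have h14 : 0 ≤ C * T := by positivity
  have h15 : C * (d / 2 / l) = C / 2 * (d / l) := by ring
  rw [add_div, h15]
  linarith [mul_nonneg h14 h10, mul_nonneg hC0.le h10, mul_nonneg h13 h11, mul_nonneg hC0.le h11,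
    mul_nonneg h13 h12, mul_nonneg h14 h12, mul_nonneg hC0.le h12]

theorem cdfS_sub_negBinomial_le (H : BoundedOneDependent P X n B)
    (hs : SmallMoments P X n) (hl : 1 ≤ lam P X n) (hC0 : 0 < C) (hC : NonuniformConst B C)
    (hg0 : 0 < Gam2 P X n) (x : ℕ) :
    (1 + ((x : ℝ) - lam P X n) ^ 2 / lam P X n)
        * |cdfS P X n x
            - distFun (nbMass (nbR (lam P X n) (Gam2 P X n)) (nbQ (lam P X n) (Gam2 P X n))) x|
      ≤ C * (compoundConst B + 2) * (R1 P X n / (lam P X n * √(lam P X n))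
          + Gam2 P X n ^ 2 / (lam P X n ^ 2 * √(lam P X n))) := by
  have hg := (le_abs_self _).trans (H.abs_Gam2_le hs)
  have h1 := mul_abs_sub_le_add (weight_nonneg hl x) (H.cdfS_sub_compound_le hs hl hC x)
    (hC.compound_sub_negBinomial_le hl hg0 hg x)
  refine h1.trans ?_
  have hR1 := H.R1_nonneg
  have hD := compoundConst_nonneg B
  set l := lam P X n
  have hl0 : 0 < l := by linarith
  rw [sqrt_pow_three hl0.le]
  have h3 : 0 ≤ C * compoundConst B * (Gam2 P X n ^ 2 / (l ^ 2 * √l)) := by positivity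
  have h4 : 0 ≤ C * 2 * (R1 P X n / (l * √l)) := by positivity
  have h5 : C * (2 * Gam2 P X n ^ 2 / l / (l * √l))
      = 2 * C * (Gam2 P X n ^ 2 / (l ^ 2 * √l)) := by
    field_simp
  linarith

/-- The binomial law matches a compound measure with `-l p / 2` in place of `Γ₂`. Exchanging the two
costs a multiple of `Γ₂ ^ 2 / l ^ 3`, which is absorbed since `√l ≤ l`. -/
theorem cdfS_sub_binomial_le (H : BoundedOneDependent P X n B)
    (hs : SmallMoments P X n) (hl : 1 ≤ lam P X n) (hC0 : 0 < C) (hC : NonuniformConst B C)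
    (hg0 : Gam2 P X n < 0) (x : ℕ) :
    (1 + ((x : ℝ) - lam P X n) ^ 2 / lam P X n)
        * |cdfS P X n x - distFun (binMass (binN (lam P X n) (Gam2 P X n))
            (lam P X n / binN (lam P X n) (Gam2 P X n))) x|
      ≤ C * (compoundConst B + 6) * (R1 P X n / (lam P X n * √(lam P X n))
          + Gam2 P X n ^ 2 / (lam P X n ^ 2 * √(lam P X n))) := by
  have hg := H.abs_Gam2_le hs
  obtain ⟨hN, hp, hp2, hd⟩ := binomial_parameters hl hg0 hg
  have h0 := H.cdfS_sub_compound_le hs hl hC x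
  have hR1 := H.R1_nonneg
  have hD := compoundConst_nonneg B
  set l := lam P X n
  set g := Gam2 P X n
  have hl0 : 0 < l := by linarith
  set p := l / binN l g with hpdef
  have hp0 : 0 < p := by positivity
  have habs : |-(l * p / 2)| ≤ 3 / 10 * l + 0.5 := by
    rw [abs_neg, abs_of_pos (by positivity)]
    nlinarith
  have h1 := mul_abs_sub_le_add (weight_nonneg hl x) h0
    (mul_abs_sub_le_add (weight_nonneg hl x)
      (hC.compound_sub_compound_le hl (by linarith) habs x)
      (hC.compound_sub_binomial_le hl (by rw [hpdef]; field_simp) hp0 hp x))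
  refine h1.trans ?_
  rw [Real.sq_sqrt hl0.le, sqrt_pow_three hl0.le]
  have hsl : √l ≤ l := by
    rw [Real.sqrt_le_left hl0.le]
    nlinarith
  have h2 : |g - -(l * p / 2)| / l ≤ 2.4 * (g ^ 2 / (l ^ 2 * √l)) := by
    calc |g - -(l * p / 2)| / l ≤ 2.4 * (g ^ 2 / l ^ 2) / l := by gcongr
      _ = 2.4 * (g ^ 2 / (l ^ 2 * l)) := by field_simp
      _ ≤ 2.4 * (g ^ 2 / (l ^ 2 * √l)) := by gcongr
  have h3 : 0.6 * (l * p ^ 2) / (l * √l) ≤ 3.6 * (g ^ 2 / (l ^ 2 * √l)) := by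
    calc 0.6 * (l * p ^ 2) / (l * √l) ≤ 0.6 * (5.76 * (g ^ 2 / l)) / (l * √l) := by gcongr
      _ = 3.456 * (g ^ 2 / (l ^ 2 * √l)) := by field_simp; ring
      _ ≤ 3.6 * (g ^ 2 / (l ^ 2 * √l)) := by gcongr; norm_num
  have h4 := mul_le_mul_of_nonneg_left h2 hC0.le
  have h5 := mul_le_mul_of_nonneg_left h3 hC0.le
  have h6 : 0 ≤ C * compoundConst B * (g ^ 2 / (l ^ 2 * √l)) := by positivity
  have h7 : 0 ≤ C * 6 * (R1 P X n / (l * √l)) := by positivity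
  linarith

end BoundedOneDependent

end BoundedCase

/-! ### Reduction of almost sure bounds to sure bounds. -/

section Truncation

open Finset

variable {Ω : Type*} [MeasurableSpace Ω] {P : Measure Ω} {X Y : ℤ → Ω → ℕ} {n B : ℕ}

/-- The variables with index in `[1, n]`, truncated at `B`. -/
def truncated (X : ℤ → Ω → ℕ) (n B : ℕ) (k : ℤ) (ω : Ω) : ℕ :=
  if 1 ≤ k ∧ k ≤ n then min (X k ω) B else 0

theorem truncated_ae_eq (h0 : ∀ k ≤ 0, X k = 0)
    (hB : ∀ k ∈ Icc (1 : ℤ) n, ∀ᵐ ω ∂P, X k ω ≤ B) (k : ℤ) (hk : k ≤ n) :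
    truncated X n B k =ᵐ[P] X k := by
  by_cases h1 : 1 ≤ k
  · filter_upwards [hB k (mem_Icc.2 ⟨h1, hk⟩)] with ω hω
    simp [truncated, h1, hk, hω]
  · refine Filter.Eventually.of_forall fun ω => ?_
    simp [truncated, h1, h0 k (by omega)]

/-- Truncation is a deterministic function of each variable, so it only shrinks the generated
σ-algebras and one-dependence is inherited. -/
theorem comap_truncated_le {Ω : Type*} (X : ℤ → Ω → ℕ) (n B : ℕ) (k : ℤ) :
    MeasurableSpace.comap (truncated X n B k) inferInstance
      ≤ MeasurableSpace.comap (X k) inferInstance := by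
  have e : truncated X n B k = (fun j => if 1 ≤ k ∧ k ≤ n then min j B else 0) ∘ X k := rfl
  rw [e, ← MeasurableSpace.comap_comp]
  exact MeasurableSpace.comap_mono (measurable_from_top.comap_le)

theorem boundedOneDependent_truncated (hm : ∀ k ∈ Icc (1 : ℤ) n, Measurable (X k))
    (hd : IsMDependent 1 P X n) : BoundedOneDependent P (truncated X n B) n B where
  measurable k := by
    by_cases h : 1 ≤ k ∧ k ≤ n
    · have e : truncated X n B k = (fun j => min j B) ∘ X k := by
        funext ω
        simp [truncated, h]
      rw [e]
      exact measurable_from_top.comp (hm k (mem_Icc.2 h))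
    · have e : truncated X n B k = fun _ => 0 := by
        funext ω
        simp [truncated, h]
      rw [e]
      exact measurable_const
  le k ω := by
    unfold truncated
    split_ifs
    · exact min_le_right _ _
    · exact Nat.zero_le _
  zero k hk := by
    funext ω
    simp only [truncated, Pi.zero_apply, ite_eq_right_iff]
    omega
  dep s t hs hst ht :=
    indep_of_indep_of_le_left (indep_of_indep_of_le_right (hd s t hs hst ht)
      (iSup₂_mono fun i _ => comap_truncated_le X n B i))
      (iSup₂_mono fun i _ => comap_truncated_le X n B i)

theorem nu_congr {k : ℤ} (h : Y k =ᵐ[P] X k) (j : ℕ) : nu P Y j k = nu P X j k :=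
  integral_congr_ae (by filter_upwards [h] with ω hω; simp only [hω])

theorem Eplus2_congr {Y₁ Y₂ Z₁ Z₂ : Ω → ℝ} (h1 : Y₁ =ᵐ[P] Z₁) (h2 : Y₂ =ᵐ[P] Z₂) :
    Eplus2 P Y₁ Y₂ = Eplus2 P Z₁ Z₂ := by
  unfold Eplus2
  rw [integral_congr_ae h1, integral_congr_ae h2, integral_congr_ae (f := fun ω => Y₁ ω * Y₂ ω) (h1.mul h2)]
  rfl

theorem Eplus3_congr {Y₁ Y₂ Y₃ Z₁ Z₂ Z₃ : Ω → ℝ} (h1 : Y₁ =ᵐ[P] Z₁) (h2 : Y₂ =ᵐ[P] Z₂)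
    (h3 : Y₃ =ᵐ[P] Z₃) : Eplus3 P Y₁ Y₂ Y₃ = Eplus3 P Z₁ Z₂ Z₃ := by
  unfold Eplus3
  rw [integral_congr_ae h1, integral_congr_ae h3, integral_congr_ae (f := fun ω => Y₂ ω * Y₃ ω) (h2.mul h3),
    integral_congr_ae (f := fun ω => Y₁ ω * Y₂ ω * Y₃ ω) ((h1.mul h2).mul h3), Eplus2_congr h1 h2]
  rfl

theorem natCast_comp_congr {k : ℤ} (h : Y k =ᵐ[P] X k) :
    (fun ω => (Y k ω : ℝ)) =ᵐ[P] fun ω => (X k ω : ℝ) := by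
  filter_upwards [h] with ω hω
  rw [hω]

theorem mixed_congr {k : ℤ} (h1 : Y (k - 1) =ᵐ[P] X (k - 1)) (h : Y k =ᵐ[P] X k) :
    mixed P Y k = mixed P X k :=
  integral_congr_ae ((natCast_comp_congr h1).mul (natCast_comp_congr h))

theorem Eplus22_congr {k : ℤ} (h1 : Y (k - 1) =ᵐ[P] X (k - 1)) (h : Y k =ᵐ[P] X k) :
    Eplus22 P Y k = Eplus22 P X k := by
  have e : ∀ {j : ℤ}, Y j =ᵐ[P] X j → (fun ω => (Y j ω : ℝ) * ((Y j ω : ℝ) - 1)) =ᵐ[P]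
      fun ω => (X j ω : ℝ) * ((X j ω : ℝ) - 1) := fun h => by
    filter_upwards [h] with ω hω
    rw [hω]
  unfold Eplus22
  rw [Eplus2_congr (e h1) (natCast_comp_congr h), Eplus2_congr (natCast_comp_congr h1) (e h)]

theorem R0_congr (h : ∀ k : ℤ, k ≤ n → Y k =ᵐ[P] X k) : R0 P Y n = R0 P X n :=
  sum_congr rfl fun k hk => by
    have hk := (mem_Icc.1 hk).2
    rw [nu_congr (h k hk), nu_congr (h k hk), mixed_congr (h _ (by omega)) (h k hk)]

theorem R1_congr (h : ∀ k : ℤ, k ≤ n → Y k =ᵐ[P] X k) : R1 P Y n = R1 P X n :=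
  sum_congr rfl fun k hk => by
    have hk := (mem_Icc.1 hk).2
    have h1 := h (k - 1) (by omega)
    have h2 := h (k - 2) (by omega)
    rw [nu_congr (h k hk), nu_congr (h k hk), nu_congr (h k hk), nu_congr h1, nu_congr h2,
      mixed_congr h1 (h k hk), Eplus22_congr h1 (h k hk),
      Eplus3_congr (natCast_comp_congr h2) (natCast_comp_congr h1) (natCast_comp_congr (h k hk))]

theorem sumS_congr (h : ∀ k : ℤ, k ≤ n → Y k =ᵐ[P] X k) : sumS Y n =ᵐ[P] sumS X n := by
  have := (Finset.eventually_all (Icc (1 : ℤ) n) (l := ae P)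
    (p := fun k ω => Y k ω = X k ω)).2 fun k hk => h k (mem_Icc.1 hk).2
  filter_upwards [this] with ω hω
  exact sum_congr rfl hω

theorem lam_congr (h : ∀ k : ℤ, k ≤ n → Y k =ᵐ[P] X k) : lam P Y n = lam P X n :=
  integral_congr_ae (by filter_upwards [sumS_congr h] with ω hω; rw [hω])

theorem Gam2_congr (h : ∀ k : ℤ, k ≤ n → Y k =ᵐ[P] X k) : Gam2 P Y n = Gam2 P X n := by
  unfold Gam2
  rw [lam_congr h, variance_congr (by filter_upwards [sumS_congr h] with ω hω; rw [hω])]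

theorem cdfS_congr (h : ∀ k : ℤ, k ≤ n → Y k =ᵐ[P] X k) (x : ℕ) : cdfS P Y n x = cdfS P X n x :=
  measureReal_congr (by
    filter_upwards [sumS_congr h] with ω hω
    change (sumS Y n ω ≤ x) = (sumS X n ω ≤ x)
    rw [hω])

theorem covariance_congr {Y₁ Y₂ Z₁ Z₂ : Ω → ℝ} (h1 : Y₁ =ᵐ[P] Z₁) (h2 : Y₂ =ᵐ[P] Z₂) :
    covariance Y₁ Y₂ P = covariance Z₁ Z₂ P := by
  unfold covariance
  rw [integral_congr_ae h1, integral_congr_ae h2]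
  refine integral_congr_ae ?_
  filter_upwards [h1, h2] with ω e1 e2
  rw [e1, e2]

theorem BoundedOneDependent.smallMoments [IsProbabilityMeasure P]
    (H : BoundedOneDependent P X n B)
    (h1 : ∀ k ∈ Icc (1 : ℤ) n, nu P X 1 k ≤ 1 / 100 ∧ nu P X 2 k ≤ nu P X 1 k)
    (h2 : ∑ k ∈ Icc (1 : ℤ) n, nu P X 2 k ≤ lam P X n / 20)
    (h3 : ∑ k ∈ Icc (2 : ℤ) n,
      |covariance (fun ω => (X (k - 1) ω : ℝ)) (fun ω => (X k ω : ℝ)) P| ≤ lam P X n / 20) :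
    BoundedOneDependent.SmallMoments P X n := by
  have h0 : ∀ k : ℤ, k ∉ Icc (1 : ℤ) n → ∀ j, j ≠ 0 → nu P X j k = 0 := fun k hk j hj => by
    have : X k = 0 := H.zero k (by rw [mem_Icc] at hk; omega)
    simp [nu, this, Nat.descFactorial_eq_zero_iff_lt.2 (Nat.pos_of_ne_zero hj)]
  have hnu : ∀ k, nu P X 1 k ≤ 1 / 100 := fun k => by
    by_cases hk : k ∈ Icc (1 : ℤ) n
    · exact (h1 k hk).1
    · rw [h0 k hk 1 one_ne_zero]; norm_num
  refine ⟨hnu, fun k => ?_, h2, ?_, ?_⟩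
  · by_cases hk : k ∈ Icc (1 : ℤ) n
    · exact (h1 k hk).2
    · rw [h0 k hk 1 one_ne_zero, h0 k hk 2 two_ne_zero]
  · linarith [H.sum_mixed_le hnu]
  · refine le_trans ?_ h3
    have e : ∑ k ∈ Icc (1 : ℤ) n, (mixed P X k - nu P X 1 (k - 1) * nu P X 1 k)
        = ∑ k ∈ Icc (2 : ℤ) n,
          covariance (fun ω => (X (k - 1) ω : ℝ)) (fun ω => (X k ω : ℝ)) P := by
      simp only [H.covariance_eq]
      symm
      refine sum_subset (Icc_subset_Icc_left (by norm_num)) fun k hk hk' => ?_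
      rw [mem_Icc] at hk hk'
      rw [H.mixed_of_nonpos (by omega), H.nu_of_nonpos one_ne_zero (by omega)]
      ring
    rw [e]
    exact abs_sum_le_sum_abs _ _

theorem smallMoments_truncated [IsProbabilityMeasure P]
    (hm : ∀ k ∈ Icc (1 : ℤ) n, Measurable (X k)) (hd : IsMDependent 1 P X n)
    (h : ∀ k : ℤ, k ≤ n → truncated X n B k =ᵐ[P] X k)
    (h1 : ∀ k ∈ Icc (1 : ℤ) n, nu P X 1 k ≤ 1 / 100 ∧ nu P X 2 k ≤ nu P X 1 k)
    (h2 : ∑ k ∈ Icc (1 : ℤ) n, nu P X 2 k ≤ lam P X n / 20)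
    (h3 : ∑ k ∈ Icc (2 : ℤ) n,
      |covariance (fun ω => (X (k - 1) ω : ℝ)) (fun ω => (X k ω : ℝ)) P| ≤ lam P X n / 20) :
    BoundedOneDependent.SmallMoments P (truncated X n B) n := by
  refine (boundedOneDependent_truncated hm hd).smallMoments (fun k hk => ?_) ?_ ?_
  · rw [nu_congr (h k (mem_Icc.1 hk).2), nu_congr (h k (mem_Icc.1 hk).2)]
    exact h1 k hk
  · rw [lam_congr h]
    refine le_trans (le_of_eq (sum_congr rfl fun k hk => ?_)) h2
    rw [nu_congr (h k (mem_Icc.1 hk).2)]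
  · rw [lam_congr h]
    refine le_trans (le_of_eq (sum_congr rfl fun k hk => ?_)) h3
    have hk := (mem_Icc.1 hk).2
    rw [covariance_congr (natCast_comp_congr (h (k - 1) (by omega)))
      (natCast_comp_congr (h k hk))]

end Truncation

/-! ### Assembly of the six estimates. -/

theorem theorem1 (C₀ : ℝ) :
    ∃ C₁ C₂ C₃ C₄ C₅ C₆ : ℝ,
      0 < C₁ ∧ 0 < C₂ ∧ 0 < C₃ ∧ 0 < C₄ ∧ 0 < C₅ ∧ 0 < C₆ ∧
      ∀ (Ω : Type*) [MeasurableSpace Ω] (P : Measure Ω) [IsProbabilityMeasure P]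
        (n : ℕ) (X : ℤ → Ω → ℕ) (l g : ℝ),
        (∀ k ∈ Finset.Icc (1 : ℤ) n, Measurable (X k)) →
        (∀ k ≤ 0, X k = 0) →
        IsMDependent 1 P X n →
        (∀ k ∈ Finset.Icc (1 : ℤ) n, nu P X 1 k ≤ 1 / 100 ∧ nu P X 2 k ≤ nu P X 1 k ∧
          ∀ᵐ ω ∂P, (X k ω : ℝ) ≤ C₀) →
        l = lam P X n →
        g = Gam2 P X n →
        1 ≤ l →
        ∑ k ∈ Finset.Icc (1 : ℤ) n, nu P X 2 k ≤ l / 20 →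
        ∑ k ∈ Finset.Icc (2 : ℤ) n,
          |covariance (fun ω => (X (k - 1) ω : ℝ)) (fun ω => (X k ω : ℝ)) P| ≤ l / 20 →
        ∀ x : ℕ,
          (1 + (x - l) ^ 2 / l) * |cdfS P X n x - distFun (poissonMass l) x|
            ≤ C₁ * (R0 P X n / l) ∧
          (1 + (x - l) ^ 2 / l) *
              |cdfS P X n x - distFun (poissonMass l) x - distFun (poissonMass1 l g) x|
            ≤ C₂ * (R0 P X n ^ 2 / l ^ 2 + R1 P X n / (l * √l)) ∧
          (1 + (x - l) ^ 2 / l) * |cdfS P X n x - distFun (compoundMass l g) x|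
            ≤ C₃ * (R1 P X n / (l * √l)) ∧
          (1 + (x - l) ^ 2 / l) * |cdfS P X n x - TPdist l g x|
            ≤ C₄ * ((R1 P X n + |g|) / (l * √l) + Int.fract (-2 * g) / l) ∧
          (0 < g →
            (1 + (x - l) ^ 2 / l) * |cdfS P X n x - distFun (nbMass (nbR l g) (nbQ l g)) x|
              ≤ C₅ * (R1 P X n / (l * √l) + g ^ 2 / (l ^ 2 * √l))) ∧
          (g < 0 →
            (1 + (x - l) ^ 2 / l) *
                |cdfS P X n x - distFun (binMass (binN l g) (l / binN l g)) x|
              ≤ C₆ * (R1 P X n / (l * √l) + g ^ 2 / (l ^ 2 * √l))) := by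
  obtain ⟨C, hC0, hC⟩ := exists_nonuniformConst ⌈C₀⌉₊
  have hD := BoundedOneDependent.compoundConst_nonneg ⌈C₀⌉₊
  have hT := NonuniformConst.translationConst_pos
  set D := BoundedOneDependent.compoundConst ⌈C₀⌉₊
  set T := NonuniformConst.translationConst
  refine ⟨C * (D * (2 + 4 * ⌈C₀⌉₊) + 2), C * (D + 4), C * (D + 1), C * (D + 2 * T + 1), C * (D + 2),
    C * (D + 6), ?_, ?_, ?_, ?_, ?_, ?_, fun Ω _ P _ n X l g hm h0 hd hb hl hg h1 h2 h3 => ?_⟩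
  rotate_left 6
  · have hae := truncated_ae_eq (B := ⌈C₀⌉₊) h0 fun k hk => (hb k hk).2.2.mono fun ω hω =>
      Nat.cast_le.1 (hω.trans (Nat.le_ceil C₀))
    have H := boundedOneDependent_truncated (B := ⌈C₀⌉₊) hm hd
    have hs := smallMoments_truncated hm hd hae (fun k hk => ⟨(hb k hk).1, (hb k hk).2.1⟩)
      (hl ▸ h2) (hl ▸ h3)
    rw [← lam_congr hae] at hl
    rw [← Gam2_congr hae] at hg
    rw [← R0_congr hae, ← R1_congr hae]
    subst hl hg
    intro x
    rw [← cdfS_congr hae]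
    refine ⟨H.cdfS_sub_poisson_le hs h1 hC0 hC x,
      H.cdfS_sub_poisson_sub_poisson1_le hs h1 hC0 hC x,
      (H.cdfS_sub_compound_le hs h1 hC x).trans ?_,
      H.cdfS_sub_translated_le hs h1 hC0 hC x,
      fun hg => H.cdfS_sub_negBinomial_le hs h1 hC0 hC hg x,
      fun hg => H.cdfS_sub_binomial_le hs h1 hC0 hC hg x⟩
    -- Only `0 ≤ D` is recorded; `D + 1` makes the constant visibly positive.
    have hR := H.R1_nonneg
    gcongr
    linarith
  all_goals positivity
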